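/- Work on the word RAM: memory cells hold natural numbers of $O(\log N)$ bits, where $N$ is the size of the input plus the largest number occurring in it, and reading or writing a cell, an arithmetic operation and a comparison take one step each. Outside its input a program may not assume anything about the initial memory contents. Let $T(n)$ be such that the distance product $(A\odot B)[i,j]=\min_k\{A[i,k]+B[k,j]\}$ of two $n\times n$ matrices of natural numbers can be computed in time $O(T(n))$ for all $n\ge 1$. A context-free grammar $G=(\mathcal N,\Sigma,\mathcal P,S)$ is in Chomsky normal form if every production has the form $A\to BC$ or $A\to x$ with $A,B,C\in\mathcal N$ and $x\in\Sigma$, or the form $S\to\varepsilon$. Its size $|G|$ is the number of nonterminals plus the total number of symbols (left-hand and right-hand sides) in the productions. The language edit distance is $\mathrm d_G(G,s)=\min_{z\in\mathcal L(G)}\mathrm d_{ed}(s,z)$, where $\mathrm d_{ed}$ is the minimum number of insertions, deletions and substitutions of single symbols that turn $s$ into $z$. (a) Suppose that for some $\gamma>2$ the function $T(n)/n^{\gamma}$ is nondecreasing up to a constant factor, i.e. there is a constant $C$ with $T(m)/m^\gamma\le C\,T(n)/n^\gamma$ for all $1\le m\le n$. Then there is an algorithm which, given any context-free grammar $G$ in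 Chomsky normal form with $\varepsilon\in\mathcal L(G)$ and any $s\in\Sigma^*$, computes $\mathrm d_G(G,s)$ exactly in time $O(|G|^2\,T(n))$, where $n=\max(|s|,1)$. (b) If this growth condition holds only with $\gamma=2$ (in particular if $T(n)=\Theta(n^2)$), the same holds with time $O(|G|^2\,T(n)\log (n+1))$. The algorithm and the implied constants do not depend on $G$ (including $\Sigma$) or $s$. -/

import Mathlib

/-! ### Machine model: a word RAM, programmed in a small structured language

The memory consists of arrays, named by natural numbers, of cells indexed by natural numbers; a
program mentions finitely many arrays. A cell holds a natural number below the word bound `B`.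
-/

/-- A memory state: `σ a i` is the content of cell `i` of array `a`. -/
abbrev RamState : Type := ℕ → ℕ → ℕ

/-- The primitive arithmetical operations of the machine. -/
inductive RamOp : Type
  | add | sub | mul | div | mod | lt | eq

/-- The value of a primitive operation. Subtraction is truncated at `0`, division is rounded down
(with `x / 0 = 0` and `x % 0 = x`), and the comparisons return `1` or `0`. -/
def RamOp.apply : RamOp → ℕ → ℕ → ℕ
  | .add, x, y => x + y
  | .sub, x, y => x - y
  | .mul, x, y => x * y
  | .div, x, y => x / y
  | .mod, x, y => x % y
  | .lt, x, y => if x < y then 1 else 0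
  | .eq, x, y => if x = y then 1 else 0

/-- Expressions: constants, memory reads `a[e]` (with a computed address `e`) and primitive
operations. -/
inductive RamExpr : Type
  | const (v : ℕ)
  | read (a : ℕ) (e : RamExpr)
  | op (o : RamOp) (e₁ e₂ : RamExpr)

/-- The value of an expression in a state. -/
def RamExpr.eval (σ : RamState) : RamExpr → ℕ
  | .const v => v
  | .read a e => σ a (e.eval σ)
  | .op o e₁ e₂ => o.apply (e₁.eval σ) (e₂.eval σ)

/-- The number of steps needed to evaluate an expression: one per constant, read or operation. -/
def RamExpr.cost : RamExpr → ℕ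
  | .const _ => 1
  | .read _ e => e.cost + 1
  | .op _ e₁ e₂ => e₁.cost + e₂.cost + 1

/-- No overflow: every value met while evaluating the expression, addresses included, is a machine
word, i.e. is below the word bound `B`. -/
def RamExpr.Fits (B : ℕ) (σ : RamState) : RamExpr → Prop
  | .const v => v < B
  | .read a e => e.Fits B σ ∧ σ a (e.eval σ) < B
  | .op o e₁ e₂ => e₁.Fits B σ ∧ e₂.Fits B σ ∧ o.apply (e₁.eval σ) (e₂.eval σ) < B

/-- Programs. `assign a e f` stores the value of `f` in cell number `e` of array `a`; `ite e c d`
and `loop e c` (while `e` do `c`) regard a nonzero value of `e` as true. -/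
inductive RamProg : Type
  | skip
  | assign (a : ℕ) (e f : RamExpr)
  | seq (c d : RamProg)
  | ite (e : RamExpr) (c d : RamProg)
  | loop (e : RamExpr) (c : RamProg)

/-- The state after storing the value `v` in cell `i` of array `a`. -/
def RamState.store (σ : RamState) (a i v : ℕ) : RamState :=
  Function.update σ a (Function.update (σ a) i v)

/-- `RamExec B c σ t σ'`: on a machine with word bound `B`, the program `c` started in the state `σ`
halts after exactly `t` steps in the state `σ'`, and no overflow occurs on the way. -/
inductive RamExec (B : ℕ) : RamProg → RamState → ℕ → RamState → Prop
  | skip (σ : RamState) : RamExec B .skip σ 1 σ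
  | assign (a : ℕ) (e f : RamExpr) (σ : RamState) (he : e.Fits B σ) (hf : f.Fits B σ) :
      RamExec B (.assign a e f) σ (e.cost + f.cost + 1) (σ.store a (e.eval σ) (f.eval σ))
  | seq {c d : RamProg} {σ σ' σ'' : RamState} {t u : ℕ}
      (hc : RamExec B c σ t σ') (hd : RamExec B d σ' u σ'') :
      RamExec B (.seq c d) σ (t + u) σ''
  | ite_true {e : RamExpr} {c d : RamProg} {σ σ' : RamState} {t : ℕ}
      (he : e.Fits B σ) (h : e.eval σ ≠ 0) (hc : RamExec B c σ t σ') :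
      RamExec B (.ite e c d) σ (e.cost + 1 + t) σ'
  | ite_false {e : RamExpr} {c d : RamProg} {σ σ' : RamState} {t : ℕ}
      (he : e.Fits B σ) (h : e.eval σ = 0) (hd : RamExec B d σ t σ') :
      RamExec B (.ite e c d) σ (e.cost + 1 + t) σ'
  | loop_true {e : RamExpr} {c : RamProg} {σ σ' σ'' : RamState} {t u : ℕ}
      (he : e.Fits B σ) (h : e.eval σ ≠ 0) (hc : RamExec B c σ t σ')
      (hl : RamExec B (.loop e c) σ' u σ'') :
      RamExec B (.loop e c) σ (e.cost + 1 + t + u) σ''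
  | loop_false {e : RamExpr} {c : RamProg} {σ : RamState}
      (he : e.Fits B σ) (h : e.eval σ = 0) :
      RamExec B (.loop e c) σ (e.cost + 1) σ

/-- Every memory cell holds a machine word. Otherwise the memory is arbitrary: a program may not rely
on cells outside its input being zero. -/
def RamState.IsWord (B : ℕ) (σ : RamState) : Prop := ∀ a i, σ a i < B

/-- Started in `σ`, the program `c` halts within `τ` steps, without overflow, in a state satisfying
`post`. -/
def RamProg.HaltsWithin (B : ℕ) (c : RamProg) (σ : RamState) (τ : ℝ) (post : RamState → Prop) :
    Prop :=
  ∃ (t : ℕ) (σ' : RamState), RamExec B c σ t σ' ∧ (t : ℝ) ≤ τ ∧ post σ'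

/-! ### The distance product -/

/-- The distance product, or (min,+) product, `(X ⊙ Y)[i,j] = min_k (X[i,k] + Y[k,j])`. -/
noncomputable def distanceProduct {n : ℕ} (X Y : Matrix (Fin n) (Fin n) ℕ) :
    Matrix (Fin n) (Fin n) ℕ :=
  fun i j => ⨅ k, X i k + Y k j

/-- The matrix `X` is stored row by row in array `a`. -/
def RamState.HoldsMatrix {n : ℕ} (σ : RamState) (a : ℕ) (X : Matrix (Fin n) (Fin n) ℕ) : Prop :=
  ∀ i j : Fin n, σ a ((i : ℕ) * n + j) = X i j

/-- The distance product of `n × n` matrices can be computed in time `O(T n)`: there is a program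
that reads `n` from cell `0` of array `0` and the factors from arrays `1` and `2`, and leaves the
product in array `3`. Words have `O(log (n + M))` bits where `M` bounds the entries. -/
def DistanceProductInTime (T : ℕ → ℝ) : Prop :=
  ∃ (D : RamProg) (K c : ℕ), ∀ n : ℕ, 1 ≤ n → ∀ (X Y : Matrix (Fin n) (Fin n) ℕ) (M : ℕ),
    (∀ i j, X i j ≤ M) → (∀ i j, Y i j ≤ M) →
    ∀ B : ℕ, (n + M + 2) ^ c ≤ B → ∀ σ : RamState, σ.IsWord B →
      σ 0 0 = n → σ.HoldsMatrix 1 X → σ.HoldsMatrix 2 Y →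
      D.HaltsWithin B σ (K * T n) fun σ' => σ'.HoldsMatrix 3 (distanceProduct X Y)

/-! ### Language edit distance -/

/-- Chomsky normal form: every production is of the form `A → BC`, or `A → x` with a terminal `x`,
or `S → ε` with the start symbol `S`. -/
def ContextFreeGrammar.IsCNF {α : Type*} (G : ContextFreeGrammar α) : Prop :=
  ∀ r ∈ G.rules,
    (∃ B C : G.NT, r.output = [Symbol.nonterminal B, Symbol.nonterminal C]) ∨
    (∃ x : α, r.output = [Symbol.terminal x]) ∨
    (r.input = G.initial ∧ r.output = [])

/-- The size `|G|`: the number of nonterminals plus the total number of symbols, on the left-hand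
and the right-hand sides, of the productions. -/
noncomputable def ContextFreeGrammar.size {α : Type*} (G : ContextFreeGrammar α) : ℕ :=
  Nat.card G.NT + ∑ r ∈ G.rules, (1 + r.output.length)

/-- One edit operation: the insertion, the deletion or the substitution of a single symbol, at any
position of a string. -/
inductive EditStep {α : Type*} : List α → List α → Prop
  | insertion (u v : List α) (x : α) : EditStep (u ++ v) (u ++ x :: v)
  | deletion (u v : List α) (x : α) : EditStep (u ++ x :: v) (u ++ v)
  | substitution (u v : List α) (x y : α) : EditStep (u ++ x :: v) (u ++ y :: v)

/-- `EditsTo k s z`: the string `s` can be turned into `z` by `k` edit operations. -/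
inductive EditsTo {α : Type*} : ℕ → List α → List α → Prop
  | refl (s : List α) : EditsTo 0 s s
  | step {k : ℕ} {s t z : List α} (h : EditStep s t) (hk : EditsTo k t z) : EditsTo (k + 1) s z

/-- The edit distance: the minimum number of edit operations that turn `s` into `z`. -/
noncomputable def editDistance {α : Type*} (s z : List α) : ℕ := sInf {k | EditsTo k s z}

/-- The language edit distance: the minimum, over the words `z` of the language of `G`, of the edit
distance between `s` and `z`. -/
noncomputable def languageEditDistance {α : Type*} (G : ContextFreeGrammar α) (s : List α) : ℕ :=
  sInf ((fun z => editDistance s z) '' {z | z ∈ G.language})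

/-- The production `r` is stored in the cells `p, …, p + 3`: its left-hand side, then a tag `0`, `1`
or `2` (the length of the right-hand side), then the right-hand side. Nonterminals are coded through
the numbering `ν`, terminals by themselves. -/
def HoldsRule {m k : ℕ} {N : Type} (ν : N ≃ Fin k) (r : ContextFreeRule (Fin m) N)
    (mem : ℕ → ℕ) (p : ℕ) : Prop :=
  mem p = ν r.input ∧
    match r.output with
    | [] => mem (p + 1) = 0
    | [Symbol.terminal x] => mem (p + 1) = 1 ∧ mem (p + 2) = x
    | [Symbol.nonterminal B, Symbol.nonterminal C] =>
        mem (p + 1) = 2 ∧ mem (p + 2) = ν B ∧ mem (p + 3) = ν C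
    | _ => False

/-- The grammar `G` and the string `s` are stored in memory, for some numbering of the nonterminals
and some order of the productions. Array `0` holds the number of nonterminals, the start symbol, the
number of productions and the length of `s`; array `1` holds the productions, and array `2` holds
`s`. -/
def RamState.HoldsInstance {m : ℕ} (σ : RamState) (G : ContextFreeGrammar (Fin m))
    (s : List (Fin m)) : Prop :=
  ∃ (k : ℕ) (ν : G.NT ≃ Fin k) (L : List (ContextFreeRule (Fin m) G.NT)),
    L.Nodup ∧ (∀ r, r ∈ L ↔ r ∈ G.rules) ∧
    σ 0 0 = k ∧ σ 0 1 = ν G.initial ∧ σ 0 2 = L.length ∧ σ 0 3 = s.length ∧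
    (∀ (i : ℕ) (h : i < L.length), HoldsRule ν L[i] (σ 1) (4 * i)) ∧
    (∀ (i : ℕ) (h : i < s.length), σ 2 i = s[i])

/-- The language edit distance can be computed exactly in time `O(F |G| n)`, where
`n = max |s| 1`: there is one program that, for every grammar `G` in Chomsky normal form with
`ε ∈ L(G)` over any alphabet `{0, …, m - 1}` and every string `s`, leaves the distance in cell `0` of
array `3`. Words have `O(log (|G| + |s| + m))` bits. -/
def LanguageEditDistanceInTime (F : ℕ → ℕ → ℝ) : Prop :=
  ∃ (P : RamProg) (K c : ℕ), ∀ (m : ℕ) (G : ContextFreeGrammar (Fin m)) (s : List (Fin m)),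
    G.IsCNF → [] ∈ G.language →
    ∀ B : ℕ, (G.size + s.length + m + 2) ^ c ≤ B → ∀ σ : RamState, σ.IsWord B →
      σ.HoldsInstance G s →
      P.HaltsWithin B σ (K * F G.size (max s.length 1)) fun σ' =>
        σ' 3 0 = languageEditDistance G s

/-- `T n / n ^ γ` is nondecreasing in `n ≥ 1` up to a constant factor. -/
def GrowsAtLeastLike (γ : ℝ) (T : ℕ → ℝ) : Prop :=
  ∃ C : ℝ, ∀ m n : ℕ, 1 ≤ m → m ≤ n → T m * (n : ℝ) ^ γ ≤ C * (T n * (m : ℝ) ^ γ)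

/-! ### Reasoning about programs -/

namespace RamState

/-! Let `value A i j` be the least number of edits that turn the part of the string between
positions `i` and `j` into a word derived from `A`, capped at one more than the length of the
string. Since the empty word belongs to the language, deleting everything is always possible. So the
cap does not affect the answer, the value of the start symbol on the whole string, while it keeps
all table entries within machine words. `Parse` describes the competing solutions: a production with
one terminal inserts, substitutes or keeps a symbol, a deletion extends an interval by one position
at either end, and a production `A → BC` joins two intervals at a split `h`.

The splits `h = i` and `h = j` refer back to the cell `(i, j)` itself. They are resolved as in
shortest path problems with nonnegative weights: the cell is relaxed with all productions, once per
nonterminal. By `eq_value_of_relaxed`, a round that finishes no new nonterminal leaves all of them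
finished, so each round before the end finishes at least one more. Over all cells this costs `O(|G|²
n²)`.

The splits `i < h < j` are handled by distance products of blocks, in the manner of Valiant's
algorithm. With `N` a power of two above the length, the cells are visited in the order given by
interleaving the binary digits of `N - 1 - i` and `j`. This order is monotone, so a cell comes after
all cells with larger row and smaller column, and every aligned square of side `2 ^ l` fills one
time interval starting at a multiple of `4 ^ l`. For a split take the last level `l` at which `i`,
`h`, `j` lie in three different blocks of side `2 ^ l`. One level higher `h` merges with `i` or with
`j`, so at level `l` its block is the right neighbour of the block of `i` or the left neighbour of
the block of `j` (`exists_splitAt`). Hence at most two block products per production, made on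
entering a square, account for all its splits of that level, and by `cellTime_lt_of_splitAt` the
entries they need are already final. The invariant is `CodedInstance.Progress`. Table entries only
decrease and never pass below the values (`EditDP.Descends`), so products that also read unfinished
entries do no harm.

There are `O((n / 2 ^ l)²)` squares of side `2 ^ l`, so the products cost `O(|G|)` times the sum of
`(n / 2 ^ l)² T(2 ^ l)`. The growth condition bounds that sum by a multiple of `T(n)` times the sum
of `(2 ^ l / n) ^ (γ - 2)`, which is geometric for `γ > 2` and has `O(log (n + 1))` terms equal to
one for `γ = 2`. The same condition gives `n² = O(T(n))`, which absorbs the remaining work. -/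

@[simp] theorem store_same (σ : RamState) (a i v : ℕ) :
    σ.store a i v a = Function.update (σ a) i v := by
  simp [store]

@[simp] theorem store_ne (σ : RamState) {a a' : ℕ} (i v : ℕ) (h : a' ≠ a) :
    σ.store a i v a' = σ a' := by
  simp [store, h]

theorem store_apply (σ : RamState) (a i v a' i' : ℕ) :
    σ.store a i v a' i' = if a' = a ∧ i' = i then v else σ a' i' := by
  by_cases ha : a' = a
  · subst ha; by_cases hi : i' = i <;> simp [hi]
  · simp [ha]

theorem store_self (σ : RamState) (a i : ℕ) : σ.store a i (σ a i) = σ := by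
  simp [store]

@[simp] theorem store_store (σ : RamState) (a i v w : ℕ) :
    (σ.store a i v).store a i w = σ.store a i w := by
  simp [store]

theorem IsWord.store {B : ℕ} {σ : RamState} (h : σ.IsWord B) {v : ℕ} (hv : v < B) (a i : ℕ) :
    (σ.store a i v).IsWord B := by
  intro a' i'
  rw [store_apply]
  split_ifs
  exacts [hv, h _ _]

end RamState

theorem RamExpr.Fits.eval_lt {B : ℕ} {σ : RamState} : ∀ {e : RamExpr}, e.Fits B σ → e.eval σ < B
  | .const _, h => h
  | .read _ _, h => h.2
  | .op _ _ _, h => h.2.2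

namespace RamProg

/-- The program contains an assignment to the array `a`. -/
@[simp] def Writes : RamProg → ℕ → Prop
  | .skip, _ => False
  | .assign b _ _, a => a = b
  | .seq c d, a => c.Writes a ∨ d.Writes a
  | .ite _ c d, a => c.Writes a ∨ d.Writes a
  | .loop _ c, a => c.Writes a

end RamProg

namespace RamExec

variable {B : ℕ} {c : RamProg} {σ σ' : RamState} {t : ℕ}

theorem frame (h : RamExec B c σ t σ') : ∀ a, ¬ c.Writes a → σ' a = σ a := by
  induction h with
  | skip | loop_false => intros; rfl
  | assign a e f σ => intro a' h; exact RamState.store_ne _ _ _ h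
  | seq _ _ h₁ h₂ =>
    intro a h
    simp only [RamProg.Writes, not_or] at h
    rw [h₂ a h.2, h₁ a h.1]
  | ite_true _ _ _ ih => intro a h; simp only [RamProg.Writes, not_or] at h; exact ih a h.1
  | ite_false _ _ _ ih => intro a h; simp only [RamProg.Writes, not_or] at h; exact ih a h.2
  | loop_true _ _ _ _ h₁ h₂ => intro a h; rw [h₂ a h, h₁ a h]

theorem isWord (h : RamExec B c σ t σ') (hσ : σ.IsWord B) : σ'.IsWord B := by
  induction h with
  | skip | loop_false => exact hσ
  | assign a e f σ he hf => exact hσ.store hf.eval_lt _ _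
  | seq _ _ h₁ h₂ => exact h₂ (h₁ hσ)
  | ite_true _ _ _ ih => exact ih hσ
  | ite_false _ _ _ ih => exact ih hσ
  | loop_true _ _ _ _ h₁ h₂ => exact h₂ (h₁ hσ)

theorem one_le (h : RamExec B c σ t σ') : 1 ≤ t := by
  induction h <;> omega

end RamExec

/-! #### Renaming the arrays of a program -/

/-- The expression reading array `a + d` instead of array `a`. -/
def RamExpr.shift (d : ℕ) : RamExpr → RamExpr
  | .const v => .const v
  | .read a e => .read (a + d) (e.shift d)
  | .op o e₁ e₂ => .op o (e₁.shift d) (e₂.shift d)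

/-- The program using array `a + d` instead of array `a`. -/
def RamProg.shift (d : ℕ) : RamProg → RamProg
  | .skip => .skip
  | .assign a e f => .assign (a + d) (e.shift d) (f.shift d)
  | .seq c₁ c₂ => .seq (c₁.shift d) (c₂.shift d)
  | .ite e c₁ c₂ => .ite (e.shift d) (c₁.shift d) (c₂.shift d)
  | .loop e c => .loop (e.shift d) (c.shift d)

/-- The arrays from `d` on. -/
def RamState.above (d : ℕ) (σ : RamState) : RamState := fun a => σ (a + d)

/-- The state `σ` with the arrays from `d` on replaced by those of `ρ`. -/
def RamState.glue (d : ℕ) (σ ρ : RamState) : RamState := fun a => if a < d then σ a else ρ (a - d)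

section Shift

variable {d B : ℕ} {σ ρ ρ' : RamState}

theorem RamState.glue_above (d : ℕ) (σ : RamState) : σ.glue d (σ.above d) = σ := by
  funext a
  by_cases h : a < d
  · simp [glue, h]
  · simp [glue, h, above, Nat.sub_add_cancel (not_lt.mp h)]

theorem RamState.above_glue (d : ℕ) (σ ρ : RamState) : (σ.glue d ρ).above d = ρ := by
  funext a
  simp [glue, above]

theorem RamState.glue_store (σ ρ : RamState) (a i v : ℕ) :
    (σ.glue d ρ).store (a + d) i v = σ.glue d (ρ.store a i v) := by
  funext a' i'
  rw [store_apply]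
  by_cases h : a' < d
  · have : a' ≠ a + d := by omega
    simp [glue, h, this]
  · simp only [glue, h, if_false, store_apply]
    have : a' = a + d ↔ a' - d = a := by omega
    simp [this]

theorem RamExpr.eval_shift (σ : RamState) (e : RamExpr) :
    (e.shift d).eval σ = e.eval (σ.above d) := by
  induction e with
  | const => rfl
  | read a e ih => simp [shift, eval, ih, RamState.above]
  | op o e₁ e₂ h₁ h₂ => simp [shift, eval, h₁, h₂]

theorem RamExpr.fits_shift (σ : RamState) (e : RamExpr) :
    (e.shift d).Fits B σ ↔ e.Fits B (σ.above d) := by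
  induction e with
  | const => rfl
  | read a e ih => simp [shift, Fits, ih, eval_shift, RamState.above]
  | op o e₁ e₂ h₁ h₂ => simp [shift, Fits, h₁, h₂, eval_shift]

theorem RamExpr.cost_shift (e : RamExpr) : (e.shift d).cost = e.cost := by
  induction e with
  | const => rfl
  | read a e ih => simp [shift, cost, ih]
  | op o e₁ e₂ h₁ h₂ => simp [shift, cost, h₁, h₂]

/-- This makes the given program for distance products callable as a subroutine: after renaming, it
touches none of the arrays below `d`, where the caller keeps its data. -/
theorem RamExec.shift {c : RamProg} {t : ℕ} (h : RamExec B c ρ t ρ') (σ : RamState) :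
    RamExec B (c.shift d) (σ.glue d ρ) t (σ.glue d ρ') := by
  induction h with
  | skip => exact .skip _
  | assign a e f ρ he hf =>
    have := RamExec.assign (B := B) (a + d) (e.shift d) (f.shift d) (σ.glue d ρ)
      (by rwa [RamExpr.fits_shift, RamState.above_glue])
      (by rwa [RamExpr.fits_shift, RamState.above_glue])
    rwa [RamExpr.cost_shift, RamExpr.cost_shift, RamExpr.eval_shift, RamExpr.eval_shift,
      RamState.above_glue, RamState.glue_store] at this
  | seq _ _ h₁ h₂ => exact .seq h₁ h₂
  | ite_true he h _ ih =>
    rw [← RamExpr.cost_shift (d := d)]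
    exact .ite_true (by rwa [RamExpr.fits_shift, RamState.above_glue])
      (by rwa [RamExpr.eval_shift, RamState.above_glue]) ih
  | ite_false he h _ ih =>
    rw [← RamExpr.cost_shift (d := d)]
    exact .ite_false (by rwa [RamExpr.fits_shift, RamState.above_glue])
      (by rwa [RamExpr.eval_shift, RamState.above_glue]) ih
  | loop_true he h _ _ h₁ h₂ =>
    rw [← RamExpr.cost_shift (d := d)]
    exact .loop_true (by rwa [RamExpr.fits_shift, RamState.above_glue])
      (by rwa [RamExpr.eval_shift, RamState.above_glue]) h₁ h₂
  | loop_false he h =>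
    rw [← RamExpr.cost_shift (d := d)]
    exact .loop_false (by rwa [RamExpr.fits_shift, RamState.above_glue])
      (by rwa [RamExpr.eval_shift, RamState.above_glue])

theorem RamProg.le_of_writes_shift {c : RamProg} {a : ℕ} (h : (c.shift d).Writes a) : d ≤ a := by
  induction c with
  | skip => exact h.elim
  | assign => simp only [shift, Writes] at h; omega
  | seq _ _ h₁ h₂ => exact h.elim h₁ h₂
  | ite _ _ _ h₁ h₂ => exact h.elim h₁ h₂
  | loop _ _ ih => exact ih h

end Shift

/-! #### Time-bounded total correctness -/

/-- Started in `σ`, the program `c` halts within `τ` steps, without overflow, in a state satisfying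
`post`; the time bound is a natural number. -/
def RamProg.Runs (B : ℕ) (c : RamProg) (σ : RamState) (τ : ℕ) (post : RamState → Prop) : Prop :=
  ∃ (t : ℕ) (σ' : RamState), RamExec B c σ t σ' ∧ t ≤ τ ∧ post σ'

namespace RamProg

variable {B : ℕ} {c d : RamProg} {σ σ' : RamState} {τ τ' : ℕ} {P Q : RamState → Prop}

/-- The state `σ'` consists of words and agrees with `σ` on the arrays which `c` does not write. -/
structure Stable (B : ℕ) (c : RamProg) (σ σ' : RamState) : Prop where
  isWord : σ'.IsWord B
  frame : ∀ a, ¬ c.Writes a → σ' a = σ a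

theorem Runs.mono (h : Runs B c σ τ P) (hτ : τ ≤ τ') (hP : ∀ σ', P σ' → Q σ') :
    Runs B c σ τ' Q :=
  let ⟨t, σ', h₁, h₂, h₃⟩ := h
  ⟨t, σ', h₁, h₂.trans hτ, hP _ h₃⟩

theorem Runs.stable (h : Runs B c σ τ P) (hσ : σ.IsWord B) :
    Runs B c σ τ fun σ' => P σ' ∧ Stable B c σ σ' :=
  let ⟨t, σ', h₁, h₂, h₃⟩ := h
  ⟨t, σ', h₁, h₂, h₃, h₁.isWord hσ, h₁.frame⟩

theorem Runs.seq (hσ : σ.IsWord B) (h : Runs B c σ τ P)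
    (h' : ∀ σ', P σ' → Stable B c σ σ' → Runs B d σ' τ' Q) : Runs B (.seq c d) σ (τ + τ') Q := by
  obtain ⟨t, σ', h₁, h₂, h₃, h₄⟩ := h.stable hσ
  obtain ⟨u, σ'', h₅, h₆, h₇⟩ := h' σ' h₃ h₄
  exact ⟨_, σ'', .seq h₁ h₅, by omega, h₇⟩

theorem Runs.ite {e : RamExpr} (he : e.Fits B σ) (hc : e.eval σ ≠ 0 → Runs B c σ τ P)
    (hd : e.eval σ = 0 → Runs B d σ τ' P) : Runs B (.ite e c d) σ (e.cost + 1 + max τ τ') P := by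
  by_cases h : e.eval σ = 0
  · obtain ⟨t, σ', h₁, h₂, h₃⟩ := hd h
    exact ⟨_, σ', .ite_false he h h₁, by omega, h₃⟩
  · obtain ⟨t, σ', h₁, h₂, h₃⟩ := hc h
    exact ⟨_, σ', .ite_true he h h₁, by omega, h₃⟩

/-- The predicate transformer of loop-free programs. -/
@[simp] def wp (B : ℕ) : RamProg → RamState → (RamState → Prop) → Prop
  | .skip, σ, Q => Q σ
  | .assign a e f, σ, Q => e.Fits B σ ∧ f.Fits B σ ∧ Q (σ.store a (e.eval σ) (f.eval σ))
  | .seq c d, σ, Q => c.wp B σ fun σ' => σ'.IsWord B → d.wp B σ' Q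
  | .ite e c d, σ, Q =>
    e.Fits B σ ∧ (e.eval σ ≠ 0 → c.wp B σ Q) ∧ (e.eval σ = 0 → d.wp B σ Q)
  | .loop _ _, _, _ => False

/-- The running time of a loop-free program. -/
def maxCost : RamProg → ℕ
  | .skip => 1
  | .assign _ e f => e.cost + f.cost + 1
  | .seq c d => c.maxCost + d.maxCost
  | .ite e c d => e.cost + 1 + max c.maxCost d.maxCost
  | .loop _ _ => 0

theorem runs_of_wp (hσ : σ.IsWord B) (h : c.wp B σ Q) : Runs B c σ c.maxCost Q := by
  induction c generalizing σ Q with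
  | skip => exact ⟨_, σ, .skip σ, le_rfl, h⟩
  | assign a e f => exact ⟨_, _, .assign a e f σ h.1 h.2.1, le_rfl, h.2.2⟩
  | seq c d hc hd => exact (hc hσ h).seq hσ fun σ' h₁ h₂ => hd h₂.isWord (h₁ h₂.isWord)
  | ite e c d hc hd => exact .ite h.1 (fun h' => hc hσ (h.2.1 h')) fun h' => hd hσ (h.2.2 h')
  | loop => exact h.elim

open Finset in
-- The guard is described by a predicate `C` on the number of completed rounds, and failure at `M`
-- forces termination. Rounds after the first failure may be counted in the sum; it is only an upper
-- bound.
theorem runs_loop {e : RamExpr} {σ₀ : RamState} (hσ : σ₀.IsWord B) (Inv : ℕ → RamState → Prop)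
    (C : ℕ → Prop) [DecidablePred C] (M : ℕ) (hM : ¬ C M) (τ : ℕ → ℕ)
    (he : ∀ l σ, Stable B c σ₀ σ → Inv l σ → e.Fits B σ ∧ (e.eval σ ≠ 0 ↔ C l))
    (hc : ∀ l σ, Stable B c σ₀ σ → Inv l σ → C l → Runs B c σ (τ l) (Inv (l + 1)))
    (h₀ : Inv 0 σ₀) :
    Runs B (.loop e c) σ₀ ((∑ l ∈ range M, if C l then τ l + (e.cost + 1) else 0) + (e.cost + 1))
      fun σ' => ∃ m, ¬ C m ∧ (∀ l < m, C l) ∧ Inv m σ' := by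
  -- Induction on the distance `d` to `M`, for a loop entered with `l` rounds already done.
  suffices H : ∀ d l σ, l + d = M → Stable B c σ₀ σ → Inv l σ → (∀ l' < l, C l') →
      Runs B (.loop e c) σ
        ((∑ l ∈ Ico l M, if C l then τ l + (e.cost + 1) else 0) + (e.cost + 1))
        fun σ' => ∃ m, ¬ C m ∧ (∀ l < m, C l) ∧ Inv m σ' by
    have := H M 0 σ₀ (by simp) ⟨hσ, fun _ _ => rfl⟩ h₀ (by simp)
    rwa [range_eq_Ico]
  intro d
  induction d with
  | zero =>
    intro l σ hl hs hI hlt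
    obtain rfl : l = M := by simpa using hl
    obtain ⟨h₁, h₂⟩ := he l σ hs hI
    exact ⟨_, σ, .loop_false h₁ (by_contra fun h => hM (h₂.1 h)), by omega, l, hM, hlt, hI⟩
  | succ d ih =>
    intro l σ hl hs hI hlt
    obtain ⟨h₁, h₂⟩ := he l σ hs hI
    by_cases hC : C l
    · obtain ⟨t, σ', h₃, h₄, h₅, h₆⟩ := (hc l σ hs hI hC).stable hs.isWord
      obtain ⟨u, σ'', h₇, h₈, h₉⟩ := ih (l + 1) σ' (by omega)
        ⟨h₆.isWord, fun a ha => (h₆.frame a ha).trans (hs.frame a ha)⟩ h₅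
        (fun l' hl' => by
          rcases Nat.lt_succ_iff_lt_or_eq.1 hl' with h | rfl
          exacts [hlt _ h, hC])
      refine ⟨_, σ'', .loop_true h₁ (h₂.2 hC) h₃ h₇, ?_, h₉⟩
      rw [sum_eq_sum_Ico_succ_bot (by omega), if_pos hC]
      omega
    · exact ⟨_, σ, .loop_false h₁ (by_contra fun h => hC (h₂.1 h)), by omega, l, hC, hlt, hI⟩

end RamProg

/-- The content of cell `0` of array `x`, used as a register. -/
abbrev RamExpr.reg (x : ℕ) : RamExpr := .read x (.const 0)

/-! ### Counting loops and guarded minima -/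

namespace RamProg

/-- Store a value in the register `x`. -/
abbrev set (x : ℕ) (e : RamExpr) : RamProg := .assign x (.const 0) e

/-- Execute `c` with the register `x` running through `0, 1, …` below the value of `e`. -/
def forLoop (x : ℕ) (e : RamExpr) (c : RamProg) : RamProg :=
  .seq (set x (.const 0))
    (.loop (.op .lt (.reg x) e) (.seq c (set x (.op .add (.reg x) (.const 1)))))

@[simp] theorem writes_forLoop {x : ℕ} {e : RamExpr} {c : RamProg} {a : ℕ} :
    (forLoop x e c).Writes a ↔ a = x ∨ c.Writes a := by
  simp only [forLoop, Writes]
  tauto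

open Finset in
-- The body does not write the counter `x`, and the invariant must ignore its content (`hI`), so
-- initialising and incrementing the counter preserve it. The bound `e` may be a computed expression
-- as long as the loop leaves its value unchanged.
theorem runs_forLoop {B x n : ℕ} {e : RamExpr} {c : RamProg} {σ₀ : RamState} (hσ : σ₀.IsWord B)
    (hn : n < B) (hx : ¬ c.Writes x) (Inv : ℕ → RamState → Prop) (τ : ℕ → ℕ)
    (he : ∀ σ, Stable B (forLoop x e c) σ₀ σ → e.Fits B σ ∧ e.eval σ = n)
    (hI : ∀ t σ v, Inv t σ → Inv t (σ.store x 0 v)) (h₀ : Inv 0 σ₀)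
    (hc : ∀ t σ, Stable B (forLoop x e c) σ₀ σ → t < n → σ x 0 = t → Inv t σ →
      Runs B c σ (τ t) (Inv (t + 1))) :
    Runs B (forLoop x e c) σ₀ ((∑ t ∈ range n, (τ t + (e.cost + 20))) + (e.cost + 20))
      (Inv n) := by
  have hB : 0 < B := by omega
  set σ₁ := σ₀.store x 0 0 with hσ₁
  have hw₁ : σ₁.IsWord B := hσ.store hB _ _
  set b : RamProg := .seq c (set x (.op .add (.reg x) (.const 1))) with hb
  have hst : ∀ σ, Stable B b σ₁ σ → Stable B (forLoop x e c) σ₀ σ := fun σ h =>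
    ⟨h.isWord, fun a ha => by
      have ha' : a ≠ x ∧ ¬ c.Writes a := by simpa using ha
      rw [h.frame a (by simp [hb, ha'.1, ha'.2]), hσ₁, RamState.store_ne _ _ _ ha'.1]⟩
  have hloop := runs_loop (c := b) (e := .op .lt (.reg x) e) hw₁
    (fun l σ => σ x 0 = l ∧ l ≤ n ∧ Inv l σ) (fun l => l < n) n (lt_irrefl n)
    (fun l => τ l + 6)
    (fun l σ hs ⟨h₁, h₂, h₃⟩ => by
      obtain ⟨h₄, h₅⟩ := he σ (hst σ hs)
      constructor
      · simp only [RamExpr.Fits, RamExpr.eval, RamOp.apply, h₅, h₁]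
        exact ⟨⟨hB, by omega⟩, h₄, by split_ifs <;> omega⟩
      · simp [RamExpr.eval, RamOp.apply, h₅, h₁])
    (fun l σ hs ⟨h₁, h₂, h₃⟩ hl => by
      refine Runs.mono (Runs.seq (τ' := 6) hs.isWord (hc l σ (hst σ hs) hl h₁ h₃)
        (fun σ' h hs' => ?_)) le_rfl (fun _ h => h)
      have hx' : σ' x 0 = l := by rw [hs'.frame x hx, h₁]
      refine (runs_of_wp hs'.isWord ?_).mono (by simp [maxCost, RamExpr.cost]) (fun _ h => h)
      simp only [wp, RamExpr.Fits, RamExpr.eval, RamOp.apply, hx']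
      exact ⟨hB, ⟨⟨hB, by omega⟩, by omega, by omega⟩, by simp, by omega, hI _ _ _ h⟩)
    ⟨by simp [hσ₁], by omega, hI _ _ _ h₀⟩
  have hset : Runs B (set x (.const 0)) σ₀ 3 (fun σ' => σ' = σ₁) :=
    (runs_of_wp hσ (by simp [wp, RamExpr.Fits, RamExpr.eval, hB, hσ₁])).mono
      (by simp [maxCost, RamExpr.cost]) (fun _ h => h)
  refine (hset.seq hσ (fun σ' h _ => by subst h; exact hloop)).mono ?_ ?_
  · have : ∀ l ∈ range n, (if l < n then τ l + 6 + ((RamExpr.op .lt (.reg x) e).cost + 1) else 0) ≤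
        τ l + (e.cost + 20) := by
      intro l hl
      rw [if_pos (mem_range.1 hl)]
      simp only [RamExpr.cost]
      omega
    have := sum_le_sum this
    simp only [RamExpr.cost] at this ⊢
    omega
  · rintro σ' ⟨m, h₁, h₂, h₃, h₄, h₅⟩
    obtain rfl : m = n := by omega
    exact h₅

theorem runs_forLoop_const {B x n : ℕ} {e : RamExpr} {c : RamProg} {σ₀ : RamState}
    (hσ : σ₀.IsWord B) (hn : n < B) (hx : ¬ c.Writes x) (Inv : ℕ → RamState → Prop) (τ : ℕ)
    (he : ∀ σ, Stable B (forLoop x e c) σ₀ σ → e.Fits B σ ∧ e.eval σ = n)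
    (hI : ∀ t σ v, Inv t σ → Inv t (σ.store x 0 v)) (h₀ : Inv 0 σ₀)
    (hc : ∀ t σ, Stable B (forLoop x e c) σ₀ σ → t < n → σ x 0 = t → Inv t σ →
      Runs B c σ τ (Inv (t + 1))) :
    Runs B (forLoop x e c) σ₀ (n * (τ + (e.cost + 20)) + (e.cost + 20)) (Inv n) := by
  simpa using runs_forLoop hσ hn hx Inv (fun _ => τ) he hI h₀ hc

/-- If the value of `g` is nonzero, replace the content of the register `x` by its minimum with the
value of `e`. -/
def minIf (x : ℕ) (g e : RamExpr) : RamProg :=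
  .ite g (.ite (.op .lt e (.reg x)) (set x e) .skip) .skip

@[simp] theorem writes_minIf {x : ℕ} {g e : RamExpr} {a : ℕ} : (minIf x g e).Writes a ↔ a = x := by
  simp [minIf]

theorem wp_minIf {B x : ℕ} {g e : RamExpr} {σ : RamState} {Q : RamState → Prop} (hσ : σ.IsWord B)
    (hB : 1 < B) (hg : g.Fits B σ) (he : g.eval σ ≠ 0 → e.Fits B σ)
    (hQ : Q (σ.store x 0 (if g.eval σ ≠ 0 then min (σ x 0) (e.eval σ) else σ x 0))) :
    (minIf x g e).wp B σ Q := by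
  have h0 : 0 < B := by omega
  refine ⟨hg, fun h => ?_, fun h => ?_⟩
  · rw [if_pos h] at hQ
    refine ⟨⟨he h, ⟨h0, hσ _ _⟩, ?_⟩, fun h' => ⟨h0, he h, ?_⟩, fun h' => ?_⟩
    · simp only [RamOp.apply]; split_ifs <;> omega
    · have : e.eval σ < σ x 0 := by
        by_contra h''
        simp [RamExpr.eval, RamOp.apply, h''] at h'
      rwa [min_eq_right this.le] at hQ
    · have : σ x 0 ≤ e.eval σ := by
        by_contra h''
        simp [RamExpr.eval, RamOp.apply, not_le.1 h''] at h'
      rwa [min_eq_left this, RamState.store_self] at hQ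
  · rw [if_neg (by simpa using h), RamState.store_self] at hQ
    exact hQ

end RamProg

/-! ### Instances coded by numbers, and the values of the dynamic program -/

/-- A grammar and a string, as they are laid out in memory. -/
structure CodedInstance where
  /-- The cells holding the productions. -/
  code : ℕ → ℕ
  /-- The cells holding the string. -/
  text : ℕ → ℕ
  /-- The number of nonterminals. -/
  nts : ℕ
  /-- The number of productions. -/
  rules : ℕ
  /-- The length of the string. -/
  len : ℕ

namespace CodedInstance

variable (g : CodedInstance)

/-- The left-hand side of production `r`. -/
def lhs (r : ℕ) : ℕ := g.code (4 * r)

/-- The length of the right-hand side of production `r`. -/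
def tag (r : ℕ) : ℕ := g.code (4 * r + 1)

/-- The first symbol of the right-hand side of production `r`. -/
def fst (r : ℕ) : ℕ := g.code (4 * r + 2)

/-- The second symbol of the right-hand side of production `r`. -/
def snd (r : ℕ) : ℕ := g.code (4 * r + 3)

/-- The nonterminals in the productions are below the number of nonterminals. -/
structure Valid : Prop where
  lhs_lt : ∀ r < g.rules, g.lhs r < g.nts
  fst_lt : ∀ r < g.rules, g.tag r = 2 → g.fst r < g.nts
  snd_lt : ∀ r < g.rules, g.tag r = 2 → g.snd r < g.nts

/-- `Parse A i j c`: the part of the string between the positions `i` and `j` can be turned into a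
word derived from `A` by `c` edit operations. -/
inductive Parse : ℕ → ℕ → ℕ → ℕ → Prop
  | eps {r : ℕ} (hr : r < g.rules) (ht : g.tag r = 0) (i : ℕ) : Parse (g.lhs r) i i 0
  | ins {r : ℕ} (hr : r < g.rules) (ht : g.tag r = 1) (i : ℕ) : Parse (g.lhs r) i i 1
  | sub {r : ℕ} (hr : r < g.rules) (ht : g.tag r = 1) (i : ℕ) : Parse (g.lhs r) i (i + 1) 1
  | keep {r : ℕ} (hr : r < g.rules) (ht : g.tag r = 1) (i : ℕ) (hi : g.text i = g.fst r) :
      Parse (g.lhs r) i (i + 1) 0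
  | delR {A i j c : ℕ} (h : Parse A i j c) : Parse A i (j + 1) (c + 1)
  | delL {A i j c : ℕ} (h : Parse A (i + 1) j c) : Parse A i j (c + 1)
  | bin {r i h j c d : ℕ} (hr : r < g.rules) (ht : g.tag r = 2)
      (hB : Parse (g.fst r) i h c) (hC : Parse (g.snd r) h j d) : Parse (g.lhs r) i j (c + d)

/-- The minimum cost of a parse, capped at one more than the length of the string. -/
noncomputable def value (A i j : ℕ) : ℕ := sInf {c | c = g.len + 1 ∨ g.Parse A i j c}

variable {g}

theorem Parse.le {A i j c : ℕ} (h : g.Parse A i j c) : i ≤ j := by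
  induction h <;> omega

/-- A nonterminal without productions has no parse, so relaxing the cell once per production, at its
left-hand side, also covers the deletions at every relevant nonterminal. -/
theorem Parse.exists_rule {A i j c : ℕ} (h : g.Parse A i j c) : ∃ r < g.rules, g.lhs r = A := by
  induction h with
  | delR _ ih => exact ih
  | delL _ ih => exact ih
  | eps hr | ins hr | sub hr | keep hr | bin hr => exact ⟨_, hr, rfl⟩

theorem Parse.extend {A i j c : ℕ} (h : g.Parse A i j c) (m : ℕ) :
    g.Parse A i (j + m) (c + m) := by
  induction m with
  | zero => exact h
  | succ m ih => exact ih.delR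

theorem value_le_cap (A i j : ℕ) : g.value A i j ≤ g.len + 1 := Nat.sInf_le (Or.inl rfl)

theorem Parse.value_le {A i j c : ℕ} (h : g.Parse A i j c) : g.value A i j ≤ c :=
  Nat.sInf_le (Or.inr h)

theorem value_eq (A i j : ℕ) :
    g.value A i j = g.len + 1 ∨ g.Parse A i j (g.value A i j) :=
  Nat.sInf_mem (s := {c | c = g.len + 1 ∨ g.Parse A i j c}) ⟨_, Or.inl rfl⟩

/-- If a summand equals the cap, so is the right side at least the cap; otherwise two optimal parses
are joined. All block products stay above the values because of this. -/
theorem value_bin {r : ℕ} (hr : r < g.rules) (ht : g.tag r = 2) (i h j : ℕ) :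
    g.value (g.lhs r) i j ≤ g.value (g.fst r) i h + g.value (g.snd r) h j := by
  have := value_le_cap (g := g) (g.lhs r) i j
  rcases value_eq (g := g) (g.fst r) i h with h₁ | h₁
  · omega
  rcases value_eq (g := g) (g.snd r) h j with h₂ | h₂
  · omega
  exact (Parse.bin hr ht h₁ h₂).value_le

theorem value_sub {r : ℕ} (hr : r < g.rules) (ht : g.tag r = 1) (i : ℕ) :
    g.value (g.lhs r) i (i + 1) ≤ if g.text i = g.fst r then 0 else 1 := by
  split_ifs with h
  exacts [(Parse.keep hr ht i h).value_le, (Parse.sub hr ht i).value_le]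

theorem value_delR (A i j : ℕ) : g.value A i (j + 1) ≤ g.value A i j + 1 := by
  have := value_le_cap (g := g) A i (j + 1)
  rcases value_eq (g := g) A i j with h | h
  · omega
  · exact h.delR.value_le

theorem value_delL (A i j : ℕ) : g.value A i j ≤ g.value A (i + 1) j + 1 := by
  have := value_le_cap (g := g) A i j
  rcases value_eq (g := g) A (i + 1) j with h | h
  · omega
  · exact h.delL.value_le

/-- `v` is at most each value that production `r` yields for the cell `(i, j)` without a split
strictly between `i` and `j`. -/
structure Relaxed (g : CodedInstance) (x : ℕ → ℕ → ℕ → ℕ) (r i j v : ℕ) : Prop where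
  delR : i < j → v ≤ x (g.lhs r) i (j - 1) + 1
  delL : i < j → v ≤ x (g.lhs r) (i + 1) j + 1
  binL : g.tag r = 2 → v ≤ x (g.fst r) i i + x (g.snd r) i j
  binR : g.tag r = 2 → v ≤ x (g.fst r) i j + x (g.snd r) j j
  ins : g.tag r = 1 → i = j → v ≤ 1
  sub : g.tag r = 1 → j = i + 1 → v ≤ if g.text i = g.fst r then 0 else 1
  eps : g.tag r = 0 → i = j → v ≤ 0

/-- Raising the table raises the upper bounds and lowering `v` only helps. This transfers the effect
of one relaxation to the table at the start of a round and to the result at its end. -/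
theorem Relaxed.mono {x x' : ℕ → ℕ → ℕ → ℕ} {r i j v v' : ℕ} (h : g.Relaxed x' r i j v)
    (hg : g.Valid) (hr : r < g.rules)
    (hx : ∀ A < g.nts, (i < j → x' A i (j - 1) ≤ x A i (j - 1)) ∧
      (i < j → x' A (i + 1) j ≤ x A (i + 1) j) ∧
      x' A i i ≤ x A i i ∧ x' A i j ≤ x A i j ∧ x' A j j ≤ x A j j)
    (hv : v' ≤ v) : g.Relaxed x r i j v' where
  delR h' := by have := h.delR h'; have := (hx _ (hg.lhs_lt r hr)).1 h'; omega
  delL h' := by have := h.delL h'; have := (hx _ (hg.lhs_lt r hr)).2.1 h'; omega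
  binL h' := by
    have := h.binL h'; have := hx _ (hg.fst_lt r hr h'); have := hx _ (hg.snd_lt r hr h'); omega
  binR h' := by
    have := h.binR h'; have := hx _ (hg.fst_lt r hr h'); have := hx _ (hg.snd_lt r hr h'); omega
  ins h₁ h₂ := hv.trans (h.ins h₁ h₂)
  sub h₁ h₂ := hv.trans (h.sub h₁ h₂)
  eps h₁ h₂ := hv.trans (h.eps h₁ h₂)

/-- The table entries which the cell `(i, j)` depends on, other than those of the cell itself, have
their final values, and the splits strictly between `i` and `j` have been taken into account. -/
structure Ready (g : CodedInstance) (x : ℕ → ℕ → ℕ → ℕ) (i j : ℕ) : Prop where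
  left : i < j → ∀ A < g.nts, x A i (j - 1) = g.value A i (j - 1)
  right : i < j → ∀ A < g.nts, x A (i + 1) j = g.value A (i + 1) j
  diagL : i < j → ∀ A < g.nts, x A i i = g.value A i i
  diagR : i < j → ∀ A < g.nts, x A j j = g.value A j j
  mid : ∀ r < g.rules, g.tag r = 2 → ∀ h, i < h → h < j →
    x (g.lhs r) i j ≤ g.value (g.fst r) i h + g.value (g.snd r) h j
  le_cap : ∀ A < g.nts, x A i j ≤ g.len + 1

/-- The argument of Bellman and Ford: `x` and `y` are the cell before and after a round, and `hend`
says that the round finished nothing new. Induction over parses shows that an optimal parse has only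
finished parts in this cell. The round would then have finished its root, so the root was finished
before. -/
theorem eq_value_of_relaxed (hg : g.Valid) {x : ℕ → ℕ → ℕ → ℕ} {i j : ℕ} (hx : g.Ready x i j)
    {y : ℕ → ℕ} (hy : ∀ A < g.nts, g.value A i j ≤ y A) (hyx : ∀ A < g.nts, y A ≤ x A i j)
    (hr : ∀ r < g.rules, g.Relaxed x r i j (y (g.lhs r)))
    (hend : ∀ A < g.nts, y A = g.value A i j → x A i j = g.value A i j) :
    ∀ A < g.nts, x A i j = g.value A i j := by
  -- The alternative on the right says that the parse is not optimal, which makes the claim usable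
  -- for subparses without choosing optimal ones.
  have key : ∀ A i' j' c, g.Parse A i' j' c → i' = i → j' = j →
      x A i j = g.value A i j ∨ g.value A i j < c := by
    -- It suffices that the round reached cost `c`: either `y` is the value and `hend` applies, or
    -- the value is strictly below `y ≤ c`.
    have done : ∀ r < g.rules, ∀ c, y (g.lhs r) ≤ c →
        x (g.lhs r) i j = g.value (g.lhs r) i j ∨ g.value (g.lhs r) i j < c := by
      intro r hr' c hc
      have h₁ := hy _ (hg.lhs_lt r hr')
      have h₂ := hend _ (hg.lhs_lt r hr')
      by_cases h : y (g.lhs r) = g.value (g.lhs r) i j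
      · exact Or.inl (h₂ h)
      · right; omega
    intro A i' j' c hp
    induction hp with
    | @eps r hr' ht i' =>
      rintro rfl rfl
      exact done _ hr' _ ((hr r hr').eps ht rfl)
    | @ins r hr' ht i' =>
      rintro rfl rfl
      exact done _ hr' _ ((hr r hr').ins ht rfl)
    | @sub r hr' ht i' =>
      rintro rfl rfl
      refine done _ hr' _ (((hr r hr').sub ht rfl).trans ?_)
      split_ifs <;> omega
    | @keep r hr' ht i' hi =>
      rintro rfl rfl
      refine done _ hr' _ (((hr r hr').sub ht rfl).trans ?_)
      rw [if_pos hi]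
    | @delR A i' j' c hp ih =>
      rintro rfl rfl
      have hle := hp.le
      obtain ⟨r, hr', rfl⟩ := hp.exists_rule
      refine done _ hr' _ (((hr r hr').delR (by omega)).trans ?_)
      rw [hx.left (by omega) _ (hg.lhs_lt r hr'), Nat.add_sub_cancel]
      exact Nat.succ_le_succ hp.value_le
    | @delL A i' j' c hp ih =>
      rintro rfl rfl
      have hle := hp.le
      obtain ⟨r, hr', rfl⟩ := hp.exists_rule
      refine done _ hr' _ (((hr r hr').delL (by omega)).trans ?_)
      rw [hx.right (by omega) _ (hg.lhs_lt r hr')]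
      exact Nat.succ_le_succ hp.value_le
    | @bin r i' h j' c d hr' ht hB hC ihB ihC =>
      rintro rfl rfl
      have hBk := hg.fst_lt r hr' ht
      have hCk := hg.snd_lt r hr' ht
      have hBv := hB.value_le
      have hCv := hC.value_le
      have hbin := value_bin hr' ht i' h j'
      have hleB := hB.le
      have hleC := hC.le
      -- Here the first factor covers the whole interval and the second an empty one. If a factor is
      -- known to be suboptimal, so is the whole parse by `value_bin`. Otherwise the first factor is
      -- finished by induction, and the second either by induction (`i' = j'`) or because it lies in
      -- an earlier, diagonal cell. The case `h = i'` is symmetric, and a proper split is covered by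
      -- `Ready.mid`.
      by_cases hB' : h = j'
      · have hb := ihB rfl hB'
        rcases hb with hb | hb
        · by_cases hij : i' = j'
          · have hc := ihC (by omega) rfl
            rcases hc with hc | hc
            · refine done _ hr' _ (((hr r hr').binR ht).trans ?_)
              subst hB' hij
              rw [hb, hc]; omega
            · subst hB' hij; right; omega
          · refine done _ hr' _ (((hr r hr').binR ht).trans ?_)
            subst hB'
            rw [hb, hx.diagR (by omega) _ hCk]
            omega
        · subst hB'; right; omega
      · by_cases hC' : h = i'
        · rcases ihC hC' rfl with hc | hc
          · refine done _ hr' _ (((hr r hr').binL ht).trans ?_)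
            subst hC'
            rw [hc, hx.diagL (by omega) _ hBk]
            omega
          · subst hC'; right; omega
        · refine done _ hr' _ ((hyx _ (hg.lhs_lt r hr')).trans ?_)
          exact (hx.mid r hr' ht h (by omega) (by omega)).trans (by omega)
  intro A hA
  -- Without an optimal parse the value is the cap, and the entry lies between the value and the
  -- cap.
  rcases value_eq (g := g) A i j with h | h
  · have h₁ := hx.le_cap A hA
    have h₂ := hy A hA
    have h₃ := hyx A hA
    omega
  · exact (key A i j _ h rfl rfl).resolve_right (lt_irrefl _)

open Finset in

/-- The number of nonterminals whose entries in a cell have their final values. -/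
noncomputable def finished (g : CodedInstance) (i j : ℕ) (y : ℕ → ℕ) : ℕ :=
  #{A ∈ range g.nts | y A = g.value A i j}

open Finset in
-- Finished entries stay finished. If the set of them does not grow during the round,
-- `eq_value_of_relaxed` says that it was already everything.
theorem finished_lt (hg : g.Valid) {x : ℕ → ℕ → ℕ → ℕ} {i j : ℕ} (hx : g.Ready x i j)
    {y : ℕ → ℕ} (hy : ∀ A < g.nts, g.value A i j ≤ y A) (hyx : ∀ A < g.nts, y A ≤ x A i j)
    (hr : ∀ r < g.rules, g.Relaxed x r i j (y (g.lhs r))) {m : ℕ} (hm : m < g.nts)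
    (h : m ≤ g.finished i j fun A => x A i j) : m + 1 ≤ g.finished i j y := by
  have hsub : {A ∈ range g.nts | x A i j = g.value A i j} ⊆
      {A ∈ range g.nts | y A = g.value A i j} := by
    intro A
    simp only [mem_filter, mem_range]
    rintro ⟨h₁, h₂⟩
    have := hy A h₁
    have := hyx A h₁
    exact ⟨h₁, by omega⟩
  rcases (card_le_card hsub).lt_or_eq with hlt | heq
  · exact Nat.succ_le_of_lt (lt_of_le_of_lt h hlt)
  · have heq' := eq_of_subset_of_card_le hsub heq.ge
    have hall := eq_value_of_relaxed hg hx hy hyx hr (fun A hA hA' => by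
      have : A ∈ ({A ∈ range g.nts | y A = g.value A i j} : Finset ℕ) := by simp [hA, hA']
      rw [← heq'] at this
      simpa [hA] using this)
    rw [finished, ← heq', filter_true_of_mem (fun A hA => hall A (by simpa using hA)), card_range]
    omega

open Finset in
theorem eq_value_of_finished {i j : ℕ} {y : ℕ → ℕ} (h : g.nts ≤ g.finished i j y) :
    ∀ A < g.nts, y A = g.value A i j := by
  have := eq_of_subset_of_card_le (filter_subset (fun A => y A = g.value A i j) (range g.nts))
    (by simpa [finished] using h)
  intro A hA
  have hA' : A ∈ range g.nts := by simpa using hA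
  rw [← this] at hA'
  exact (mem_filter.1 hA').2

end CodedInstance

/-! ### The order of evaluation -/

/-- The number whose binary digits are the binary digits of `t` at the even positions. -/
def evenBits (t : ℕ) : ℕ := if t = 0 then 0 else 2 * evenBits (t / 4) + t % 2

/-- The number whose binary digits are the binary digits of `t` at the odd positions. -/
def oddBits (t : ℕ) : ℕ := if t = 0 then 0 else 2 * oddBits (t / 4) + t % 4 / 2

/-- The number whose binary digits at the even and odd positions are those of `x` and `y`. -/
def interleave (x y : ℕ) : ℕ :=
  if x = 0 ∧ y = 0 then 0 else 4 * interleave (x / 2) (y / 2) + (2 * (y % 2) + x % 2)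
termination_by x + y
decreasing_by omega

theorem evenBits_eq (t : ℕ) : evenBits t = 2 * evenBits (t / 4) + t % 2 := by
  rcases eq_or_ne t 0 with rfl | h
  · simp [evenBits]
  · rw [evenBits, if_neg h]

theorem oddBits_eq (t : ℕ) : oddBits t = 2 * oddBits (t / 4) + t % 4 / 2 := by
  rcases eq_or_ne t 0 with rfl | h
  · simp [oddBits]
  · rw [oddBits, if_neg h]

theorem interleave_eq (x y : ℕ) :
    interleave x y = 4 * interleave (x / 2) (y / 2) + (2 * (y % 2) + x % 2) := by
  by_cases h : x = 0 ∧ y = 0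
  · obtain ⟨rfl, rfl⟩ := h
    simp [interleave]
  · rw [interleave, if_neg h]

theorem evenBits_le (t : ℕ) : evenBits t ≤ t := by
  induction t using Nat.strong_induction_on with
  | _ t ih =>
    rcases eq_or_ne t 0 with rfl | h
    · simp [evenBits]
    · rw [evenBits_eq]
      have := ih (t / 4) (by omega)
      omega

theorem oddBits_le (t : ℕ) : oddBits t ≤ t := by
  induction t using Nat.strong_induction_on with
  | _ t ih =>
    rcases eq_or_ne t 0 with rfl | h
    · simp [oddBits]
    · rw [oddBits_eq]
      have := ih (t / 4) (by omega)
      omega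

theorem bits_lt (L t : ℕ) (h : t < 2 ^ L * 2 ^ L) : evenBits t < 2 ^ L ∧ oddBits t < 2 ^ L := by
  induction L generalizing t with
  | zero =>
    obtain rfl : t = 0 := by simpa using h
    simp [evenBits, oddBits]
  | succ L ih =>
    rw [evenBits_eq, oddBits_eq]
    have := ih (t / 4) (by rw [pow_succ] at h; rw [Nat.div_lt_iff_lt_mul (by norm_num)]; linarith)
    rw [pow_succ]
    omega

/-- Together with `bits_interleave` this makes the order of evaluation a bijection between times and
cells. -/
theorem interleave_bits (t : ℕ) : interleave (evenBits t) (oddBits t) = t := by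
  induction t using Nat.strong_induction_on with
  | _ t ih =>
    rcases eq_or_ne t 0 with rfl | h
    · simp [evenBits, oddBits, interleave]
    · rw [interleave_eq, evenBits_eq, oddBits_eq]
      have h₁ : (2 * evenBits (t / 4) + t % 2) / 2 = evenBits (t / 4) := by omega
      have h₂ : (2 * oddBits (t / 4) + t % 4 / 2) / 2 = oddBits (t / 4) := by omega
      rw [h₁, h₂, ih (t / 4) (by omega)]
      omega

theorem bits_interleave (x y : ℕ) :
    evenBits (interleave x y) = x ∧ oddBits (interleave x y) = y := by
  induction hs : x + y using Nat.strong_induction_on generalizing x y with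
  | _ s ih =>
    by_cases h : x = 0 ∧ y = 0
    · obtain ⟨rfl, rfl⟩ := h
      simp [evenBits, oddBits, interleave]
    · have hi := ih (x / 2 + y / 2) (by omega) (x / 2) (y / 2) rfl
      rw [evenBits_eq, oddBits_eq, interleave_eq]
      have h₁ : (4 * interleave (x / 2) (y / 2) + (2 * (y % 2) + x % 2)) / 4 =
        interleave (x / 2) (y / 2) := by omega
      rw [h₁, hi.1, hi.2]
      omega

theorem interleave_lt (L x y : ℕ) (hx : x < 2 ^ L) (hy : y < 2 ^ L) :
    interleave x y < 2 ^ L * 2 ^ L := by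
  induction L generalizing x y with
  | zero =>
    obtain rfl : x = 0 := by simpa using hx
    obtain rfl : y = 0 := by simpa using hy
    simp [interleave]
  | succ L ih =>
    rw [pow_succ] at hx hy
    have := ih (x / 2) (y / 2) (by omega) (by omega)
    rw [interleave_eq, pow_succ]
    have e : 2 ^ L * 2 * (2 ^ L * 2) = 4 * (2 ^ L * 2 ^ L) := by ring
    omega

/-- The interleaving of the halves decides unless it is equal for both pairs; then the halves agree
by injectivity and the two lowest digits decide. -/
theorem interleave_mono {x y x' y' : ℕ} (hx : x ≤ x') (hy : y ≤ y') :
    interleave x y ≤ interleave x' y' := by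
  induction hs : x' + y' using Nat.strong_induction_on generalizing x y x' y' with
  | _ s ih =>
    by_cases h : x' = 0 ∧ y' = 0
    · obtain ⟨rfl, rfl⟩ := h
      obtain rfl : x = 0 := by omega
      obtain rfl : y = 0 := by omega
      rfl
    · have hi := ih (x' / 2 + y' / 2) (by omega) (x := x / 2) (y := y / 2) (x' := x' / 2)
        (y' := y' / 2) (by omega) (by omega) rfl
      rw [interleave_eq x y, interleave_eq x' y']
      rcases hi.lt_or_eq with hlt | heq
      · omega
      · have h₁ := bits_interleave (x / 2) (y / 2)
        have h₂ := bits_interleave (x' / 2) (y' / 2)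
        rw [heq] at h₁
        have e₁ := h₁.1.symm.trans h₂.1
        have e₂ := h₁.2.symm.trans h₂.2
        omega

theorem interleave_lt_interleave {x y x' y' : ℕ} (hx : x ≤ x') (hy : y ≤ y')
    (h : x < x' ∨ y < y') : interleave x y < interleave x' y' := by
  refine lt_of_le_of_ne (interleave_mono hx hy) fun heq => ?_
  have h₁ := bits_interleave x y
  have h₂ := bits_interleave x' y'
  rw [heq] at h₁
  omega

/-- Dropping the lowest `l` digits of both coordinates drops the lowest `2 l` digits of the time. So
dividing times by `4 ^ l` identifies exactly the cells of one aligned square of side `2 ^ l`. -/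
theorem interleave_div (l x y : ℕ) :
    interleave (x / 2 ^ l) (y / 2 ^ l) = interleave x y / (2 ^ l * 2 ^ l) := by
  induction l with
  | zero => simp
  | succ l ih =>
    have e : 2 ^ (l + 1) * 2 ^ (l + 1) = (2 ^ l * 2 ^ l) * 4 := by ring
    rw [e, ← Nat.div_div_eq_div_mul, ← ih, pow_succ, ← Nat.div_div_eq_div_mul,
      ← Nat.div_div_eq_div_mul, interleave_eq (x / 2 ^ l) (y / 2 ^ l)]
    omega

theorem dvd_bits (l t : ℕ) (h : 2 ^ l * 2 ^ l ∣ t) : 2 ^ l ∣ evenBits t ∧ 2 ^ l ∣ oddBits t := by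
  induction l generalizing t with
  | zero => simp
  | succ l ih =>
    have e : 2 ^ (l + 1) * 2 ^ (l + 1) = 4 * (2 ^ l * 2 ^ l) := by ring
    rw [e] at h
    obtain ⟨w, rfl⟩ := h
    have hi := ih (2 ^ l * 2 ^ l * w) (dvd_mul_right _ _)
    rw [evenBits_eq, oddBits_eq, mul_assoc 4]
    have h₁ : 4 * (2 ^ l * 2 ^ l * w) / 4 = 2 ^ l * 2 ^ l * w := by omega
    have h₂ : 4 * (2 ^ l * 2 ^ l * w) % 2 = 0 := by omega
    have h₃ : 4 * (2 ^ l * 2 ^ l * w) % 4 / 2 = 0 := by omega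
    rw [h₁, h₂, h₃, pow_succ, mul_comm (2 ^ l) 2, add_zero, add_zero]
    exact ⟨Nat.mul_dvd_mul_left 2 hi.1, Nat.mul_dvd_mul_left 2 hi.2⟩

/-! ### Edit distance and alignments -/

/-- An alignment of two strings with `k` edit operations. -/
inductive Align {α : Type*} : ℕ → List α → List α → Prop
  | nil : Align 0 [] []
  | keep {k : ℕ} {s z : List α} (x : α) (h : Align k s z) : Align k (x :: s) (x :: z)
  | subst {k : ℕ} {s z : List α} (x y : α) (h : Align k s z) : Align (k + 1) (x :: s) (y :: z)
  | del {k : ℕ} {s z : List α} (x : α) (h : Align k s z) : Align (k + 1) (x :: s) z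
  | ins {k : ℕ} {s z : List α} (y : α) (h : Align k s z) : Align (k + 1) s (y :: z)

namespace Align

variable {α : Type*} {k l : ℕ} {s t s' z z' : List α}

theorem refl : ∀ s : List α, Align 0 s s
  | [] => nil
  | x :: s => (refl s).keep x

theorem of_nil : ∀ s : List α, Align s.length s []
  | [] => nil
  | x :: s => (of_nil s).del x

theorem length_eq (h : Align k s []) : k = s.length := by
  generalize hz : ([] : List α) = z at h
  induction h with
  | nil => rfl
  | keep | subst | ins => exact absurd hz (by simp)
  | del x h ih => simp [ih hz]

theorem append (h : Align k s z) (h' : Align l s' z') : Align (k + l) (s ++ s') (z ++ z') := by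
  induction h with
  | nil => simpa using h'
  | keep x _ ih => exact ih.keep x
  | subst x y _ ih => simpa [add_right_comm] using ih.subst x y
  | del x _ ih => simpa [add_right_comm] using ih.del x
  | ins y _ ih => simpa [add_right_comm] using ih.ins y

/-- An alignment runs through both strings from left to right, so cutting `z` cuts `s`; deletions at
the cut are given to the left part. -/
theorem split_right (h : Align k s (z ++ z')) : ∃ s₁ s₂ k₁ k₂, s = s₁ ++ s₂ ∧ k = k₁ + k₂ ∧
    Align k₁ s₁ z ∧ Align k₂ s₂ z' := by
  generalize hw : z ++ z' = w at h
  induction h generalizing z with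
  | nil =>
    obtain ⟨rfl, rfl⟩ := List.append_eq_nil_iff.1 hw
    exact ⟨[], [], 0, 0, rfl, rfl, .nil, .nil⟩
  | @keep k s w x h ih =>
    cases z with
    | nil => obtain rfl : z' = _ := hw; exact ⟨[], _, 0, _, rfl, (zero_add _).symm, .nil, h.keep x⟩
    | cons y z =>
      simp only [List.cons_append, List.cons.injEq] at hw
      obtain ⟨rfl, hw⟩ := hw
      obtain ⟨s₁, s₂, k₁, k₂, rfl, rfl, h₁, h₂⟩ := ih hw
      exact ⟨_, _, _, _, rfl, rfl, h₁.keep y, h₂⟩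
  | @subst k s w x y h ih =>
    cases z with
    | nil =>
      obtain rfl : z' = _ := hw; exact ⟨[], _, 0, _, rfl, (zero_add _).symm, .nil, h.subst x y⟩
    | cons y z =>
      simp only [List.cons_append, List.cons.injEq] at hw
      obtain ⟨rfl, hw⟩ := hw
      obtain ⟨s₁, s₂, k₁, k₂, rfl, rfl, h₁, h₂⟩ := ih hw
      exact ⟨_, _, k₁ + 1, k₂, rfl, by omega, h₁.subst x y, h₂⟩
  | @del k s w x h ih =>
    obtain ⟨s₁, s₂, k₁, k₂, rfl, rfl, h₁, h₂⟩ := ih hw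
    exact ⟨_, _, k₁ + 1, k₂, rfl, by omega, h₁.del x, h₂⟩
  | @ins k s w y h ih =>
    cases z with
    | nil => obtain rfl : z' = _ := hw; exact ⟨[], _, 0, _, rfl, (zero_add _).symm, .nil, h.ins y⟩
    | cons y z =>
      simp only [List.cons_append, List.cons.injEq] at hw
      obtain ⟨rfl, hw⟩ := hw
      obtain ⟨s₁, s₂, k₁, k₂, rfl, rfl, h₁, h₂⟩ := ih hw
      exact ⟨_, _, k₁ + 1, k₂, rfl, by omega, h₁.ins y, h₂⟩

theorem symm (h : Align k s z) : Align k z s := by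
  induction h with
  | nil => exact nil
  | keep x _ ih => exact ih.keep x
  | subst x y _ ih => exact ih.subst y x
  | del x _ ih => exact ih.ins x
  | ins y _ ih => exact ih.del y

theorem tail {x : α} (h : Align k (x :: s) z) : ∃ k' ≤ k + 1, Align k' s z := by
  generalize hw : x :: s = w at h
  induction h with
  | nil => exact absurd hw (by simp)
  | keep y h =>
    obtain ⟨rfl, rfl⟩ := List.cons.inj hw
    exact ⟨_, le_rfl, h.ins x⟩
  | subst _ y h =>
    obtain ⟨rfl, rfl⟩ := List.cons.inj hw
    exact ⟨_, by omega, h.ins y⟩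
  | del _ h =>
    obtain ⟨rfl, rfl⟩ := List.cons.inj hw
    exact ⟨_, by omega, h⟩
  | ins y _ ih =>
    obtain ⟨k', hk', h⟩ := ih hw
    exact ⟨_, by omega, h.ins y⟩

theorem replace_head {x : α} (y : α) (h : Align k (x :: s) z) :
    ∃ k' ≤ k + 1, Align k' (y :: s) z := by
  generalize hw : x :: s = w at h
  induction h with
  | nil => exact absurd hw (by simp)
  | keep x' h =>
    obtain ⟨rfl, rfl⟩ := List.cons.inj hw
    exact ⟨_, le_rfl, h.subst y x⟩
  | subst _ y' h =>
    obtain ⟨rfl, rfl⟩ := List.cons.inj hw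
    exact ⟨_, by omega, h.subst y y'⟩
  | del _ h =>
    obtain ⟨rfl, rfl⟩ := List.cons.inj hw
    exact ⟨_, by omega, h.del y⟩
  | ins y' _ ih =>
    obtain ⟨k', hk', h⟩ := ih hw
    exact ⟨_, by omega, h.ins y'⟩

/-- Cutting the alignment at the place of the edit reduces the claim to an edit of the first symbol,
treated in `tail` and `replace_head`. Iterated, it turns edits in arbitrary order into one alignment
that is no more expensive. -/
theorem of_editStep (hst : EditStep s t) (h : Align k t z) : ∃ k' ≤ k + 1, Align k' s z := by
  have key : ∀ (u v v' : List α), Align k (u ++ v) z →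
      (∀ l w, Align l v w → ∃ l' ≤ l + 1, Align l' v' w) → ∃ k' ≤ k + 1, Align k' (u ++ v') z := by
    intro u v v' h hv
    obtain ⟨s₁, s₂, k₁, k₂, rfl, rfl, h₁, h₂⟩ := h.symm.split_right
    obtain ⟨k', hk', h'⟩ := hv _ _ h₂.symm
    exact ⟨_, by omega, h₁.symm.append h'⟩
  cases hst with
  | insertion u v x => exact key u _ _ h fun l w hl => hl.tail
  | deletion u v x => exact key u _ _ h fun l w hl => ⟨_, le_rfl, hl.del x⟩
  | substitution u v x y => exact key u _ _ h fun l w hl => hl.replace_head x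

end Align

theorem EditsTo.exists_align {α : Type*} {k : ℕ} {s z : List α} (h : EditsTo k s z) :
    ∃ k' ≤ k, Align k' s z := by
  induction h with
  | refl s => exact ⟨0, le_rfl, Align.refl s⟩
  | step h _ ih =>
    obtain ⟨k', hk', h'⟩ := ih
    obtain ⟨k'', hk'', h''⟩ := h'.of_editStep h
    exact ⟨k'', by omega, h''⟩

theorem EditsTo.cons {α : Type*} {k : ℕ} {s z : List α} (x : α) (h : EditsTo k s z) :
    EditsTo k (x :: s) (x :: z) := by
  induction h with
  | refl s => exact .refl _
  | step h _ ih =>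
    refine .step ?_ ih
    cases h with
    | insertion u v y => exact .insertion (x :: u) v y
    | deletion u v y => exact .deletion (x :: u) v y
    | substitution u v y y' => exact .substitution (x :: u) v y y'

theorem Align.editsTo {α : Type*} {k : ℕ} {s z : List α} (h : Align k s z) : EditsTo k s z := by
  induction h with
  | nil => exact .refl _
  | keep x _ ih => exact ih.cons x
  | @subst k s z x y _ ih => exact .step (.substitution [] s x y) (ih.cons y)
  | @del k s z x _ ih => exact .step (.deletion [] s x) ih
  | @ins k s z y _ ih => exact .step (.insertion [] s y) (ih.cons y)

theorem editDistance_le {α : Type*} {k : ℕ} {s z : List α} (h : Align k s z) :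
    editDistance s z ≤ k :=
  Nat.sInf_le h.editsTo

theorem exists_align_le_editDistance {α : Type*} (s z : List α) :
    ∃ k ≤ editDistance s z, Align k s z := by
  have h : (Align (s.length + z.length) (s ++ []) ([] ++ z)) :=
    (Align.of_nil s).append (Align.of_nil z).symm
  rw [List.append_nil, List.nil_append] at h
  exact (Nat.sInf_mem (s := {k | EditsTo k s z}) ⟨_, h.editsTo⟩).exists_align

/-! ### Derivations of grammars in Chomsky normal form -/

namespace ContextFreeGrammar

variable {α : Type*} (G : ContextFreeGrammar α)

/-- `G.Yields A w`: there is a parse tree with root `A` and yield `w`, the productions being those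
of Chomsky normal form. -/
inductive Yields : G.NT → List α → Prop
  | empty {r : ContextFreeRule α G.NT} (hr : r ∈ G.rules) (ho : r.output = []) : Yields r.input []
  | leaf {r : ContextFreeRule α G.NT} {x : α} (hr : r ∈ G.rules)
      (ho : r.output = [Symbol.terminal x]) : Yields r.input [x]
  | pair {r : ContextFreeRule α G.NT} {B C : G.NT} {u v : List α} (hr : r ∈ G.rules)
      (ho : r.output = [Symbol.nonterminal B, Symbol.nonterminal C]) (hB : Yields B u)
      (hC : Yields C v) : Yields r.input (u ++ v)

/-- The words obtained from a sentential form by replacing each nonterminal by one of its yields. -/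
def FormYields : List (Symbol α G.NT) → List α → Prop
  | [], w => w = []
  | .terminal x :: f, w => ∃ v, w = x :: v ∧ FormYields f v
  | .nonterminal A :: f, w => ∃ u v, w = u ++ v ∧ G.Yields A u ∧ FormYields f v

variable {G}

theorem formYields_map_terminal (w : List α) : G.FormYields (w.map Symbol.terminal) w := by
  induction w with
  | nil => rfl
  | cons x w ih => exact ⟨w, rfl, ih⟩

theorem FormYields.split {f f' : List (Symbol α G.NT)} {w : List α}
    (h : G.FormYields (f ++ f') w) :
    ∃ u v, w = u ++ v ∧ G.FormYields f u ∧ G.FormYields f' v := by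
  induction f generalizing w with
  | nil => exact ⟨[], w, rfl, rfl, h⟩
  | cons a f ih =>
    cases a with
    | terminal x =>
      obtain ⟨v, rfl, h⟩ := h
      obtain ⟨u, v, rfl, h₁, h₂⟩ := ih h
      exact ⟨x :: u, v, rfl, ⟨u, rfl, h₁⟩, h₂⟩
    | nonterminal A =>
      obtain ⟨u₀, v, rfl, h₀, h⟩ := h
      obtain ⟨u, v, rfl, h₁, h₂⟩ := ih h
      exact ⟨u₀ ++ u, v, by simp, ⟨u₀, u, rfl, h₀, h₁⟩, h₂⟩

theorem FormYields.yields {r : ContextFreeRule α G.NT} {w : List α} (hG : G.IsCNF)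
    (hr : r ∈ G.rules) (h : G.FormYields r.output w) : G.Yields r.input w := by
  rcases hG r hr with ⟨B, C, ho⟩ | ⟨x, ho⟩ | ⟨-, ho⟩
  · rw [ho] at h
    obtain ⟨u, v, rfl, hB, u', v', rfl, hC, rfl⟩ := h
    rw [List.append_nil]
    exact .pair hr ho hB hC
  · rw [ho] at h
    obtain ⟨v, rfl, rfl⟩ := h
    exact .leaf hr ho
  · rw [ho] at h
    obtain rfl : w = [] := h
    exact .empty hr ho

/-- Pulling yields back along a rewriting step avoids any normalisation of the order of derivation:
the trees below the rewritten symbols become the children of a new node. -/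
theorem FormYields.of_rewrites {r : ContextFreeRule α G.NT} {f f' : List (Symbol α G.NT)}
    {w : List α} (hG : G.IsCNF) (hr : r ∈ G.rules) (hf : r.Rewrites f f')
    (h : G.FormYields f' w) : G.FormYields f w := by
  induction hf generalizing w with
  | head s =>
    obtain ⟨u, v, rfl, h₁, h₂⟩ := h.split
    exact ⟨u, v, rfl, h₁.yields hG hr, h₂⟩
  | cons a _ ih =>
    cases a with
    | terminal x =>
      obtain ⟨v, rfl, h⟩ := h
      exact ⟨v, rfl, ih h⟩
    | nonterminal A =>
      obtain ⟨u, v, rfl, h₁, h⟩ := h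
      exact ⟨u, v, rfl, h₁, ih h⟩

theorem Yields.derives {A : G.NT} {w : List α} (h : G.Yields A w) :
    G.Derives [Symbol.nonterminal A] (w.map Symbol.terminal) := by
  have step : ∀ r ∈ G.rules, G.Derives [Symbol.nonterminal r.input] r.output := fun r hr =>
    Produces.single ⟨r, hr, ContextFreeRule.Rewrites.input_output⟩
  induction h with
  | empty hr ho => simpa [ho] using step _ hr
  | leaf hr ho => simpa [ho] using step _ hr
  | @pair r B C u v hr ho _ _ hB hC =>
    have h₁ := step r hr
    rw [ho] at h₁
    have h₂ := hB.append_right [Symbol.nonterminal C]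
    have h₃ := hC.append_left (u.map Symbol.terminal)
    rw [List.map_append]
    exact (h₁.trans h₂).trans h₃

theorem mem_language_iff_yields (hG : G.IsCNF) (w : List α) :
    w ∈ G.language ↔ G.Yields G.initial w := by
  rw [mem_language_iff]
  refine ⟨fun h => ?_, Yields.derives⟩
  have : G.FormYields [Symbol.nonterminal G.initial] w := by
    refine Relation.ReflTransGen.head_induction_on h (formYields_map_terminal w) ?_
    rintro f f' ⟨r, hr, hf⟩ _ ih
    exact ih.of_rewrites hG hr hf
  obtain ⟨u, v, rfl, h₁, rfl⟩ := this
  simpa using h₁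

end ContextFreeGrammar

/-! ### Parses of the coded instance and the language edit distance -/

/-- The coded instance `g` represents the grammar `G` with the numbering `ν` of the nonterminals and
the string `s`. -/
structure CodedInstance.Codes {m : ℕ} (g : CodedInstance) (G : ContextFreeGrammar (Fin m))
    (ν : G.NT ≃ Fin g.nts) (s : List (Fin m)) : Prop where
  cnf : G.IsCNF
  exists_index : ∀ r ∈ G.rules, ∃ i < g.rules, HoldsRule ν r g.code (4 * i)
  exists_rule : ∀ i < g.rules, ∃ r ∈ G.rules, HoldsRule ν r g.code (4 * i)
  len_eq : g.len = s.length
  text_eq : ∀ (i : ℕ) (h : i < s.length), g.text i = s[i]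

namespace CodedInstance.Codes

variable {m : ℕ} {g : CodedInstance} {G : ContextFreeGrammar (Fin m)} {ν : G.NT ≃ Fin g.nts}
  {s : List (Fin m)}

theorem cases_rule (h : g.Codes G ν s) {i : ℕ} (hi : i < g.rules) :
    ∃ r ∈ G.rules, g.lhs i = ν r.input ∧
      ((g.tag i = 0 ∧ r.output = []) ∨
       (g.tag i = 1 ∧ ∃ x : Fin m, g.fst i = x ∧ r.output = [Symbol.terminal x]) ∨
       (g.tag i = 2 ∧ ∃ B C : G.NT, g.fst i = ν B ∧ g.snd i = ν C ∧
          r.output = [Symbol.nonterminal B, Symbol.nonterminal C])) := by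
  obtain ⟨r, hr, h₁, h₂⟩ := h.exists_rule i hi
  refine ⟨r, hr, h₁, ?_⟩
  rcases h.cnf r hr with ⟨B, C, ho⟩ | ⟨x, ho⟩ | ⟨-, ho⟩
  · rw [ho] at h₂; exact Or.inr (Or.inr ⟨h₂.1, B, C, h₂.2.1, h₂.2.2, ho⟩)
  · rw [ho] at h₂; exact Or.inr (Or.inl ⟨h₂.1, x, h₂.2, ho⟩)
  · rw [ho] at h₂; exact Or.inl ⟨h₂, ho⟩

theorem valid (h : g.Codes G ν s) : g.Valid where
  lhs_lt i hi := by
    obtain ⟨r, -, h₁, -⟩ := h.cases_rule hi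
    rw [h₁]; exact (ν _).2
  fst_lt i hi ht := by
    obtain ⟨r, -, -, h | h | ⟨-, B, C, h₁, -⟩⟩ := h.cases_rule hi
    · omega
    · omega
    · rw [h₁]; exact (ν _).2
  snd_lt i hi ht := by
    obtain ⟨r, -, -, h | h | ⟨-, B, C, -, h₁, -⟩⟩ := h.cases_rule hi
    · omega
    · omega
    · rw [h₁]; exact (ν _).2

theorem val_inj {A A' : G.NT} (h : (ν A : ℕ) = ν A') : A = A' := ν.injective (Fin.ext h)

theorem text_append (h : g.Codes G ν s) {l r : List (Fin m)} {x : Fin m} (hs : s = l ++ x :: r) :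
    g.text l.length = x := by
  rw [h.text_eq _ (by simp [hs])]
  simp [hs]

/-- Soundness of `Parse`, by induction: each clause either adds an edit at an end of the aligned
piece `u` or concatenates two alignments. The surrounding pieces `l` and `r` must vary in the
induction, since positions are lengths of prefixes. -/
theorem exists_yields (hg : g.Codes G ν s) {A i j c : ℕ} (h : g.Parse A i j c) (A' : G.NT)
    (hA : A = ν A') (l u r : List (Fin m)) (hs : s = l ++ u ++ r) (hl : i = l.length)
    (hu : j = l.length + u.length) : ∃ w, G.Yields A' w ∧ Align c u w := by
  induction h generalizing A' l u r with
  | @eps i hi ht p =>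
    obtain ⟨ρ, hρ, h₁, ⟨-, ho⟩ | h | h⟩ := hg.cases_rule hi
    · obtain rfl := val_inj (h₁.symm.trans hA)
      obtain rfl : u = [] := List.length_eq_zero_iff.1 (by omega)
      exact ⟨_, .empty hρ ho, .nil⟩
    · omega
    · omega
  | @ins i hi ht p =>
    obtain ⟨ρ, hρ, h₁, h | ⟨-, x, -, ho⟩ | h⟩ := hg.cases_rule hi
    · omega
    · obtain rfl := val_inj (h₁.symm.trans hA)
      obtain rfl : u = [] := List.length_eq_zero_iff.1 (by omega)
      exact ⟨_, .leaf hρ ho, Align.nil.ins x⟩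
    · omega
  | @sub i hi ht p =>
    obtain ⟨ρ, hρ, h₁, h | ⟨-, x, hx, ho⟩ | h⟩ := hg.cases_rule hi
    · omega
    · obtain rfl := val_inj (h₁.symm.trans hA)
      obtain ⟨y, rfl⟩ := List.length_eq_one_iff.1 (show u.length = 1 by omega)
      exact ⟨_, .leaf hρ ho, Align.nil.subst y x⟩
    · omega
  | @keep i hi ht p htext =>
    obtain ⟨ρ, hρ, h₁, h | ⟨-, x, hx, ho⟩ | h⟩ := hg.cases_rule hi
    · omega
    · obtain rfl := val_inj (h₁.symm.trans hA)
      obtain ⟨y, rfl⟩ := List.length_eq_one_iff.1 (show u.length = 1 by omega)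
      have hy := hg.text_append (l := l) (r := r) (x := y) (by simpa using hs)
      obtain rfl : y = x := Fin.ext (by rw [← hy, ← hx, ← htext, hl])
      exact ⟨_, .leaf hρ ho, Align.nil.keep y⟩
    · omega
  | @delR A i j c hp ih =>
    have := hp.le
    have hne : u ≠ [] := by rintro rfl; simp at hu; omega
    have hsplit := List.dropLast_append_getLast hne
    obtain ⟨w, hw, ha⟩ := ih A' hA l u.dropLast (u.getLast hne :: r)
      (by rw [hs]; nth_rewrite 1 [← hsplit]; simp) hl (by rw [List.length_dropLast]; omega)
    refine ⟨w, hw, ?_⟩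
    rw [← hsplit]
    simpa using ha.append (Align.nil.del (u.getLast hne))
  | @delL A i j c hp ih =>
    have := hp.le
    cases u with
    | nil => simp at hu; omega
    | cons x u =>
      obtain ⟨w, hw, ha⟩ := ih A' hA (l ++ [x]) u r (by simpa using hs) (by simp [hl])
        (by simp at hu ⊢; omega)
      exact ⟨w, hw, ha.del x⟩
  | @bin i p h j c d hi ht hB hC ihB ihC =>
    have h₁ := hB.le
    have h₂ := hC.le
    obtain ⟨ρ, hρ, hl', h | h | ⟨-, B, C, hB', hC', ho⟩⟩ := hg.cases_rule hi
    · omega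
    · omega
    · obtain rfl := val_inj (hl'.symm.trans hA)
      have hsplit := List.take_append_drop (h - p) u
      have hlen : (u.take (h - p)).length = h - p := by rw [List.length_take]; omega
      obtain ⟨w, hw, ha⟩ := ihB B hB' l (u.take (h - p)) (u.drop (h - p) ++ r)
        (by rw [hs, List.append_assoc l, List.append_assoc l, ← List.append_assoc (u.take _), hsplit]) hl (by omega)
      obtain ⟨w', hw', ha'⟩ := ihC C hC' (l ++ u.take (h - p)) (u.drop (h - p)) r
        (by rw [hs, List.append_assoc l, List.append_assoc l, hsplit, List.append_assoc])
        (by rw [List.length_append]; omega)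
        (by rw [List.length_append, List.length_drop]; omega)
      refine ⟨_, .pair hρ ho hw hw', ?_⟩
      rw [← hsplit]
      exact ha.append ha'

/-- Completeness of `Parse`, by induction on the derivation tree. At an inner node the alignment is
split along the two yields, and that determines the split position. -/
theorem parse (hg : g.Codes G ν s) {A : G.NT} {w : List (Fin m)} (h : G.Yields A w) {c : ℕ}
    {l u r : List (Fin m)} (hs : s = l ++ u ++ r) (ha : Align c u w) :
    g.Parse (ν A) l.length (l.length + u.length) c := by
  induction h generalizing c l u r with
  | @empty ρ hρ ho =>
    obtain ⟨i, hi, h₁, h₂⟩ := hg.exists_index _ hρ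
    rw [ho] at h₂
    rw [← h₁, ha.length_eq]
    simpa [CodedInstance.lhs] using (Parse.eps hi h₂ l.length).extend u.length
  | @leaf ρ x hρ ho =>
    obtain ⟨i, hi, h₁, h₂⟩ := hg.exists_index _ hρ
    rw [ho] at h₂
    obtain ⟨ht, hx⟩ := h₂
    rw [← h₁]
    -- At a leaf the alignment consists of deletions before `x`, one event for `x`, and deletions
    -- after it. The former become `delL` by an inner induction, the latter `delR` through
    -- `Parse.extend`.
    generalize hz : [x] = z at ha
    induction ha generalizing l with
    | nil => exact absurd hz (by simp)
    | @keep k u z y ha =>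
      obtain ⟨rfl, rfl⟩ := List.cons.inj hz
      have hy := hg.text_append (l := l) (r := u ++ r) (x := x) (by simpa using hs)
      rw [ha.length_eq]
      simpa [add_assoc, add_comm 1, CodedInstance.lhs] using
        (Parse.keep hi ht l.length (hy.trans (Eq.symm hx))).extend u.length
    | @subst k u z y y' ha =>
      obtain ⟨rfl, rfl⟩ := List.cons.inj hz
      rw [ha.length_eq]
      simpa [add_assoc, add_comm 1, CodedInstance.lhs] using
        (Parse.sub hi ht l.length).extend u.length
    | @del k u z y ha ih =>
      have := ih (l := l ++ [y]) (by simpa using hs) hz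
      refine .delL ?_
      simpa [add_assoc, add_comm 1] using this
    | @ins k u z y ha =>
      obtain ⟨rfl, rfl⟩ := List.cons.inj hz
      rw [ha.length_eq]
      simpa [CodedInstance.lhs, add_comm 1] using (Parse.ins hi ht l.length).extend u.length
  | @pair ρ B C w₁ w₂ hρ ho _ _ ihB ihC =>
    obtain ⟨i, hi, h₁, h₂⟩ := hg.exists_index _ hρ
    rw [ho] at h₂
    obtain ⟨ht, hB, hC⟩ := h₂
    obtain ⟨u₁, u₂, k₁, k₂, rfl, rfl, a₁, a₂⟩ := ha.split_right
    have p₁ := ihB (l := l) (r := u₂ ++ r) (by simpa using hs) a₁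
    have p₂ := ihC (l := l ++ u₁) (r := r) (by simpa using hs) a₂
    rw [← h₁]
    rw [← hB] at p₁
    rw [← hC] at p₂
    rw [List.length_append] at p₂
    rw [List.length_append, ← add_assoc]
    exact Parse.bin hi ht p₁ p₂

/-- The language edit distance is the value of the start symbol on the whole string. -/
theorem languageEditDistance_eq (hg : g.Codes G ν s) (hε : [] ∈ G.language) :
    languageEditDistance G s = g.value (ν G.initial) 0 s.length := by
  have hle : ∀ z ∈ G.language, g.value (ν G.initial) 0 s.length ≤ editDistance s z := by
    intro z hz
    obtain ⟨k, hk, ha⟩ := exists_align_le_editDistance s z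
    have := hg.parse ((ContextFreeGrammar.mem_language_iff_yields hg.cnf z).1 hz)
      (l := []) (r := []) (by simp) ha
    simp only [List.length_nil, zero_add] at this
    exact this.value_le.trans hk
  apply le_antisymm
  · rcases value_eq (g := g) (ν G.initial) 0 s.length with h | h
    -- The capped case is impossible: the empty word is in the language and deleting all of `s`
    -- costs only its length.
    · have h₁ := hle [] hε
      have h₂ := editDistance_le (Align.of_nil s)
      have := hg.len_eq
      omega
    · obtain ⟨w, hw, ha⟩ := hg.exists_yields h G.initial rfl [] s [] (by simp) rfl (by simp)
      have hmem : editDistance s w ∈ (fun z => editDistance s z) '' {z | z ∈ G.language} :=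
        ⟨w, (ContextFreeGrammar.mem_language_iff_yields hg.cnf w).2 hw, rfl⟩
      exact (Nat.sInf_le hmem).trans (editDistance_le ha)
  · obtain ⟨z, hz, he⟩ := Nat.sInf_mem
      (s := (fun z => editDistance s z) '' {z | z ∈ G.language}) ⟨_, [], hε, rfl⟩
    exact (hle z hz).trans he.le

end CodedInstance.Codes

/-! ### Programs for the dynamic program -/

namespace RamExpr

variable {B : ℕ} {σ : RamState} {e f : RamExpr}

/-- The expression mentions the array `x`. -/
@[simp] def Reads (x : ℕ) : RamExpr → Prop
  | .const _ => False
  | .read a e => a = x ∨ e.Reads x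
  | .op _ e₁ e₂ => e₁.Reads x ∨ e₂.Reads x

theorem eval_congr {σ σ' : RamState} : ∀ {e : RamExpr}, (∀ a, e.Reads a → σ' a = σ a) →
    e.eval σ' = e.eval σ
  | .const _, _ => rfl
  | .read a e, h => by
    have := eval_congr (e := e) fun b hb => h b (Or.inr hb)
    simp only [eval, this, h a (Or.inl rfl)]
  | .op o e₁ e₂, h => by
    have h₁ := eval_congr (e := e₁) fun b hb => h b (Or.inl hb)
    have h₂ := eval_congr (e := e₂) fun b hb => h b (Or.inr hb)
    simp only [eval, h₁, h₂]

theorem fits_congr {σ σ' : RamState} : ∀ {e : RamExpr}, (∀ a, e.Reads a → σ' a = σ a) →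
    e.Fits B σ → e.Fits B σ'
  | .const _, _, h' => h'
  | .read a e, h, h' => by
    have := eval_congr (e := e) fun b hb => h b (Or.inr hb)
    refine ⟨fits_congr (fun b hb => h b (Or.inr hb)) h'.1, ?_⟩
    rw [this, h a (Or.inl rfl)]
    exact h'.2
  | .op o e₁ e₂, h, h' => by
    have h₁ := eval_congr (e := e₁) fun b hb => h b (Or.inl hb)
    have h₂ := eval_congr (e := e₂) fun b hb => h b (Or.inr hb)
    refine ⟨fits_congr (fun b hb => h b (Or.inl hb)) h'.1,
      fits_congr (fun b hb => h b (Or.inr hb)) h'.2.1, ?_⟩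
    rw [h₁, h₂]
    exact h'.2.2

theorem fits_read (hσ : σ.IsWord B) (a : ℕ) : (read a e).Fits B σ ↔ e.Fits B σ :=
  ⟨fun h => h.1, fun h => ⟨h, hσ _ _⟩⟩

theorem fits_reg (hσ : σ.IsWord B) (a : ℕ) : (reg a).Fits B σ :=
  ⟨lt_of_le_of_lt (Nat.zero_le _) (hσ a 0), hσ _ _⟩

theorem fits_sub : (op .sub e f).Fits B σ ↔ e.Fits B σ ∧ f.Fits B σ :=
  ⟨fun h => ⟨h.1, h.2.1⟩, fun h => ⟨h.1, h.2, lt_of_le_of_lt (Nat.sub_le _ _) h.1.eval_lt⟩⟩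

theorem fits_div : (op .div e f).Fits B σ ↔ e.Fits B σ ∧ f.Fits B σ :=
  ⟨fun h => ⟨h.1, h.2.1⟩, fun h => ⟨h.1, h.2, lt_of_le_of_lt (Nat.div_le_self _ _) h.1.eval_lt⟩⟩

theorem fits_mod : (op .mod e f).Fits B σ ↔ e.Fits B σ ∧ f.Fits B σ :=
  ⟨fun h => ⟨h.1, h.2.1⟩, fun h => ⟨h.1, h.2, lt_of_le_of_lt (Nat.mod_le _ _) h.1.eval_lt⟩⟩

theorem fits_lt (hB : 1 < B) : (op .lt e f).Fits B σ ↔ e.Fits B σ ∧ f.Fits B σ :=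
  ⟨fun h => ⟨h.1, h.2.1⟩, fun h => ⟨h.1, h.2, by simp only [RamOp.apply]; split_ifs <;> omega⟩⟩

theorem fits_eq (hB : 1 < B) : (op .eq e f).Fits B σ ↔ e.Fits B σ ∧ f.Fits B σ :=
  ⟨fun h => ⟨h.1, h.2.1⟩, fun h => ⟨h.1, h.2, by simp only [RamOp.apply]; split_ifs <;> omega⟩⟩

theorem fits_add : (op .add e f).Fits B σ ↔
    e.Fits B σ ∧ f.Fits B σ ∧ e.eval σ + f.eval σ < B := Iff.rfl

theorem fits_mul : (op .mul e f).Fits B σ ↔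
    e.Fits B σ ∧ f.Fits B σ ∧ e.eval σ * f.eval σ < B := Iff.rfl

theorem fits_const {v : ℕ} : (const v).Fits B σ ↔ v < B := Iff.rfl

theorem eval_lt_ne_zero : (op .lt e f).eval σ ≠ 0 ↔ e.eval σ < f.eval σ := by
  simp only [eval, RamOp.apply]
  split_ifs <;> simp_all

theorem eval_eq_ne_zero : (op .eq e f).eval σ ≠ 0 ↔ e.eval σ = f.eval σ := by
  simp only [eval, RamOp.apply]
  split_ifs <;> simp_all

theorem eval_mul_ne_zero : (op .mul e f).eval σ ≠ 0 ↔ e.eval σ ≠ 0 ∧ f.eval σ ≠ 0 := by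
  simp only [eval, RamOp.apply]
  exact mul_ne_zero_iff

theorem eval_lt_le_one : (op .lt e f).eval σ ≤ 1 := by
  simp only [eval, RamOp.apply]
  split_ifs <;> omega

theorem eval_eq_le_one : (op .eq e f).eval σ ≤ 1 := by
  simp only [eval, RamOp.apply]
  split_ifs <;> omega

theorem fits_mul_of_le_one (hB : 1 < B) (he : e.Fits B σ) (hf : f.Fits B σ) (he' : e.eval σ ≤ 1)
    (hf' : f.eval σ ≤ 1) : (op .mul e f).Fits B σ :=
  ⟨he, hf, lt_of_le_of_lt (Nat.mul_le_mul he' hf') (by omega)⟩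

end RamExpr

namespace RamProg

/-- Replace the content of the register `x` by its minimum with the values of those expressions in a
list whose guards are nonzero. -/
def minOver (x : ℕ) : List (RamExpr × RamExpr) → RamProg
  | [] => .skip
  | (g, e) :: l => .seq (minIf x g e) (minOver x l)

theorem eq_of_writes_minOver {x a : ℕ} : ∀ {l : List (RamExpr × RamExpr)},
    (minOver x l).Writes a → a = x
  | [], h => h.elim
  | (_, _) :: _, h => h.elim (fun h => writes_minIf.1 h) eq_of_writes_minOver

/-- The expressions do not read `x`, so they keep the values they had at the start while `x`
changes. The bound `lo` carries soundness (the result does not fall below the true value), the last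
hypothesis completeness (it is at most every admissible option). -/
theorem wp_minOver {B x lo : ℕ} {Q : RamState → Prop} {σ : RamState} (hB : 1 < B) :
    ∀ (l : List (RamExpr × RamExpr)), σ.IsWord B →
    (∀ q ∈ l, ¬ q.1.Reads x ∧ ¬ q.2.Reads x) →
    (∀ q ∈ l, q.1.Fits B σ ∧
      (q.1.eval σ ≠ 0 → q.2.Fits B σ ∧ lo ≤ q.2.eval σ)) → lo ≤ σ x 0 →
    (∀ v, lo ≤ v → v ≤ σ x 0 → (∀ q ∈ l, q.1.eval σ ≠ 0 → v ≤ q.2.eval σ) →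
      Q (σ.store x 0 v)) →
    (minOver x l).wp B σ Q
  | [], _, _, _, hlo, hQ => by
    have := hQ (σ x 0) hlo le_rfl (by simp)
    rwa [RamState.store_self] at this
  | (g, e) :: l, hσ, hr, hf, hlo, hQ => by
    have hf₀ := hf (g, e) List.mem_cons_self
    refine wp_minIf hσ hB hf₀.1 (fun h => (hf₀.2 h).1) fun hσ' => ?_
    set w := if g.eval σ ≠ 0 then min (σ x 0) (e.eval σ) else σ x 0 with hw
    have hcongr : ∀ q ∈ l, (∀ a, q.1.Reads a → σ.store x 0 w a = σ a) ∧
        (∀ a, q.2.Reads a → σ.store x 0 w a = σ a) := fun q hq =>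
      ⟨fun a ha => RamState.store_ne _ _ _ fun h => (hr q (.tail _ hq)).1 (h ▸ ha),
       fun a ha => RamState.store_ne _ _ _ fun h => (hr q (.tail _ hq)).2 (h ▸ ha)⟩
    have hwlo : lo ≤ w := by
      rw [hw]; split_ifs with h
      exacts [le_min hlo (hf₀.2 h).2, hlo]
    refine wp_minOver (lo := lo) hB l hσ' (fun q hq => hr q (.tail _ hq)) (fun q hq => ?_) ?_ ?_
    · have h := hf q (.tail _ hq)
      rw [RamExpr.eval_congr (hcongr q hq).1, RamExpr.eval_congr (hcongr q hq).2]
      exact ⟨RamExpr.fits_congr (hcongr q hq).1 h.1, fun h' =>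
        ⟨RamExpr.fits_congr (hcongr q hq).2 (h.2 h').1, (h.2 h').2⟩⟩
    · simpa using hwlo
    · intro v hv hv' hall
      rw [RamState.store_store]
      have hv' : v ≤ w := by simpa using hv'
      refine hQ v hv (hv'.trans ?_) fun q hq h => ?_
      · rw [hw]; split_ifs
        exacts [min_le_left _ _, le_rfl]
      · rcases List.mem_cons.1 hq with rfl | hq
        · refine hv'.trans ?_
          rw [hw, if_pos h]
          exact min_le_right _ _
        · have := hall q hq
          rw [RamExpr.eval_congr (hcongr q hq).1, RamExpr.eval_congr (hcongr q hq).2] at this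
          exact this h

end RamProg

namespace EditDP

open RamExpr RamProg

/-! The arrays: `4` stride of the table, `5` table, `6` and `7` coordinates of the cells in the order
of evaluation, `8` time, `9` side of the blocks, `10` production, `11` round, `12` and `13` row and
column, `14` minimum, `15` power of two, `16` offset of the middle block, `17` running index,
`18` offset of the rows. -/

/-- The address of a table entry. -/
abbrev addrE (a i j : RamExpr) : RamExpr :=
  .op .add (.op .mul (.op .add (.op .mul a (.reg 4)) i) (.reg 4)) j

/-- A table entry. -/
abbrev tabE (a i j : RamExpr) : RamExpr := .read 5 (addrE a i j)

/-- Component `d` of the current production. -/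
abbrev codeE (d : ℕ) : RamExpr :=
  .read 1 (.op .add (.op .mul (.const 4) (.reg 10)) (.const d))

/-- The table entry of `A`, `i`, `j` in a state, the stride being `N`. -/
def tab (N : ℕ) (σ : RamState) (A i j : ℕ) : ℕ := σ 5 ((A * N + i) * N + j)

/-- The word bound `B` and the stride `N` are large enough. -/
structure Setting (g : CodedInstance) (B N : ℕ) : Prop where
  valid : g.Valid
  len_lt : g.len < N
  table_lt : g.nts * N * N < B
  square_lt : 4 * (N * N) + 2 * N + 10 < B
  code_lt : 4 * g.rules + 4 < B
  cap_lt : 2 * (g.len + 1) + 2 < B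

/-- The instance and the stride are in memory. -/
structure Loaded (g : CodedInstance) (N : ℕ) (σ : RamState) : Prop where
  nts : σ 0 0 = g.nts
  rules : σ 0 2 = g.rules
  len : σ 0 3 = g.len
  code : σ 1 = g.code
  text : σ 2 = g.text
  stride : σ 4 0 = N

/-- The table entries lie between the values and the cap. -/
structure Table (g : CodedInstance) (N : ℕ) (σ : RamState) : Prop where
  value_le : ∀ A < g.nts, ∀ i < N, ∀ j < N, g.value A i j ≤ tab N σ A i j
  le_cap : ∀ A < g.nts, ∀ i < N, ∀ j < N, tab N σ A i j ≤ g.len + 1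

/-- The table entries have decreased, but not below the values. -/
def Descends (g : CodedInstance) (N : ℕ) (σ σ' : RamState) : Prop :=
  ∀ A < g.nts, ∀ i < N, ∀ j < N, g.value A i j ≤ tab N σ' A i j ∧ tab N σ' A i j ≤ tab N σ A i j

variable {g : CodedInstance} {B N : ℕ} {σ σ' σ'' : RamState}

theorem Table.refl (h : Table g N σ) : Descends g N σ σ := fun A hA i hi j hj =>
  ⟨h.value_le A hA i hi j hj, le_rfl⟩

theorem Descends.trans (h : Descends g N σ σ') (h' : Descends g N σ' σ'') :
    Descends g N σ σ'' := fun A hA i hi j hj =>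
  ⟨(h' A hA i hi j hj).1, (h' A hA i hi j hj).2.trans (h A hA i hi j hj).2⟩

theorem Table.descends (h : Table g N σ) (h' : Descends g N σ σ') : Table g N σ' where
  value_le A hA i hi j hj := (h' A hA i hi j hj).1
  le_cap A hA i hi j hj := (h' A hA i hi j hj).2.trans (h.le_cap A hA i hi j hj)

theorem tab_congr (h : σ' 5 = σ 5) : tab N σ' = tab N σ := by
  funext A i j
  simp [tab, h]

theorem Descends.congr {ρ ρ' : RamState} (h : Descends g N σ σ') (h₁ : ρ 5 = σ 5)
    (h₂ : ρ' 5 = σ' 5) : Descends g N ρ ρ' := by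
  unfold Descends
  rw [tab_congr h₁, tab_congr h₂]
  exact h

theorem Table.congr {ρ : RamState} (h : Table g N σ) (h₁ : ρ 5 = σ 5) : Table g N ρ := by
  refine ⟨?_, ?_⟩ <;> rw [tab_congr h₁]
  exacts [h.value_le, h.le_cap]

theorem Loaded.congr {ρ : RamState} (h : Loaded g N σ) (h₁ : ∀ a ≤ 4, ρ a = σ a) :
    Loaded g N ρ := by
  constructor
  · rw [h₁ _ (by norm_num)]; exact h.nts
  · rw [h₁ _ (by norm_num)]; exact h.rules
  · rw [h₁ _ (by norm_num)]; exact h.len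
  · rw [h₁ _ (by norm_num)]; exact h.code
  · rw [h₁ _ (by norm_num)]; exact h.text
  · rw [h₁ _ (by norm_num)]; exact h.stride

/-- Addresses are numbers written in base `N`, so distinct entries occupy distinct memory cells. -/
theorem addr_inj {A i j A' i' j' : ℕ} (hi : i < N) (hj : j < N) (hi' : i' < N) (hj' : j' < N)
    (h : (A * N + i) * N + j = (A' * N + i') * N + j') : A = A' ∧ i = i' ∧ j = j' := by
  have key : ∀ a b a' b' : ℕ, b < N → b' < N → a * N + b = a' * N + b' → a = a' ∧ b = b' := by
    intro a b a' b' hb hb' h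
    have hN : 0 < N := by omega
    have h₁ := congrArg (· / N) h
    have h₂ := congrArg (· % N) h
    simp only [Nat.mul_comm _ N, Nat.mul_add_div hN, Nat.div_eq_of_lt hb, Nat.div_eq_of_lt hb',
      Nat.mul_add_mod, Nat.mod_eq_of_lt hb, Nat.mod_eq_of_lt hb', add_zero] at h₁ h₂
    exact ⟨h₁, h₂⟩
  obtain ⟨h₁, h₂⟩ := key _ _ _ _ hj hj' h
  obtain ⟨h₃, h₄⟩ := key _ _ _ _ hi hi' h₁
  exact ⟨h₃, h₄, h₂⟩

theorem tab_update {A i j v : ℕ} (hi : i < N) (hj : j < N)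
    (h : σ' 5 = Function.update (σ 5) ((A * N + i) * N + j) v) :
    tab N σ' A i j = v ∧ ∀ A' i' j', i' < N → j' < N → ¬(A' = A ∧ i' = i ∧ j' = j) →
      tab N σ' A' i' j' = tab N σ A' i' j' := by
  constructor
  · simp [tab, h]
  · intro A' i' j' hi' hj' hne
    rw [tab, h, Function.update_of_ne, tab]
    intro heq
    exact hne (addr_inj hi' hj' hi hj heq)

theorem descends_of_update {A i j v : ℕ} (hσ : Table g N σ) (hi : i < N) (hj : j < N)
    (hv : g.value A i j ≤ v) (hv' : v ≤ tab N σ A i j)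
    (h : σ' 5 = Function.update (σ 5) ((A * N + i) * N + j) v) : Descends g N σ σ' := by
  obtain ⟨h₁, h₂⟩ := tab_update hi hj h
  intro A' hA' i' hi' j' hj'
  by_cases hc : A' = A ∧ i' = i ∧ j' = j
  · obtain ⟨rfl, rfl, rfl⟩ := hc
    rw [h₁]
    exact ⟨hv, hv'⟩
  · rw [h₂ A' i' j' hi' hj' hc]
    exact hσ.refl A' hA' i' hi' j' hj'

theorem Setting.addr_lt (S : Setting g B N) {A i j : ℕ} (hA : A < g.nts) (hi : i < N)
    (hj : j < N) : (A * N + i) * N + j < B ∧ (A * N + i) * N < B ∧ A * N + i < B ∧ A * N < B := by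
  have h₁ : (A + 1) * N ≤ g.nts * N := Nat.mul_le_mul_right _ hA
  have h₂ : (A * N + i + 1) * N ≤ g.nts * N * N :=
    Nat.mul_le_mul_right _ (by rw [add_mul] at h₁; omega)
  have h₃ : A * N + i ≤ (A * N + i) * N := Nat.le_mul_of_pos_right _ (by omega)
  have h₄ := S.table_lt
  rw [add_mul (A * N + i)] at h₂
  omega

section Eval

variable (S : Setting g B N) (hσ : σ.IsWord B) (hL : Loaded g N σ)
include S hσ hL

theorem addrE_spec {a i j : RamExpr} (ha : a.Fits B σ) (hi : i.Fits B σ) (hj : j.Fits B σ)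
    (ha' : a.eval σ < g.nts) (hi' : i.eval σ < N) (hj' : j.eval σ < N) :
    (addrE a i j).Fits B σ ∧
      (addrE a i j).eval σ = (a.eval σ * N + i.eval σ) * N + j.eval σ := by
  obtain ⟨h₁, h₂, h₃, h₄⟩ := S.addr_lt ha' hi' hj'
  have hN : (RamExpr.reg 4).eval σ = N := hL.stride
  refine ⟨⟨⟨⟨⟨ha, fits_reg hσ 4, ?_⟩, hi, ?_⟩, fits_reg hσ 4, ?_⟩, hj, ?_⟩, ?_⟩
  all_goals simp only [RamExpr.eval, RamOp.apply, hL.stride]; try assumption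

theorem tabE_spec {a i j : RamExpr} (ha : a.Fits B σ) (hi : i.Fits B σ) (hj : j.Fits B σ)
    (ha' : a.eval σ < g.nts) (hi' : i.eval σ < N) (hj' : j.eval σ < N) :
    (tabE a i j).Fits B σ ∧ (tabE a i j).eval σ = tab N σ (a.eval σ) (i.eval σ) (j.eval σ) := by
  obtain ⟨h₁, h₂⟩ := addrE_spec S hσ hL ha hi hj ha' hi' hj'
  refine ⟨(fits_read hσ 5).2 h₁, ?_⟩
  rw [RamExpr.eval, h₂, tab]

theorem codeE_spec {r d : ℕ} (hr : σ 10 0 = r) (hr' : r < g.rules) (hd : d ≤ 3) :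
    (codeE d).Fits B σ ∧ (codeE d).eval σ = g.code (4 * r + d) := by
  have := S.code_lt
  refine ⟨(fits_read hσ 1).2 ⟨⟨?_, fits_reg hσ 10, ?_⟩, ?_, ?_⟩, ?_⟩
  all_goals simp only [RamExpr.Fits, RamExpr.eval, RamOp.apply, hr, hL.code]
  all_goals omega

end Eval

end EditDP

/-! ### Closing a single cell -/

namespace EditDP

open RamExpr RamProg

variable {g : CodedInstance} {B N : ℕ} {σ : RamState}

/-- The values which the current production yields for the cell `(i, j)`, with their guards. -/
def relaxOptions : List (RamExpr × RamExpr) :=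
  [(.op .lt (.reg 12) (.reg 13),
      .op .add (tabE (codeE 0) (.reg 12) (.op .sub (.reg 13) (.const 1))) (.const 1)),
   (.op .lt (.reg 12) (.reg 13),
      .op .add (tabE (codeE 0) (.op .add (.reg 12) (.const 1)) (.reg 13)) (.const 1)),
   (.op .eq (codeE 1) (.const 2),
      .op .add (tabE (codeE 2) (.reg 12) (.reg 12)) (tabE (codeE 3) (.reg 12) (.reg 13))),
   (.op .eq (codeE 1) (.const 2),
      .op .add (tabE (codeE 2) (.reg 12) (.reg 13)) (tabE (codeE 3) (.reg 13) (.reg 13))),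
   (.op .mul (.op .eq (codeE 1) (.const 1)) (.op .eq (.reg 12) (.reg 13)), .const 1),
   (.op .mul (.op .eq (codeE 1) (.const 1)) (.op .eq (.reg 13) (.op .add (.reg 12) (.const 1))),
      .op .sub (.const 1) (.op .eq (.read 2 (.reg 12)) (codeE 2))),
   (.op .mul (.op .eq (codeE 1) (.const 0)) (.op .eq (.reg 12) (.reg 13)), .const 0)]

/-- Relax the cell `(i, j)` with the current production. -/
def relax : RamProg :=
  .seq (set 14 (tabE (codeE 0) (.reg 12) (.reg 13)))
    (.seq (minOver 14 relaxOptions) (.assign 5 (addrE (codeE 0) (.reg 12) (.reg 13)) (.reg 14)))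

theorem writes_relax {a : ℕ} (h : relax.Writes a) : a = 14 ∨ a = 5 := by
  rcases h with h | h | h
  exacts [Or.inl h, Or.inl (eq_of_writes_minOver h), Or.inr h]

theorem wp_relax (S : Setting g B N) (hσ : σ.IsWord B) (hL : Loaded g N σ) (hT : Table g N σ)
    {r i j : ℕ} (hr : σ 10 0 = r) (hr' : r < g.rules) (hi : σ 12 0 = i) (hi' : i < N)
    (hj : σ 13 0 = j) (hj' : j < N) :
    relax.wp B σ fun σ' => ∃ v, g.value (g.lhs r) i j ≤ v ∧ v ≤ tab N σ (g.lhs r) i j ∧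
      g.Relaxed (tab N σ) r i j v ∧
      σ' 5 = Function.update (σ 5) ((g.lhs r * N + i) * N + j) v := by
  have hB : 1 < B := by have := S.cap_lt; omega
  have h12 : ∀ {ρ : RamState}, ρ.IsWord B → (RamExpr.reg 12).Fits B ρ := fun h => fits_reg h 12
  have h13 : ∀ {ρ : RamState}, ρ.IsWord B → (RamExpr.reg 13).Fits B ρ := fun h => fits_reg h 13
  have hA := S.valid.lhs_lt r hr'
  have hloc : ∀ {ρ : RamState} (v : ℕ), ρ = σ.store 14 0 v → Loaded g N ρ ∧ ρ 10 0 = r ∧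
      ρ 12 0 = i ∧ ρ 13 0 = j ∧ tab N ρ = tab N σ := by
    rintro ρ v rfl
    refine ⟨hL.congr fun a ha => RamState.store_ne _ _ _ (by omega), ?_, ?_, ?_, ?_⟩
    · rw [RamState.store_ne _ _ _ (by norm_num), hr]
    · rw [RamState.store_ne _ _ _ (by norm_num), hi]
    · rw [RamState.store_ne _ _ _ (by norm_num), hj]
    · exact tab_congr (RamState.store_ne _ _ _ (by norm_num))
  obtain ⟨c₁, c₂⟩ := codeE_spec S hσ hL hr hr' (d := 0) (by norm_num)
  obtain ⟨t₁, t₂⟩ := tabE_spec S hσ hL c₁ (h12 hσ) (h13 hσ) (c₂ ▸ hA) (by simpa [eval, hi])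
    (by simpa [eval, hj])
  have e₀ : σ.store 14 ((RamExpr.const 0).eval σ)
      ((tabE (codeE 0) (.reg 12) (.reg 13)).eval σ) = σ.store 14 0 (tab N σ (g.lhs r) i j) := by
    rw [t₂, c₂]; simp only [eval, hi, hj]; rfl
  refine ⟨fits_const.2 (by omega), t₁, ?_⟩
  rw [e₀]
  generalize hσ₁' : σ.store 14 0 (tab N σ (g.lhs r) i j) = σ₁
  intro hσ₁
  obtain ⟨hL₁, hr₁, hi₁, hj₁, htab⟩ := hloc _ hσ₁'.symm
  have e12 : (RamExpr.reg 12).eval σ₁ = i := hi₁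
  have e13 : (RamExpr.reg 13).eval σ₁ = j := hj₁
  have code := fun d (hd : d ≤ 3) => codeE_spec S hσ₁ hL₁ hr₁ hr' (d := d) hd
  obtain ⟨A₁, A₂⟩ := code 0 (by norm_num)
  obtain ⟨T₁, T₂⟩ := code 1 (by norm_num)
  obtain ⟨B₁, B₂⟩ := code 2 (by norm_num)
  obtain ⟨C₁, C₂⟩ := code 3 (by norm_num)
  change _ = g.lhs r at A₂
  change _ = g.tag r at T₂
  change _ = g.fst r at B₂
  change _ = g.snd r at C₂
  have hcap : ∀ A < g.nts, ∀ i < N, ∀ j < N, tab N σ A i j ≤ g.len + 1 := hT.le_cap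
  have hval := hT.value_le
  have hcl := S.cap_lt
  have hsq := S.square_lt
  have f12 := h12 hσ₁
  have f13 := h13 hσ₁
  have o1 : i < j → (tabE (codeE 0) (.reg 12) (.op .sub (.reg 13) (.const 1))).Fits B σ₁ ∧
      (tabE (codeE 0) (.reg 12) (.op .sub (.reg 13) (.const 1))).eval σ₁ =
        tab N σ (g.lhs r) i (j - 1) := by
    intro hij
    have h := tabE_spec S hσ₁ hL₁ A₁ f12 (fits_sub.2 ⟨f13, fits_const.2 hB⟩) (A₂ ▸ hA)
      (e12 ▸ hi') (by simp only [eval, RamOp.apply, hj₁]; omega)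
    rw [A₂, htab] at h
    simpa only [eval, RamOp.apply, hi₁, hj₁] using h
  have o2 : i < j → (tabE (codeE 0) (.op .add (.reg 12) (.const 1)) (.reg 13)).Fits B σ₁ ∧
      (tabE (codeE 0) (.op .add (.reg 12) (.const 1)) (.reg 13)).eval σ₁ =
        tab N σ (g.lhs r) (i + 1) j := by
    intro hij
    have h := tabE_spec S hσ₁ hL₁ A₁ (fits_add.2 ⟨f12, fits_const.2 hB, by
      simp only [eval, hi₁]; omega⟩) f13 (A₂ ▸ hA)
      (by simp only [eval, RamOp.apply, hi₁]; omega) (e13 ▸ hj')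
    rw [A₂, htab] at h
    simpa only [eval, RamOp.apply, hi₁, hj₁] using h
  have o3 : ∀ {d A x y u w}, (codeE d).Fits B σ₁ → (codeE d).eval σ₁ = A → A < g.nts →
      σ₁ x 0 = u → u < N → σ₁ y 0 = w → w < N →
      (tabE (codeE d) (.reg x) (.reg y)).Fits B σ₁ ∧
        (tabE (codeE d) (.reg x) (.reg y)).eval σ₁ = tab N σ A u w := by
    intro d A x y u w h₁ h₂ h₃ h₄ h₅ h₆ h₇
    have h := tabE_spec S hσ₁ hL₁ h₁ (fits_reg hσ₁ x) (fits_reg hσ₁ y) (h₂ ▸ h₃)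
      (by simpa only [eval, h₄]) (by simpa only [eval, h₆])
    rw [h₂, htab] at h
    simpa only [eval, h₄, h₆] using h
  have gT : ∀ v < B, (RamExpr.op .eq (codeE 1) (.const v)).Fits B σ₁ := fun v hv =>
    (fits_eq hB).2 ⟨T₁, fits_const.2 hv⟩
  have gT' : ∀ v, (RamExpr.op .eq (codeE 1) (.const v)).eval σ₁ ≠ 0 ↔ g.tag r = v := fun v => by
    rw [eval_eq_ne_zero, T₂]; rfl
  have gI : (RamExpr.op .eq (.reg 12) (.reg 13)).Fits B σ₁ := (fits_eq hB).2 ⟨f12, f13⟩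
  have gI' : (RamExpr.op .eq (.reg 12) (.reg 13)).eval σ₁ ≠ 0 ↔ i = j := by
    rw [eval_eq_ne_zero, e12, e13]
  have gS : (RamExpr.op .eq (.reg 13) (.op .add (.reg 12) (.const 1))).Fits B σ₁ :=
    (fits_eq hB).2 ⟨f13, f12, fits_const.2 hB, by simp only [eval, RamOp.apply, hi₁]; omega⟩
  have gS' : (RamExpr.op .eq (.reg 13) (.op .add (.reg 12) (.const 1))).eval σ₁ ≠ 0 ↔
      j = i + 1 := by
    rw [eval_eq_ne_zero, e13]; simp only [eval, RamOp.apply, hi₁]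
  have gL : (RamExpr.op .lt (.reg 12) (.reg 13)).Fits B σ₁ := (fits_lt hB).2 ⟨f12, f13⟩
  have gL' : (RamExpr.op .lt (.reg 12) (.reg 13)).eval σ₁ ≠ 0 ↔ i < j := by
    rw [eval_lt_ne_zero, e12, e13]
  have gM : ∀ {e f : RamExpr} {v : ℕ}, v < B → (RamExpr.op .eq e f).Fits B σ₁ →
      (RamExpr.op .mul (.op .eq (codeE 1) (.const v)) (.op .eq e f)).Fits B σ₁ := fun hv h =>
    fits_mul_of_le_one hB (gT _ hv) h eval_eq_le_one eval_eq_le_one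
  have sE : (RamExpr.op .sub (.const 1) (.op .eq (.read 2 (.reg 12)) (codeE 2))).Fits B σ₁ :=
    fits_sub.2 ⟨fits_const.2 hB, (fits_eq hB).2 ⟨(fits_read hσ₁ 2).2 f12, B₁⟩⟩
  have sE' : (RamExpr.op .sub (.const 1) (.op .eq (.read 2 (.reg 12)) (codeE 2))).eval σ₁ =
      if g.text i = g.fst r then 0 else 1 := by
    have h : (RamExpr.read 2 (.reg 12)).eval σ₁ = g.text i := by simp only [eval, hi₁, hL₁.text]
    rw [eval, eval, eval, h, B₂]
    simp only [RamOp.apply]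
    split_ifs <;> rfl
  refine wp_minOver (lo := g.value (g.lhs r) i j) hB relaxOptions hσ₁ ?_ ?_ ?_ ?_
  · simp [relaxOptions]
  · simp only [relaxOptions, List.forall_mem_cons, gL', gT', eval_mul_ne_zero, gI', gS', sE']
    refine ⟨⟨gL, fun h => ?_⟩, ⟨gL, fun h => ?_⟩, ⟨gT _ (by omega), fun h => ?_⟩,
      ⟨gT _ (by omega), fun h => ?_⟩, ⟨gM hB gI, fun h => ⟨fits_const.2 hB, ?_⟩⟩,
      ⟨gM hB gS, fun h => ⟨sE, ?_⟩⟩, ⟨gM (by omega) gI, fun h => ⟨fits_const.2 (by omega), ?_⟩⟩,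
      by simp⟩
    -- From here to the end of the list each option is checked for two things: its value is a
    -- machine word because entries are capped, and it is not below the value of the cell, by the
    -- corresponding clause of `Parse`.
    · obtain ⟨h₁, h₂⟩ := o1 h
      have h₃ := hcap _ hA i hi' (j - 1) (by omega)
      have h₄ := hval _ hA i hi' (j - 1) (by omega)
      have h₅ := CodedInstance.value_delR (g := g) (g.lhs r) i (j - 1)
      rw [Nat.sub_add_cancel (by omega)] at h₅
      refine ⟨fits_add.2 ⟨h₁, fits_const.2 hB, ?_⟩, ?_⟩
      · rw [h₂]; simp only [eval]; omega
      · rw [eval, h₂]; simp only [eval, RamOp.apply]; omega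
    · obtain ⟨h₁, h₂⟩ := o2 h
      have h₃ := hcap _ hA (i + 1) (by omega) j hj'
      have h₄ := hval _ hA (i + 1) (by omega) j hj'
      have h₅ := CodedInstance.value_delL (g := g) (g.lhs r) i j
      refine ⟨fits_add.2 ⟨h₁, fits_const.2 hB, ?_⟩, ?_⟩
      · rw [h₂]; simp only [eval]; omega
      · rw [eval, h₂]; simp only [eval, RamOp.apply]; omega
    · have hb := S.valid.fst_lt r hr' h
      have hc := S.valid.snd_lt r hr' h
      obtain ⟨h₁, h₂⟩ := o3 B₁ B₂ hb hi₁ hi' hi₁ hi'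
      obtain ⟨h₃, h₄⟩ := o3 C₁ C₂ hc hi₁ hi' hj₁ hj'
      have h₅ := hcap _ hb i hi' i hi'
      have h₆ := hcap _ hc i hi' j hj'
      have h₇ := hval _ hb i hi' i hi'
      have h₈ := hval _ hc i hi' j hj'
      have h₉ := CodedInstance.value_bin hr' h i i j
      refine ⟨fits_add.2 ⟨h₁, h₃, ?_⟩, ?_⟩
      · rw [h₂, h₄]; omega
      · rw [eval, h₂, h₄]; simp only [RamOp.apply]; omega
    · have hb := S.valid.fst_lt r hr' h
      have hc := S.valid.snd_lt r hr' h
      obtain ⟨h₁, h₂⟩ := o3 B₁ B₂ hb hi₁ hi' hj₁ hj'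
      obtain ⟨h₃, h₄⟩ := o3 C₁ C₂ hc hj₁ hj' hj₁ hj'
      have h₅ := hcap _ hb i hi' j hj'
      have h₆ := hcap _ hc j hj' j hj'
      have h₇ := hval _ hb i hi' j hj'
      have h₈ := hval _ hc j hj' j hj'
      have h₉ := CodedInstance.value_bin hr' h i j j
      refine ⟨fits_add.2 ⟨h₁, h₃, ?_⟩, ?_⟩
      · rw [h₂, h₄]; omega
      · rw [eval, h₂, h₄]; simp only [RamOp.apply]; omega
    · obtain ⟨h, rfl⟩ := h
      exact (CodedInstance.Parse.ins hr' h i).value_le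
    · obtain ⟨h, rfl⟩ := h
      exact CodedInstance.value_sub hr' h i
    · obtain ⟨h, rfl⟩ := h
      exact (CodedInstance.Parse.eps hr' h i).value_le
  · rw [← hσ₁']
    simpa using hval _ hA i hi' j hj'
  · intro v hv hv' hall hσ₂
    have h14 : σ₁ 14 0 = tab N σ (g.lhs r) i j := by rw [← hσ₁']; simp
    obtain ⟨hL₂, hr₂, hi₂, hj₂, -⟩ := hloc v (ρ := σ₁.store 14 0 v) (by rw [← hσ₁']; simp)
    obtain ⟨A₃, A₄⟩ := codeE_spec S hσ₂ hL₂ hr₂ hr' (d := 0) (by norm_num)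
    change _ = g.lhs r at A₄
    obtain ⟨a₁, a₂⟩ := addrE_spec S hσ₂ hL₂ A₃ (h12 hσ₂) (h13 hσ₂) (A₄ ▸ hA)
      (by simpa only [eval, hi₂]) (by simpa only [eval, hj₂])
    rw [A₄, show (RamExpr.reg 12).eval (σ₁.store 14 0 v) = i from hi₂,
      show (RamExpr.reg 13).eval (σ₁.store 14 0 v) = j from hj₂] at a₂
    refine ⟨a₁, fits_reg hσ₂ 14, v, hv, h14 ▸ hv', ?_, ?_⟩
    · simp only [relaxOptions, List.forall_mem_cons, gL', gT', eval_mul_ne_zero, gI', gS',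
        sE'] at hall
      obtain ⟨q₁, q₂, q₃, q₄, q₅, q₆, q₇, -⟩ := hall
      constructor
      · intro h
        have := q₁ h
        rwa [eval, (o1 h).2] at this
      · intro h
        have := q₂ h
        rwa [eval, (o2 h).2] at this
      · intro h
        have := q₃ h
        rwa [eval, (o3 B₁ B₂ (S.valid.fst_lt r hr' h) hi₁ hi' hi₁ hi').2,
          (o3 C₁ C₂ (S.valid.snd_lt r hr' h) hi₁ hi' hj₁ hj').2] at this
      · intro h
        have := q₄ h
        rwa [eval, (o3 B₁ B₂ (S.valid.fst_lt r hr' h) hi₁ hi' hj₁ hj').2,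
          (o3 C₁ C₂ (S.valid.snd_lt r hr' h) hj₁ hj' hj₁ hj').2] at this
      · exact fun h h' => q₅ ⟨h, h'⟩
      · exact fun h h' => q₆ ⟨h, h'⟩
      · exact fun h h' => q₇ ⟨h, h'⟩
    · rw [RamState.store_same, a₂, ← hσ₁']
      simp [eval]

theorem maxCost_relax : relax.maxCost ≤ 500 := by decide

/-- Relax the cell `(i, j)` with all productions. -/
def relaxAll : RamProg := forLoop 10 (.read 0 (.const 2)) relax

/-- Compute the final values of the cell `(i, j)`. -/
def closeCell : RamProg := forLoop 11 (.read 0 (.const 0)) relaxAll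

theorem writes_relaxAll {a : ℕ} (h : relaxAll.Writes a) : a = 5 ∨ a = 10 ∨ a = 14 := by
  rcases writes_forLoop.1 h with h | h
  · omega
  · have := writes_relax h; omega

theorem writes_closeCell {a : ℕ} (h : closeCell.Writes a) :
    a = 5 ∨ a = 10 ∨ a = 11 ∨ a = 14 := by
  rcases writes_forLoop.1 h with h | h
  · omega
  · have := writes_relaxAll h; omega

/-- The table is updated in place, so a production sees entries already lowered by earlier ones. By
`Relaxed.mono` the resulting bounds also hold against the table at the start of the round, which is
the form that the counting argument needs. -/
theorem runs_relaxAll (S : Setting g B N) (hσ : σ.IsWord B) (hL : Loaded g N σ)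
    (hT : Table g N σ) {i j : ℕ} (hi : σ 12 0 = i) (hi' : i < N) (hj : σ 13 0 = j) (hj' : j < N) :
    relaxAll.Runs B σ (600 * (g.rules + 1)) fun σ' => Descends g N σ σ' ∧
      ∀ r < g.rules, g.Relaxed (tab N σ) r i j (tab N σ' (g.lhs r) i j) := by
  have hcode := S.code_lt
  have hframe : ∀ {σ'}, Stable B relaxAll σ σ' → ∀ a, a ≠ 5 → a ≠ 10 → a ≠ 14 → σ' a = σ a :=
    fun hs a h₁ h₂ h₃ => hs.frame a fun h => by have := writes_relaxAll h; omega
  refine Runs.mono (runs_forLoop_const hσ (n := g.rules) (by omega)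
    (fun h => by have := writes_relax h; omega)
    (fun r σ' => Descends g N σ σ' ∧
      ∀ r' < r, g.Relaxed (tab N σ) r' i j (tab N σ' (g.lhs r') i j)) 500 ?_ ?_ ?_ ?_) ?_
    fun _ h => h
  · intro σ' hs
    have h0 := hframe hs 0 (by norm_num) (by norm_num) (by norm_num)
    exact ⟨(fits_read hs.isWord _).2 (fits_const.2 (by omega)), by simp only [eval, h0, hL.rules]⟩
  · rintro r σ' v ⟨h₁, h₂⟩
    have h5 : σ'.store 10 0 v 5 = σ' 5 := RamState.store_ne _ _ _ (by norm_num)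
    exact ⟨h₁.congr rfl h5, by rwa [tab_congr h5]⟩
  · exact ⟨hT.refl, fun r h => absurd h (Nat.not_lt_zero r)⟩
  · rintro r σ' hs hr hr' ⟨h₁, h₂⟩
    have hL' : Loaded g N σ' := hL.congr fun a ha => hframe hs a (by omega) (by omega) (by omega)
    have h12 := hframe hs 12 (by norm_num) (by norm_num) (by norm_num)
    have h13 := hframe hs 13 (by norm_num) (by norm_num) (by norm_num)
    have hT' := hT.descends h₁
    refine (runs_of_wp hs.isWord (wp_relax S hs.isWord hL' hT' hr' hr (i := i) (j := j)
      (by rw [h12, hi]) hi' (by rw [h13, hj]) hj')).mono maxCost_relax ?_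
    rintro σ'' ⟨v, hv, hv', hrel, hup⟩
    have hd := descends_of_update hT' hi' hj' hv hv' hup
    refine ⟨h₁.trans hd, fun r' hr'' => ?_⟩
    rcases Nat.lt_succ_iff_lt_or_eq.1 hr'' with hlt | rfl
    · exact (h₂ r' hlt).mono S.valid (by omega)
        (fun A _ => ⟨fun _ => le_rfl, fun _ => le_rfl, le_rfl, le_rfl, le_rfl⟩)
        (hd _ (S.valid.lhs_lt r' (by omega)) i hi' j hj').2
    · rw [(tab_update hi' hj' hup).1]
      refine hrel.mono S.valid hr (fun A hA => ⟨fun h => ?_, fun h => ?_, ?_, ?_, ?_⟩) le_rfl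
      · exact (h₁ A hA i hi' (j - 1) (by omega)).2
      · exact (h₁ A hA (i + 1) (by omega) j hj').2
      · exact (h₁ A hA i hi' i hi').2
      · exact (h₁ A hA i hi' j hj').2
      · exact (h₁ A hA j hj' j hj').2
  · simp only [cost]
    omega

theorem Descends.eq_value {σ' : RamState} (h : Descends g N σ σ') {A i j : ℕ} (hA : A < g.nts)
    (hi : i < N) (hj : j < N) (hv : tab N σ A i j = g.value A i j) :
    tab N σ' A i j = g.value A i j := by
  have := h A hA i hi j hj
  omega

theorem Descends.ready {σ' : RamState} (h : Descends g N σ σ') (hg : g.Valid) {i j : ℕ}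
    (hi : i < N) (hj : j < N) (hr : g.Ready (tab N σ) i j) : g.Ready (tab N σ') i j where
  left hij A hA := h.eq_value hA hi (by omega) (hr.left hij A hA)
  right hij A hA := h.eq_value hA (by omega) hj (hr.right hij A hA)
  diagL hij A hA := h.eq_value hA hi hi (hr.diagL hij A hA)
  diagR hij A hA := h.eq_value hA hj hj (hr.diagR hij A hA)
  mid r hr' ht l hl hl' := (h _ (hg.lhs_lt r hr') i hi j hj).2.trans (hr.mid r hr' ht l hl hl')
  le_cap A hA := (h A hA i hi j hj).2.trans (hr.le_cap A hA)

/-- The invariant after `m` rounds is that at least `m` nonterminals are finished, if the cell was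
ready at the start. Unready cells, such as those to the right of the string, are processed all the
same, and only the bounds of `Descends` are claimed for them. -/
theorem runs_closeCell (S : Setting g B N) (hσ : σ.IsWord B) (hL : Loaded g N σ)
    (hT : Table g N σ) {i j : ℕ} (hi : σ 12 0 = i) (hi' : i < N) (hj : σ 13 0 = j) (hj' : j < N) :
    closeCell.Runs B σ (700 * ((g.nts + 1) * (g.rules + 1))) fun σ' => Descends g N σ σ' ∧
      (g.Ready (tab N σ) i j → ∀ A < g.nts, tab N σ' A i j = g.value A i j) := by
  have hnB : g.nts < B := by
    have h1 := S.table_lt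
    have h2 := S.len_lt
    have h3 : g.nts ≤ g.nts * N * N := by
      rw [mul_assoc]; exact Nat.le_mul_of_pos_right _ (Nat.mul_pos (by omega) (by omega))
    omega
  have hframe : ∀ {σ'}, Stable B closeCell σ σ' → ∀ a, a ≠ 5 → a ≠ 10 → a ≠ 11 → a ≠ 14 →
      σ' a = σ a :=
    fun hs a h₁ h₂ h₃ h₄ => hs.frame a fun h => by have := writes_closeCell h; omega
  refine Runs.mono (runs_forLoop_const hσ hnB (fun h => by have := writes_relaxAll h; omega)
    (fun m σ' => Descends g N σ σ' ∧ (g.Ready (tab N σ) i j →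
      m ≤ g.finished i j fun A => tab N σ' A i j)) (600 * (g.rules + 1)) ?_ ?_ ?_ ?_) ?_ ?_
  · intro σ' hs
    have h0 := hframe hs 0 (by norm_num) (by norm_num) (by norm_num) (by norm_num)
    exact ⟨(fits_read hs.isWord _).2 (fits_const.2 (by omega)), by simp only [eval, h0, hL.nts]⟩
  · rintro r σ' v ⟨h₁, h₂⟩
    have h5 : σ'.store 11 0 v 5 = σ' 5 := RamState.store_ne _ _ _ (by norm_num)
    exact ⟨h₁.congr rfl h5, by rwa [tab_congr h5]⟩
  · exact ⟨hT.refl, fun _ => Nat.zero_le _⟩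
  · rintro m σ' hs hm - ⟨h₁, h₂⟩
    have hL' : Loaded g N σ' := hL.congr fun a ha =>
      hframe hs a (by omega) (by omega) (by omega) (by omega)
    have h12 := hframe hs 12 (by norm_num) (by norm_num) (by norm_num) (by norm_num)
    have h13 := hframe hs 13 (by norm_num) (by norm_num) (by norm_num) (by norm_num)
    have hT' := hT.descends h₁
    refine (runs_relaxAll S hs.isWord hL' hT' (i := i) (j := j) (by rw [h12, hi]) hi'
      (by rw [h13, hj]) hj').mono le_rfl ?_
    rintro σ'' ⟨hd, hrel⟩
    refine ⟨h₁.trans hd, fun hready => ?_⟩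
    exact CodedInstance.finished_lt S.valid (h₁.ready S.valid hi' hj' hready)
      (fun A hA => (hd A hA i hi' j hj').1) (fun A hA => (hd A hA i hi' j hj').2) hrel hm
      (h₂ hready)
  · simp only [cost]
    nlinarith
  · rintro σ' ⟨h₁, h₂⟩
    exact ⟨h₁, fun hr => CodedInstance.eq_value_of_finished (h₂ hr)⟩

end EditDP

/-- Within `Dt n` steps the program `D` computes distance products of `n × n` matrices. -/
def MultipliesWithin (D : RamProg) (c : ℕ) (Dt : ℕ → ℕ) : Prop :=
  ∀ n : ℕ, 1 ≤ n → ∀ (X Y : Matrix (Fin n) (Fin n) ℕ) (M : ℕ),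
    (∀ i j, X i j ≤ M) → (∀ i j, Y i j ≤ M) →
    ∀ B : ℕ, (n + M + 2) ^ c ≤ B → ∀ σ : RamState, σ.IsWord B →
      σ 0 0 = n → σ.HoldsMatrix 1 X → σ.HoldsMatrix 2 Y →
      D.Runs B σ (Dt n) fun σ' => σ'.HoldsMatrix 3 (distanceProduct X Y)

theorem RamProg.Runs.shift {B d τ : ℕ} {c : RamProg} {σ : RamState} {P : RamState → Prop}
    (h : c.Runs B (σ.above d) τ P) : (c.shift d).Runs B σ τ fun σ' => P (σ'.above d) := by
  obtain ⟨t, σ', h₁, h₂, h₃⟩ := h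
  have := h₁.shift (d := d) σ
  rw [RamState.glue_above] at this
  exact ⟨t, _, this, h₂, by simpa only [RamState.above_glue] using h₃⟩

theorem distanceProduct_le {n : ℕ} (X Y : Matrix (Fin n) (Fin n) ℕ) (i k j : Fin n) :
    distanceProduct X Y i j ≤ X i k + Y k j :=
  ciInf_le (OrderBot.bddBelow _) k

theorem le_distanceProduct {n : ℕ} (X Y : Matrix (Fin n) (Fin n) ℕ) (i j : Fin n) {v : ℕ}
    (h : ∀ k, v ≤ X i k + Y k j) : v ≤ distanceProduct X Y i j :=
  haveI : Nonempty (Fin n) := ⟨i⟩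
  le_ciInf h

/-! ### Distance products of blocks of the table -/

namespace EditDP

open RamExpr RamProg

variable {g : CodedInstance} {B N : ℕ} {σ : RamState}

/-- The entry with the running index of the block of the table at the offsets `x` and `y`. -/
abbrev blockRow (x : ℕ) : RamExpr := .op .add (.reg x) (.op .div (.reg 17) (.reg 9))

/-- The column of the entry with the running index of a block of the table at offset `y`. -/
abbrev blockCol (y : ℕ) : RamExpr := .op .add (.reg y) (.op .mod (.reg 17) (.reg 9))

/-- Copy the entry with the running index of the two blocks to be multiplied. -/
def copyEntry : RamProg :=
  .seq (.assign 101 (.reg 17) (tabE (codeE 2) (blockRow 18) (blockCol 16)))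
    (.assign 102 (.reg 17) (tabE (codeE 3) (blockRow 16) (blockCol 13)))

/-- Merge the entry with the running index of the product into the table. -/
def mergeEntry : RamProg :=
  .seq (set 14 (tabE (codeE 0) (blockRow 18) (blockCol 13)))
    (.seq (minOver 14 [(.const 1, .read 103 (.reg 17))])
      (.assign 5 (addrE (codeE 0) (blockRow 18) (blockCol 13)) (.reg 14)))

/-- Multiply two blocks of the table for the current production. -/
def multiply (D : RamProg) : RamProg :=
  .ite (.op .eq (codeE 1) (.const 2))
    (.seq (set 100 (.reg 9))
      (.seq (forLoop 17 (.op .mul (.reg 9) (.reg 9)) copyEntry)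
        (.seq (D.shift 100) (forLoop 17 (.op .mul (.reg 9) (.reg 9)) mergeEntry))))
    .skip

theorem writes_copyEntry {a : ℕ} (h : copyEntry.Writes a) : a = 101 ∨ a = 102 := h

theorem writes_mergeEntry {a : ℕ} (h : mergeEntry.Writes a) : a = 5 ∨ a = 14 := by
  rcases h with h | h | h
  exacts [Or.inr h, Or.inr (eq_of_writes_minOver h), Or.inl h]

theorem writes_multiply {D : RamProg} {a : ℕ} (h : (multiply D).Writes a) :
    a = 5 ∨ a = 14 ∨ a = 17 ∨ 100 ≤ a := by
  rcases h with (h | h | h | h) | h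
  · change a = 100 at h; omega
  · rcases writes_forLoop.1 h with h | h
    · omega
    · have := writes_copyEntry h; omega
  · have := le_of_writes_shift h; omega
  · rcases writes_forLoop.1 h with h | h
    · omega
    · have := writes_mergeEntry h; omega
  · exact h.elim

/-- The side and the offsets of the blocks to be multiplied are in memory. -/
structure Blocks (g : CodedInstance) (N : ℕ) (σ : RamState) (p o c j : ℕ) : Prop where
  side : σ 9 0 = p
  row : σ 18 0 = o
  mid : σ 16 0 = c
  col : σ 13 0 = j
  side_pos : 1 ≤ p
  side_le : p ≤ g.len
  row_le : o + p ≤ N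
  mid_le : c + p ≤ N
  col_le : j + p ≤ N

theorem Blocks.congr {p o c j : ℕ} (h : Blocks g N σ p o c j) {ρ : RamState}
    (h₁ : ∀ a, a = 9 ∨ a = 13 ∨ a = 16 ∨ a = 18 → ρ a = σ a) : Blocks g N ρ p o c j :=
  { h with
    side := by rw [h₁ 9 (by omega)]; exact h.side
    row := by rw [h₁ 18 (by omega)]; exact h.row
    mid := by rw [h₁ 16 (by omega)]; exact h.mid
    col := by rw [h₁ 13 (by omega)]; exact h.col }

theorem block_spec (S : Setting g B N) (hσ : σ.IsWord B) (hL : Loaded g N σ) {r d x y p w u v : ℕ}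
    (hr : σ 10 0 = r) (hr' : r < g.rules) (hd : d ≤ 3) (hA : g.code (4 * r + d) < g.nts)
    (hp : σ 9 0 = p) (hw : σ 17 0 = w) (hw' : w < p * p) (hx : σ x 0 = u) (hx' : u + p ≤ N)
    (hy : σ y 0 = v) (hy' : v + p ≤ N) :
    (addrE (codeE d) (blockRow x) (blockCol y)).Fits B σ ∧
    (addrE (codeE d) (blockRow x) (blockCol y)).eval σ =
      (g.code (4 * r + d) * N + (u + w / p)) * N + (v + w % p) := by
  obtain ⟨c₁, c₂⟩ := codeE_spec S hσ hL hr hr' hd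
  have hp0 : 0 < p := Nat.pos_of_ne_zero fun h => by subst h; omega
  have hq : w / p < p := Nat.div_lt_of_lt_mul hw'
  have hm : w % p < p := Nat.mod_lt _ hp0
  have hsq := S.square_lt
  have e₁ : (blockRow x).eval σ = u + w / p := by simp only [eval, RamOp.apply, hx, hw, hp]
  have e₂ : (blockCol y).eval σ = v + w % p := by simp only [eval, RamOp.apply, hy, hw, hp]
  have f₁ : (blockRow x).Fits B σ :=
    ⟨fits_reg hσ x, fits_div.2 ⟨fits_reg hσ 17, fits_reg hσ 9⟩, by
      change (blockRow x).eval σ < B; omega⟩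
  have f₂ : (blockCol y).Fits B σ :=
    ⟨fits_reg hσ y, fits_mod.2 ⟨fits_reg hσ 17, fits_reg hσ 9⟩, by
      change (blockCol y).eval σ < B; omega⟩
  have := addrE_spec S hσ hL c₁ f₁ f₂ (c₂ ▸ hA) (by omega) (by omega)
  rwa [c₂, e₁, e₂] at this

theorem wp_copyEntry (S : Setting g B N) (hσ : σ.IsWord B) (hL : Loaded g N σ) {r p o c j w : ℕ}
    (hb : Blocks g N σ p o c j) (hr : σ 10 0 = r) (hr' : r < g.rules) (ht : g.tag r = 2)
    (hw : σ 17 0 = w) (hw' : w < p * p) :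
    copyEntry.wp B σ fun σ' => σ' =
      (σ.store 101 w (tab N σ (g.fst r) (o + w / p) (c + w % p))).store 102 w
        (tab N σ (g.snd r) (c + w / p) (j + w % p)) := by
  have hbk := S.valid.fst_lt r hr' ht
  have hck := S.valid.snd_lt r hr' ht
  obtain ⟨a₁, a₂⟩ := block_spec S hσ hL hr hr' (d := 2) (by norm_num) hbk hb.side hw hw' hb.row
    hb.row_le hb.mid hb.mid_le
  have e₀ : σ.store 101 ((RamExpr.reg 17).eval σ)
      ((tabE (codeE 2) (blockRow 18) (blockCol 16)).eval σ) =
      σ.store 101 w (tab N σ (g.fst r) (o + w / p) (c + w % p)) := by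
    rw [RamExpr.eval, RamExpr.eval, RamExpr.eval, a₂, hw]; rfl
  refine ⟨fits_reg hσ 17, (fits_read hσ 5).2 a₁, ?_⟩
  rw [e₀]
  intro hσ₁
  have hne : ∀ a, a ≠ 101 →
      σ.store 101 w (tab N σ (g.fst r) (o + w / p) (c + w % p)) a = σ a :=
    fun a ha => RamState.store_ne _ _ _ ha
  have hb₁ := hb.congr (ρ := σ.store 101 w (tab N σ (g.fst r) (o + w / p) (c + w % p)))
    fun a _ => hne a (by omega)
  obtain ⟨b₁, b₂⟩ := block_spec S hσ₁ (hL.congr fun a ha => hne a (by omega))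
    (by rw [hne 10 (by norm_num), hr]) hr' (d := 3) (by norm_num) hck
    hb₁.side (by rw [hne 17 (by norm_num), hw]) hw' hb₁.mid hb₁.mid_le hb₁.col hb₁.col_le
  refine ⟨fits_reg hσ₁ 17, (fits_read hσ₁ 5).2 b₁, ?_⟩
  rw [RamExpr.eval, RamExpr.eval, RamExpr.eval, b₂, hne 17 (by norm_num), hw, hne 5 (by norm_num)]
  rfl

theorem wp_mergeEntry (S : Setting g B N) (hσ : σ.IsWord B) (hL : Loaded g N σ)
    (hT : Table g N σ) {r p o c j w : ℕ}
    (hb : Blocks g N σ p o c j) (hr : σ 10 0 = r) (hr' : r < g.rules)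
    (hw : σ 17 0 = w) (hw' : w < p * p)
    (hlo : g.value (g.lhs r) (o + w / p) (j + w % p) ≤ σ 103 w) :
    mergeEntry.wp B σ fun σ' => Descends g N σ σ' ∧
      tab N σ' (g.lhs r) (o + w / p) (j + w % p) ≤ σ 103 w := by
  have hB : 1 < B := by have := S.cap_lt; omega
  have hA := S.valid.lhs_lt r hr'
  have hp0 := hb.side_pos
  have hq : w / p < p := Nat.div_lt_of_lt_mul hw'
  have hm : w % p < p := Nat.mod_lt _ hp0
  have ho := hb.row_le
  have hj := hb.col_le
  obtain ⟨a₁, a₂⟩ := block_spec S hσ hL hr hr' (d := 0) (by norm_num) hA hb.side hw hw' hb.row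
    hb.row_le hb.col hb.col_le
  have e₀ : σ.store 14 ((RamExpr.const 0).eval σ)
      ((tabE (codeE 0) (blockRow 18) (blockCol 13)).eval σ) =
      σ.store 14 0 (tab N σ (g.lhs r) (o + w / p) (j + w % p)) := by
    rw [RamExpr.eval, RamExpr.eval, a₂]; rfl
  refine ⟨fits_const.2 (by omega), (fits_read hσ 5).2 a₁, ?_⟩
  rw [e₀]
  intro hσ₁
  set x := tab N σ (g.lhs r) (o + w / p) (j + w % p) with hx
  have e₁ : (RamExpr.read 103 (.reg 17)).eval (σ.store 14 0 x) = σ 103 w := by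
    simp [RamExpr.eval, hw]
  refine wp_minOver (lo := g.value (g.lhs r) (o + w / p) (j + w % p)) hB _ hσ₁ (by simp)
    ?_ ?_ ?_
  · simp only [List.forall_mem_cons, e₁]
    exact ⟨⟨fits_const.2 hB, fun _ => ⟨(fits_read hσ₁ _).2 (fits_reg hσ₁ 17), hlo⟩⟩, by simp⟩
  · simpa using hT.value_le _ hA _ (by omega) _ (by omega)
  · intro v hv hv' hall hσ₂
    rw [RamState.store_store] at hσ₂ ⊢
    have hv₁ : v ≤ σ 103 w := by
      simp only [List.forall_mem_cons, e₁] at hall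
      exact hall.1 (by simp [eval])
    have hv₂ : v ≤ x := by simpa using hv'
    have hne : ∀ a, a ≠ 14 → σ.store 14 0 v a = σ a := fun a ha => RamState.store_ne _ _ _ ha
    have hb₁ := hb.congr (ρ := σ.store 14 0 v) fun a _ => hne a (by omega)
    obtain ⟨b₁, b₂⟩ := block_spec S hσ₂ (hL.congr fun a ha => hne a (by omega))
      (by rw [hne 10 (by norm_num), hr]) hr' (d := 0) (by norm_num) hA
      hb₁.side (by rw [hne 17 (by norm_num), hw]) hw' hb₁.row hb₁.row_le hb₁.col hb₁.col_le
    refine ⟨b₁, fits_reg hσ₂ 14, ?_⟩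
    rw [b₂]
    have hup : (σ.store 14 0 v).store 5 ((g.code (4 * r + 0) * N + (o + w / p)) * N + (j + w % p))
        ((RamExpr.reg 14).eval (σ.store 14 0 v)) 5 =
        Function.update (σ 5) ((g.lhs r * N + (o + w / p)) * N + (j + w % p)) v := by
      rw [RamState.store_same, hne 5 (by norm_num)]
      simp [eval, CodedInstance.lhs]
    exact ⟨descends_of_update hT (by omega) (by omega) hv hv₂ hup,
      (tab_update (by omega) (by omega) hup).1.le.trans hv₁⟩

theorem maxCost_copyEntry : copyEntry.maxCost ≤ 100 := by decide

theorem maxCost_mergeEntry : mergeEntry.maxCost ≤ 100 := by decide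


theorem runs_copyLoop (S : Setting g B N) (hσ : σ.IsWord B) (hL : Loaded g N σ) {r p o c j : ℕ}
    (hb : Blocks g N σ p o c j) (hr : σ 10 0 = r) (hr' : r < g.rules) (ht : g.tag r = 2) :
    (forLoop 17 (.op .mul (.reg 9) (.reg 9)) copyEntry).Runs B σ (200 * (p * p + 1)) fun σ' =>
      ∀ w < p * p, σ' 101 w = tab N σ (g.fst r) (o + w / p) (c + w % p) ∧
        σ' 102 w = tab N σ (g.snd r) (c + w / p) (j + w % p) := by
  have hpN : p ≤ N := by have := hb.row_le; omega
  have hpp : p * p < B := by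
    have := Nat.mul_le_mul hpN hpN
    have := S.square_lt
    omega
  have hframe : ∀ {σ'}, Stable B (forLoop 17 (.op .mul (.reg 9) (.reg 9)) copyEntry) σ σ' →
      ∀ a < 100, a ≠ 17 → σ' a = σ a := fun hs a h₁ h₂ => hs.frame a fun h => by
    rcases writes_forLoop.1 h with h | h
    · omega
    · have := writes_copyEntry h; omega
  refine (runs_forLoop_const hσ hpp (fun h => by have := writes_copyEntry h; omega)
    (fun m σ' => ∀ w < m, σ' 101 w = tab N σ (g.fst r) (o + w / p) (c + w % p) ∧
        σ' 102 w = tab N σ (g.snd r) (c + w / p) (j + w % p)) 100 ?_ ?_ ?_ ?_).mono ?_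
    fun _ h => h
  · intro σ' hs
    have h9 : σ' 9 0 = p := by rw [hframe hs 9 (by norm_num) (by norm_num), hb.side]
    refine ⟨⟨fits_reg hs.isWord 9, fits_reg hs.isWord 9, ?_⟩, ?_⟩ <;>
      simp only [eval, RamOp.apply, h9]
    exact hpp
  · intro m σ' v h w hw
    rw [RamState.store_ne _ _ _ (by norm_num), RamState.store_ne _ _ _ (by norm_num)]
    exact h w hw
  · exact fun w hw => absurd hw (Nat.not_lt_zero w)
  · intro m σ' hs hm hm' hI
    have hf := hframe hs
    refine (runs_of_wp hs.isWord (wp_copyEntry S hs.isWord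
      (hL.congr fun a ha => hf a (by omega) (by omega)) (hb.congr fun a ha => hf a (by omega)
        (by omega)) (by rw [hf 10 (by norm_num) (by norm_num), hr]) hr' ht hm' hm)).mono
      maxCost_copyEntry ?_
    rintro σ'' rfl w hw
    rw [tab_congr (hf 5 (by norm_num) (by norm_num))]
    rcases Nat.lt_succ_iff_lt_or_eq.1 hw with hlt | rfl
    · have := hI w hlt
      simp only [RamState.store_apply]
      rw [if_neg (by omega), if_neg (by omega), if_neg (by omega), if_neg (by omega)]
      exact this
    · simp
  · simp only [cost]
    omega

theorem runs_mergeLoop (S : Setting g B N) (hσ : σ.IsWord B) (hL : Loaded g N σ)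
    (hT : Table g N σ) {r p o c j : ℕ} (hb : Blocks g N σ p o c j) (hr : σ 10 0 = r)
    (hr' : r < g.rules)
    (hlo : ∀ w < p * p, g.value (g.lhs r) (o + w / p) (j + w % p) ≤ σ 103 w) :
    (forLoop 17 (.op .mul (.reg 9) (.reg 9)) mergeEntry).Runs B σ (200 * (p * p + 1)) fun σ' =>
      Descends g N σ σ' ∧
        ∀ w < p * p, tab N σ' (g.lhs r) (o + w / p) (j + w % p) ≤ σ 103 w := by
  have hpN : p ≤ N := by have := hb.row_le; omega
  have hA := S.valid.lhs_lt r hr'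
  have hpp : p * p < B := by
    have := Nat.mul_le_mul hpN hpN
    have := S.square_lt
    omega
  have hframe : ∀ {σ'}, Stable B (forLoop 17 (.op .mul (.reg 9) (.reg 9)) mergeEntry) σ σ' →
      ∀ a, a ≠ 5 → a ≠ 14 → a ≠ 17 → σ' a = σ a := fun hs a h₁ h₂ h₃ => hs.frame a fun h => by
    rcases writes_forLoop.1 h with h | h
    · omega
    · have := writes_mergeEntry h; omega
  refine (runs_forLoop_const hσ hpp (fun h => by have := writes_mergeEntry h; omega)
    (fun m σ' => Descends g N σ σ' ∧
        ∀ w < m, tab N σ' (g.lhs r) (o + w / p) (j + w % p) ≤ σ 103 w) 100 ?_ ?_ ?_ ?_).mono ?_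
    fun _ h => h
  · intro σ' hs
    have h9 : σ' 9 0 = p := by
      rw [hframe hs 9 (by norm_num) (by norm_num) (by norm_num), hb.side]
    refine ⟨⟨fits_reg hs.isWord 9, fits_reg hs.isWord 9, ?_⟩, ?_⟩ <;>
      simp only [eval, RamOp.apply, h9]
    exact hpp
  · rintro m σ' v ⟨h₁, h₂⟩
    have h5 : σ'.store 17 0 v 5 = σ' 5 := RamState.store_ne _ _ _ (by norm_num)
    exact ⟨h₁.congr rfl h5, by rwa [tab_congr h5]⟩
  · exact ⟨hT.refl, fun w hw => absurd hw (Nat.not_lt_zero w)⟩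
  · rintro m σ' hs hm hm' ⟨h₁, h₂⟩
    have hf := hframe hs
    have h103 := hf 103 (by norm_num) (by norm_num) (by norm_num)
    refine (runs_of_wp hs.isWord (wp_mergeEntry S hs.isWord
      (hL.congr fun a ha => hf a (by omega) (by omega) (by omega)) (hT.descends h₁)
      (hb.congr fun a ha => hf a (by omega) (by omega) (by omega))
      (by rw [hf 10 (by norm_num) (by norm_num) (by norm_num), hr]) hr' hm' hm
      (by rw [h103]; exact hlo m hm))).mono maxCost_mergeEntry ?_
    rintro σ'' ⟨hd, hle⟩
    refine ⟨h₁.trans hd, fun w hw => ?_⟩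
    rcases Nat.lt_succ_iff_lt_or_eq.1 hw with hlt | rfl
    · have hw' : w < p * p := by omega
      have hp0 := hb.side_pos
      have hq : w / p < p := Nat.div_lt_of_lt_mul hw'
      have hmod : w % p < p := Nat.mod_lt _ hp0
      have := hb.row_le
      have := hb.col_le
      exact (hd _ hA _ (by omega) _ (by omega)).2.trans (h₂ w hlt)
    · rwa [h103] at hle
  · simp only [cost]
    omega

/-- The subroutine can be called again and again on dirty memory because its specification assumes
nothing outside its input. Entries are at most `g.len + 1` and the side at most `g.len`, whence the
base `2 * g.len + 3` in the word bound. The product never falls below the values by `value_bin`, so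
merging it into the table is safe even if some factors are not final. -/
theorem runs_multiply {D : RamProg} {c₀ : ℕ} {Dt : ℕ → ℕ} (hD : MultipliesWithin D c₀ Dt)
    (S : Setting g B N) (hB : (2 * g.len + 3) ^ c₀ ≤ B) (hσ : σ.IsWord B) (hL : Loaded g N σ)
    (hT : Table g N σ) {r p o c j : ℕ} (hb : Blocks g N σ p o c j) (hr : σ 10 0 = r)
    (hr' : r < g.rules) :
    (multiply D).Runs B σ (Dt p + 500 * (p * p + 1)) fun σ' => Descends g N σ σ' ∧
      (g.tag r = 2 → ∀ u < p, ∀ v < p, ∀ w < p, tab N σ' (g.lhs r) (o + u) (j + v) ≤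
        tab N σ (g.fst r) (o + u) (c + w) + tab N σ (g.snd r) (c + w) (j + v)) := by
  have hcap := S.cap_lt
  have hp0 := hb.side_pos
  have ho := hb.row_le
  have hc := hb.mid_le
  have hj := hb.col_le
  obtain ⟨t₁, t₂⟩ := codeE_spec S hσ hL hr hr' (d := 1) (by norm_num)
  have hguard : (RamExpr.op .eq (codeE 1) (.const 2)).eval σ ≠ 0 ↔ g.tag r = 2 := by
    rw [eval_eq_ne_zero, t₂]; rfl
  refine (Runs.ite (τ := 4 + (200 * (p * p + 1) + (Dt p + 200 * (p * p + 1)))) (τ' := 1)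
    ((fits_eq (by omega)).2 ⟨t₁, fits_const.2 (by omega)⟩) (fun h => ?_) (fun h => ?_)).mono
    (by simp only [cost]; omega) fun _ h => h
  swap
  · refine (runs_of_wp hσ ?_).mono le_rfl fun _ h => h
    exact ⟨hT.refl, fun ht => absurd h (hguard.2 ht)⟩
  have ht := hguard.1 h
  have hbk := S.valid.fst_lt r hr' ht
  have hck := S.valid.snd_lt r hr' ht
  have hset : (set 100 (.reg 9)).Runs B σ 4 fun σ' => σ' = σ.store 100 0 p := by
    refine (runs_of_wp (c := set 100 (.reg 9)) (Q := fun σ' => σ' = σ.store 100 0 p) hσ ?_).mono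
      (by decide) fun _ h => h
    exact ⟨fits_const.2 (by omega), fits_reg hσ 9, by simp [eval, hb.side]⟩
  refine hset.seq hσ fun σ₁ hσ₁ hs₁ => ?_
  have f₁ : ∀ a, a ≠ 100 → σ₁ a = σ a := fun a ha => by
    rw [hσ₁]; exact RamState.store_ne _ _ _ ha
  have h100 : σ₁ 100 0 = p := by rw [hσ₁]; simp
  have tab₁ : tab N σ₁ = tab N σ := tab_congr (f₁ 5 (by norm_num))
  refine (runs_copyLoop S hs₁.isWord (hL.congr fun a _ => f₁ a (by omega))
    (hb.congr fun a _ => f₁ a (by omega)) (by rw [f₁ 10 (by norm_num), hr]) hr' ht).seq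
    hs₁.isWord fun σ₂ hcopy hs₂ => ?_
  have f₂ : ∀ a, a ≠ 17 → a ≠ 100 → a ≠ 101 → a ≠ 102 → σ₂ a = σ a := fun a h₁ h₂ h₃ h₄ => by
    rw [← f₁ a h₂]
    refine hs₂.frame a fun h => ?_
    rcases writes_forLoop.1 h with h | h
    · omega
    · have := writes_copyEntry h; omega
  have h100' : σ₂ 100 0 = p := by
    rw [← h100]
    refine congrFun (hs₂.frame 100 fun h => ?_) 0
    rcases writes_forLoop.1 h with h | h
    · omega
    · have := writes_copyEntry h; omega
  rw [tab₁] at hcopy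
  have hidx : ∀ u v : Fin p, (u : ℕ) * p + v < p * p ∧ ((u : ℕ) * p + v) / p = u ∧
      ((u : ℕ) * p + v) % p = v := fun u v => by
    refine ⟨?_, ?_, ?_⟩
    · have h₁ : ((u : ℕ) + 1) * p ≤ p * p := Nat.mul_le_mul_right _ u.2
      have h₂ := v.2
      rw [add_mul] at h₁
      omega
    · rw [mul_comm, Nat.mul_add_div hp0, Nat.div_eq_of_lt v.2, add_zero]
    · rw [mul_comm, Nat.mul_add_mod, Nat.mod_eq_of_lt v.2]
  let X : Matrix (Fin p) (Fin p) ℕ := fun u v => tab N σ (g.fst r) (o + u) (c + v)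
  let Y : Matrix (Fin p) (Fin p) ℕ := fun u v => tab N σ (g.snd r) (c + u) (j + v)
  have hrun : D.Runs B (σ₂.above 100) (Dt p) fun σ' => σ'.HoldsMatrix 3 (distanceProduct X Y) := by
    refine hD p hp0 X Y (g.len + 1)
      (fun u v => hT.le_cap _ hbk _ (by omega) _ (by omega))
      (fun u v => hT.le_cap _ hck _ (by omega) _ (by omega)) B
      (le_trans (Nat.pow_le_pow_left (by have := hb.side_le; omega) _) hB) _
      (fun a i => hs₂.isWord _ _) h100' ?_ ?_
    · intro u v
      obtain ⟨h₁, h₂, h₃⟩ := hidx u v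
      have := (hcopy _ h₁).1
      rwa [h₂, h₃] at this
    · intro u v
      obtain ⟨h₁, h₂, h₃⟩ := hidx u v
      have := (hcopy _ h₁).2
      rwa [h₂, h₃] at this
  refine hrun.shift.seq hs₂.isWord fun σ₃ hprod hs₃ => ?_
  have f₃ : ∀ a < 100, a ≠ 17 → σ₃ a = σ a := fun a h₁ h₂ => by
    rw [← f₂ a h₂ (by omega) (by omega) (by omega)]
    exact hs₃.frame a fun h => by have := le_of_writes_shift h; omega
  have tab₃ : tab N σ₃ = tab N σ := tab_congr (f₃ 5 (by norm_num) (by norm_num))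
  have hprod' : ∀ u v : Fin p, σ₃ 103 ((u : ℕ) * p + v) = distanceProduct X Y u v := hprod
  have hlo : ∀ w < p * p, g.value (g.lhs r) (o + w / p) (j + w % p) ≤ σ₃ 103 w := by
    intro w hw
    have hq : w / p < p := Nat.div_lt_of_lt_mul hw
    have hm : w % p < p := Nat.mod_lt _ hp0
    have := hprod' ⟨w / p, hq⟩ ⟨w % p, hm⟩
    rw [show w / p * p + w % p = w from Nat.div_add_mod' w p] at this
    rw [this]
    refine le_distanceProduct X Y _ _ fun k => ?_
    have hk := k.2
    exact (CodedInstance.value_bin hr' ht _ (c + k) _).trans (add_le_add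
      (hT.value_le _ hbk _ (by omega) _ (by omega)) (hT.value_le _ hck _ (by omega) _ (by omega)))
  refine (runs_mergeLoop S hs₃.isWord (hL.congr fun a _ => f₃ a (by omega) (by omega))
    (hT.congr (f₃ 5 (by norm_num) (by norm_num)))
    (hb.congr fun a _ => f₃ a (by omega) (by omega))
    (by rw [f₃ 10 (by norm_num) (by norm_num), hr]) hr' hlo).mono le_rfl ?_
  rintro σ₄ ⟨hd, hle⟩
  refine ⟨hd.congr (f₃ 5 (by norm_num) (by norm_num)).symm rfl, fun _ u hu v hv w hw => ?_⟩
  obtain ⟨h₁, h₂, h₃⟩ := hidx ⟨u, hu⟩ ⟨v, hv⟩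
  have h₄ := hle _ h₁
  rw [hprod' ⟨u, hu⟩ ⟨v, hv⟩, h₂, h₃] at h₄
  exact h₄.trans (distanceProduct_le X Y _ ⟨w, hw⟩ _)

/-- Multiply two blocks of the table for all productions. -/
def multiplyAll (D : RamProg) : RamProg := forLoop 10 (.read 0 (.const 2)) (multiply D)

theorem writes_multiplyAll {D : RamProg} {a : ℕ} (h : (multiplyAll D).Writes a) :
    a = 5 ∨ a = 10 ∨ a = 14 ∨ a = 17 ∨ 100 ≤ a := by
  rcases writes_forLoop.1 h with h | h
  · omega
  · have := writes_multiply h; omega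

/-- The splits in the middle block have been taken into account, the factors being read in `σ`. -/
def Included (g : CodedInstance) (N : ℕ) (σ σ' : RamState) (p o c j : ℕ) : Prop :=
  ∀ r < g.rules, g.tag r = 2 → ∀ u < p, ∀ v < p, ∀ w < p, tab N σ' (g.lhs r) (o + u) (j + v) ≤
    tab N σ (g.fst r) (o + u) (c + w) + tab N σ (g.snd r) (c + w) (j + v)

/-- Later productions may read factors lowered by earlier ones; this only strengthens the bounds,
which are therefore stated with the factors of the initial state. -/
theorem runs_multiplyAll {D : RamProg} {c₀ : ℕ} {Dt : ℕ → ℕ} (hD : MultipliesWithin D c₀ Dt)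
    (S : Setting g B N) (hB : (2 * g.len + 3) ^ c₀ ≤ B) (hσ : σ.IsWord B) (hL : Loaded g N σ)
    (hT : Table g N σ) {p o c j : ℕ} (hb : Blocks g N σ p o c j) :
    (multiplyAll D).Runs B σ ((g.rules + 1) * (Dt p + 600 * (p * p + 1))) fun σ' =>
      Descends g N σ σ' ∧ Included g N σ σ' p o c j := by
  have hcode := S.code_lt
  have ho := hb.row_le
  have hc := hb.mid_le
  have hj := hb.col_le
  have hframe : ∀ {σ'}, Stable B (multiplyAll D) σ σ' → ∀ a < 100, a ≠ 5 → a ≠ 10 → a ≠ 14 →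
      a ≠ 17 → σ' a = σ a :=
    fun hs a h₁ h₂ h₃ h₄ h₅ => hs.frame a fun h => by have := writes_multiplyAll h; omega
  refine (runs_forLoop_const hσ (n := g.rules) (by omega)
    (fun h => by have := writes_multiply h; omega)
    (fun m σ' => Descends g N σ σ' ∧ ∀ r < m, g.tag r = 2 → ∀ u < p, ∀ v < p, ∀ w < p,
      tab N σ' (g.lhs r) (o + u) (j + v) ≤
        tab N σ (g.fst r) (o + u) (c + w) + tab N σ (g.snd r) (c + w) (j + v))
    (Dt p + 500 * (p * p + 1)) ?_ ?_ ?_ ?_).mono ?_ fun _ h => h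
  · intro σ' hs
    have h0 := hframe hs 0 (by norm_num) (by norm_num) (by norm_num) (by norm_num) (by norm_num)
    exact ⟨(fits_read hs.isWord _).2 (fits_const.2 (by omega)), by simp only [eval, h0, hL.rules]⟩
  · rintro r σ' v ⟨h₁, h₂⟩
    have h5 : σ'.store 10 0 v 5 = σ' 5 := RamState.store_ne _ _ _ (by norm_num)
    exact ⟨h₁.congr rfl h5, by rwa [tab_congr h5]⟩
  · exact ⟨hT.refl, fun r h => absurd h (Nat.not_lt_zero r)⟩
  · rintro r σ' hs hr hr' ⟨h₁, h₂⟩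
    have hf := hframe hs
    refine (runs_multiply hD S hB hs.isWord
      (hL.congr fun a ha => hf a (by omega) (by omega) (by omega) (by omega) (by omega))
      (hT.descends h₁)
      (hb.congr fun a ha => hf a (by omega) (by omega) (by omega) (by omega) (by omega)) hr'
      hr).mono le_rfl ?_
    rintro σ'' ⟨hd, hle⟩
    refine ⟨h₁.trans hd, fun r' hr'' ht u hu v hv w hw => ?_⟩
    rcases Nat.lt_succ_iff_lt_or_eq.1 hr'' with hlt | rfl
    · exact (hd _ (S.valid.lhs_lt r' (by omega)) _ (by omega) _ (by omega)).2.trans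
        (h₂ r' hlt ht u hu v hv w hw)
    · exact (hle ht u hu v hv w hw).trans (add_le_add
        (h₁ _ (S.valid.fst_lt r' hr ht) _ (by omega) _ (by omega)).2
        (h₁ _ (S.valid.snd_lt r' hr ht) _ (by omega) _ (by omega)).2)
  · simp only [cost]
    nlinarith

end EditDP

/-! ### Splits and blocks -/

/-- The time at which the cell `(i, j)` receives its final value. -/
def cellTime (N i j : ℕ) : ℕ := interleave (N - 1 - i) j

/-- In the division into blocks of side `p`, the position `h` lies in the block after that of `i` or
before that of `j`, and the three blocks do not merge in pairs otherwise. -/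
def SplitAt (p i h j : ℕ) : Prop :=
  (i / p % 2 = 0 ∧ h / p = i / p + 1 ∧ h / p < j / p) ∨
    (j / p % 2 = 1 ∧ h / p + 1 = j / p ∧ i / p < h / p)

/-- The level is the one just below the first at which the three blocks are no longer distinct. Two
neighbouring block numbers merge on halving exactly when they differ by one and the smaller is even,
which gives the parities in `SplitAt`. -/
theorem exists_splitAt {i h j : ℕ} (h₁ : i < h) (h₂ : h < j) :
    ∃ l, 2 ^ l ≤ j ∧ SplitAt (2 ^ l) i h j := by
  have hex : ∃ l, ¬(i / 2 ^ l < h / 2 ^ l ∧ h / 2 ^ l < j / 2 ^ l) := by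
    -- At level `j` every block number up to that of `j` is zero.
    refine ⟨j, fun hj => ?_⟩
    rw [Nat.div_eq_of_lt (Nat.lt_two_pow_self (n := j))] at hj
    exact absurd hj.2 (Nat.not_lt_zero _)
  classical
  have hspec := Nat.find_spec hex
  rcases hl : Nat.find hex with _ | l
  · rw [hl] at hspec
    simp only [pow_zero, Nat.div_one] at hspec
    exact absurd ⟨h₁, h₂⟩ hspec
  · have hmin := not_not.1 (Nat.find_min hex (m := l) (by omega))
    rw [hl, pow_succ] at hspec
    simp only [← Nat.div_div_eq_div_mul] at hspec
    refine ⟨l, ?_, ?_⟩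
    · by_contra hlt
      rw [Nat.div_eq_of_lt (show j < 2 ^ l by omega)] at hmin
      exact absurd hmin.2 (Nat.not_lt_zero _)
    · unfold SplitAt
      generalize i / 2 ^ l = a at *
      generalize h / 2 ^ l = b at *
      generalize j / 2 ^ l = c at *
      omega

/-- Reversing the rows maps blocks to blocks because the block side divides the table side. -/
theorem sub_div_of_dvd {N p h : ℕ} (hp : 0 < p) (hN : p ∣ N) (hh : h < N) :
    (N - 1 - h) / p = N / p - 1 - h / p := by
  obtain ⟨n, rfl⟩ := hN
  rw [Nat.mul_div_cancel_left _ hp]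
  have h₁ := Nat.div_add_mod h p
  have h₂ := Nat.mod_lt h hp
  have hq : h / p < n := Nat.div_lt_of_lt_mul hh
  obtain ⟨k, rfl⟩ := Nat.exists_eq_add_of_lt hq
  have e : p * (h / p + k + 1) - 1 - h = p * k + (p - 1 - h % p) := by
    have : p * (h / p + k + 1) = p * (h / p) + p * k + p := by ring
    omega
  rw [e, Nat.mul_add_div hp, Nat.div_eq_of_lt (by omega)]
  omega

section Blocks

variable {L l N t i h j : ℕ}

theorem cellTime_bits (hN : N = 2 ^ L) (ht : t < N * N) :
    N - 1 - evenBits t < N ∧ oddBits t < N ∧ cellTime N (N - 1 - evenBits t) (oddBits t) = t := by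
  subst hN
  obtain ⟨h₁, h₂⟩ := bits_lt L t ht
  refine ⟨by omega, h₂, ?_⟩
  rw [cellTime, show 2 ^ L - 1 - (2 ^ L - 1 - evenBits t) = evenBits t by omega, interleave_bits]

theorem cellTime_lt_of_col (N i : ℕ) {j j' : ℕ} (h : j < j') : cellTime N i j < cellTime N i j' :=
  interleave_lt_interleave le_rfl h.le (Or.inr h)

theorem cellTime_lt_of_row {N i i' : ℕ} (j : ℕ) (h : i < i') (h' : i' < N) :
    cellTime N i' j < cellTime N i j :=
  interleave_lt_interleave (by omega) le_rfl (Or.inl (by omega))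

/-- The square of side `2 ^ l` entered at time `t`. -/
theorem block_at (hN : N = 2 ^ L) (hl : 2 ^ l ≤ N) (ht : t < N * N)
    (hdvd : 2 ^ l * 2 ^ l ∣ t) : 2 ^ l ∣ N - 1 - evenBits t + 1 ∧ 2 ^ l ∣ oddBits t ∧
      2 ^ l ≤ N - 1 - evenBits t + 1 ∧ oddBits t + 2 ^ l ≤ N := by
  have hdN : 2 ^ l ∣ N := by
    rw [hN] at hl ⊢
    exact pow_dvd_pow 2 ((Nat.pow_le_pow_iff_right (by norm_num)).1 hl)
  obtain ⟨h₁, h₂⟩ := bits_lt L t (by rwa [← hN])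
  rw [← hN] at h₁ h₂
  obtain ⟨h₃, h₄⟩ := dvd_bits l t hdvd
  have e : N - 1 - evenBits t + 1 = N - evenBits t := by omega
  rw [e]
  have h₅ : 2 ^ l ∣ N - evenBits t := Nat.dvd_sub hdN h₃
  refine ⟨h₅, h₄, Nat.le_of_dvd (by omega) h₅, ?_⟩
  have := Nat.le_of_dvd (by omega) (Nat.dvd_sub hdN h₄)
  omega

/-- Times with the same quotient by `4 ^ l` form one aligned square. The cell visited first has the
largest row and the smallest column, so the row block of the square ends at its row and the column
block starts at its column. -/
theorem mem_block_at (hN : N = 2 ^ L) (hl : 2 ^ l ≤ N)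
    (hi : i < N) (ht : t = 2 ^ l * 2 ^ l * (cellTime N i j / (2 ^ l * 2 ^ l)))
    (ht' : t < N * N) :
    i / 2 ^ l + 1 = (N - 1 - evenBits t + 1) / 2 ^ l ∧ j / 2 ^ l = oddBits t / 2 ^ l := by
  have hp : 0 < 2 ^ l := by positivity
  have hdN : 2 ^ l ∣ N := by
    rw [hN] at hl ⊢
    exact pow_dvd_pow 2 ((Nat.pow_le_pow_iff_right (by norm_num)).1 hl)
  have h₁ := interleave_div l (evenBits t) (oddBits t)
  rw [interleave_bits] at h₁
  have h₂ := interleave_div l (N - 1 - i) j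
  have h₃ : t / (2 ^ l * 2 ^ l) = cellTime N i j / (2 ^ l * 2 ^ l) := by
    conv_lhs => rw [ht]
    exact Nat.mul_div_cancel_left _ (by positivity)
  rw [h₃, cellTime, ← h₂] at h₁
  have h₄ := bits_interleave (evenBits t / 2 ^ l) (oddBits t / 2 ^ l)
  have h₅ := bits_interleave ((N - 1 - i) / 2 ^ l) (j / 2 ^ l)
  rw [h₁] at h₄
  have h₆ : (N - 1 - i) / 2 ^ l = evenBits t / 2 ^ l := h₅.1.symm.trans h₄.1
  have h₇ : j / 2 ^ l = oddBits t / 2 ^ l := h₅.2.symm.trans h₄.2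
  refine ⟨?_, h₇⟩
  have h₈ := sub_div_of_dvd hp hdN hi
  obtain ⟨h₉, -⟩ := bits_lt L t (by rwa [← hN])
  obtain ⟨h₁₀, -⟩ := dvd_bits l t (ht ▸ dvd_mul_right _ _)
  rw [← hN] at h₉
  have h₁₁ : i / 2 ^ l < N / 2 ^ l := Nat.div_lt_div_of_lt_of_dvd hdN hi
  have e : N - 1 - evenBits t + 1 = N - evenBits t := by omega
  have h₁₂ : (N - evenBits t) / 2 ^ l = N / 2 ^ l - evenBits t / 2 ^ l := by
    obtain ⟨n, hn⟩ := hdN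
    obtain ⟨x, hx⟩ := h₁₀
    rw [hn, hx, ← Nat.mul_sub, Nat.mul_div_cancel_left _ hp, Nat.mul_div_cancel_left _ hp,
      Nat.mul_div_cancel_left _ hp]
  rw [e, h₁₂]
  generalize i / 2 ^ l = a at *
  generalize N / 2 ^ l = b at *
  generalize evenBits t / 2 ^ l = c at *
  omega

/-- The factors of a split are final when the square containing the cell is entered. -/
theorem cellTime_lt_of_splitAt (hN : N = 2 ^ L) (hl : 2 ^ l ≤ N) (hi : i < N) (hh : h < N)
    (h₁ : i / 2 ^ l < h / 2 ^ l) (h₂ : h / 2 ^ l < j / 2 ^ l) :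
    cellTime N i h < 2 ^ l * 2 ^ l * (cellTime N i j / (2 ^ l * 2 ^ l)) ∧
      cellTime N h j < 2 ^ l * 2 ^ l * (cellTime N i j / (2 ^ l * 2 ^ l)) := by
  have hp : 0 < 2 ^ l := by positivity
  have hdN : 2 ^ l ∣ N := by
    rw [hN] at hl ⊢
    exact pow_dvd_pow 2 ((Nat.pow_le_pow_iff_right (by norm_num)).1 hl)
  -- Lying in an earlier square of side `2 ^ l` means being finished before the later square is
  -- entered; the two factors are in squares with smaller column block, respectively larger row
  -- block.
  have key : ∀ {a b : ℕ}, a / (2 ^ l * 2 ^ l) < b / (2 ^ l * 2 ^ l) →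
      a < 2 ^ l * 2 ^ l * (b / (2 ^ l * 2 ^ l)) := fun {a b} hab => by
    rw [mul_comm]
    exact (Nat.div_lt_iff_lt_mul (by positivity)).1 hab
  have e₁ := sub_div_of_dvd hp hdN hi
  have e₂ := sub_div_of_dvd hp hdN hh
  have h₁₁ : h / 2 ^ l < N / 2 ^ l := Nat.div_lt_div_of_lt_of_dvd hdN hh
  constructor <;> refine key ?_ <;> rw [cellTime, cellTime, ← interleave_div, ← interleave_div]
  · exact interleave_lt_interleave le_rfl h₂.le (Or.inr h₂)
  · exact interleave_lt_interleave (by omega) le_rfl (Or.inl (by omega))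

end Blocks

/-! ### The invariant of the main loop -/

namespace CodedInstance

/-- The state of the table `x` at time `t`. -/
structure Progress (g : CodedInstance) (N : ℕ) (x : ℕ → ℕ → ℕ → ℕ) (t : ℕ) : Prop where
  done : ∀ A < g.nts, ∀ i < N, ∀ j ≤ g.len, cellTime N i j < t → x A i j = g.value A i j
  mid : ∀ r < g.rules, g.tag r = 2 → ∀ l i h j, 2 ^ l ≤ g.len → i < h → h < j → j ≤ g.len →
    SplitAt (2 ^ l) i h j → 2 ^ l * 2 ^ l * (cellTime N i j / (2 ^ l * 2 ^ l)) < t →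
    x (g.lhs r) i j ≤ g.value (g.fst r) i h + g.value (g.snd r) h j

variable {g : CodedInstance} {N L t : ℕ} {x y : ℕ → ℕ → ℕ → ℕ}

theorem progress_zero (g : CodedInstance) (N : ℕ) (x : ℕ → ℕ → ℕ → ℕ) : g.Progress N x 0 where
  done _ _ _ _ _ _ h := absurd h (Nat.not_lt_zero _)
  mid _ _ _ _ _ _ _ _ _ _ _ _ h := absurd h (Nat.not_lt_zero _)

theorem Progress.mono (h : g.Progress N x t) (hg : g.Valid) (hN : g.len < N)
    (hy : ∀ A < g.nts, ∀ i < N, ∀ j < N, g.value A i j ≤ y A i j ∧ y A i j ≤ x A i j) :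
    g.Progress N y t where
  done A hA i hi j hj ht := by
    have := h.done A hA i hi j hj ht
    have := hy A hA i hi j (by omega)
    omega
  mid r hr htag l i k j hl hi hk hj hs ht :=
    (hy _ (hg.lhs_lt r hr) i (by omega) j (by omega)).2.trans
      (h.mid r hr htag l i k j hl hi hk hj hs ht)

/-- The splits which the block products at time `t` have to take into account. -/
def MidAt (g : CodedInstance) (N : ℕ) (x y : ℕ → ℕ → ℕ → ℕ) (t : ℕ) : Prop :=
  ∀ r < g.rules, g.tag r = 2 → ∀ l i h j, 2 ^ l ≤ g.len → i < h → h < j → j ≤ g.len →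
    SplitAt (2 ^ l) i h j → 2 ^ l * 2 ^ l * (cellTime N i j / (2 ^ l * 2 ^ l)) = t →
    y (g.lhs r) i j ≤ x (g.fst r) i h + x (g.snd r) h j

/-- A split of level `l` is due when the square of side `2 ^ l` around its cell is entered. If this
happens now, both factors are already final in `x`, so the bound by table entries in `MidAt` becomes
a bound by values. -/
theorem Progress.mid_succ (h : g.Progress N x t) (hg : g.Valid) (hNL : N = 2 ^ L) (hN : g.len < N)
    (hy : ∀ A < g.nts, ∀ i < N, ∀ j < N, g.value A i j ≤ y A i j ∧ y A i j ≤ x A i j)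
    (hm : g.MidAt N x y t) :
    ∀ r < g.rules, g.tag r = 2 → ∀ l i h j, 2 ^ l ≤ g.len → i < h → h < j → j ≤ g.len →
      SplitAt (2 ^ l) i h j → 2 ^ l * 2 ^ l * (cellTime N i j / (2 ^ l * 2 ^ l)) < t + 1 →
      y (g.lhs r) i j ≤ g.value (g.fst r) i h + g.value (g.snd r) h j := by
  intro r hr htag l i k j hl hi hk hj hs ht
  rcases Nat.lt_succ_iff_lt_or_eq.1 ht with hlt | heq
  · exact (h.mono hg hN hy).mid r hr htag l i k j hl hi hk hj hs hlt
  · have h₁ : i / 2 ^ l < k / 2 ^ l ∧ k / 2 ^ l < j / 2 ^ l := by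
      rcases hs with hs | hs <;> omega
    obtain ⟨h₂, h₃⟩ := cellTime_lt_of_splitAt hNL (by omega) (by omega) (by omega) h₁.1 h₁.2
      (N := N) (l := l) (i := i) (h := k) (j := j)
    rw [heq] at h₂ h₃
    rw [← h.done _ (hg.fst_lt r hr htag) i (by omega) k (by omega) h₂,
      ← h.done _ (hg.snd_lt r hr htag) k (by omega) j hj h₃]
    exact hm r hr htag l i k j hl hi hk hj hs heq

/-- A square is entered no later than any of its cells is visited, so every proper split has been
accounted for by then. The neighbouring and diagonal cells have smaller times by monotonicity. -/
theorem Progress.ready (h : g.Progress N x t) (hg : g.Valid) (hNL : N = 2 ^ L) (hN : g.len < N)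
    (hy : ∀ A < g.nts, ∀ i < N, ∀ j < N, g.value A i j ≤ y A i j ∧ y A i j ≤ x A i j)
    (hm : g.MidAt N x y t) {i j : ℕ} (hi : i < N) (hj : j ≤ g.len) (ht : cellTime N i j = t)
    (hcap : ∀ A < g.nts, y A i j ≤ g.len + 1) : g.Ready y i j where
  left hij A hA := (h.mono hg hN hy).done A hA i hi _ (by omega)
    (by rw [← ht]; exact cellTime_lt_of_col N i (by omega))
  right hij A hA := (h.mono hg hN hy).done A hA _ (by omega) _ hj
    (by rw [← ht]; exact cellTime_lt_of_row j (by omega) (by omega))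
  diagL hij A hA := (h.mono hg hN hy).done A hA i hi _ (by omega)
    (by rw [← ht]; exact cellTime_lt_of_col N i (by omega))
  diagR hij A hA := (h.mono hg hN hy).done A hA _ (by omega) _ hj
    (by rw [← ht]; exact cellTime_lt_of_row j (by omega) (by omega))
  mid r hr htag k hik hkj := by
    obtain ⟨l, hl, hs⟩ := exists_splitAt hik hkj
    refine h.mid_succ hg hNL hN hy hm r hr htag l i k j (hl.trans hj) hik hkj hj hs ?_
    rw [ht]
    exact Nat.lt_succ_of_le (Nat.mul_div_le _ _)
  le_cap := hcap

/-- The tables `x`, `y`, `z` are those before the step, after the block products and after closing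
the cell. Since times determine cells, one cell only has to be finished. -/
theorem Progress.succ (h : g.Progress N x t) (hg : g.Valid) (hNL : N = 2 ^ L) (hN : g.len < N)
    (hy : ∀ A < g.nts, ∀ i < N, ∀ j < N, g.value A i j ≤ y A i j ∧ y A i j ≤ x A i j)
    (hm : g.MidAt N x y t) {i j : ℕ} (hi : i < N) (ht : cellTime N i j = t)
    (hcap : ∀ A < g.nts, y A i j ≤ g.len + 1) {z : ℕ → ℕ → ℕ → ℕ}
    (hz : ∀ A < g.nts, ∀ i < N, ∀ j < N, g.value A i j ≤ z A i j ∧ z A i j ≤ y A i j)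
    (hclose : g.Ready y i j → ∀ A < g.nts, z A i j = g.value A i j) :
    g.Progress N z (t + 1) where
  done A hA i' hi' j' hj' ht' := by
    rcases Nat.lt_succ_iff_lt_or_eq.1 ht' with hlt | heq
    · exact ((h.mono hg hN hy).mono hg hN hz).done A hA i' hi' j' hj' hlt
    · have h₁ := bits_interleave (N - 1 - i) j
      have h₂ := bits_interleave (N - 1 - i') j'
      rw [show interleave (N - 1 - i) j = t from ht] at h₁
      rw [show interleave (N - 1 - i') j' = t from heq] at h₂
      obtain rfl : i = i' := by omega
      obtain rfl : j = j' := by omega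
      exact hclose (h.ready hg hNL hN hy hm hi hj' ht hcap) A hA
  mid r hr htag l i' k j' hl hi' hk hj hs ht' :=
    (hz _ (hg.lhs_lt r hr) i' (by omega) j' (by omega)).2.trans
      (h.mid_succ hg hNL hN hy hm r hr htag l i' k j' hl hi' hk hj hs ht')

end CodedInstance

/-! ### Block products due at a given time -/

namespace EditDP

open RamExpr RamProg

variable {g : CodedInstance} {B N : ℕ} {σ σ' σ'' : RamState}

/-- The time for the block products of one kind at blocks of side `p`. -/
def multiplyCost (g : CodedInstance) (Dt : ℕ → ℕ) (p : ℕ) : ℕ :=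
  (g.rules + 1) * (Dt p + 600 * (p * p + 1))

theorem Included.descends {p o c j : ℕ} (h : Included g N σ σ' p o c j) (hg : g.Valid)
    (hd : Descends g N σ' σ'') (ho : o + p ≤ N) (hj : j + p ≤ N) :
    Included g N σ σ'' p o c j := fun r hr ht u hu v hv w hw =>
  (hd _ (hg.lhs_lt r hr) _ (by omega) _ (by omega)).2.trans (h r hr ht u hu v hv w hw)

theorem Descends.included {p o c j : ℕ} (hd : Descends g N σ σ') (hg : g.Valid)
    (h : Included g N σ' σ'' p o c j) (ho : o + p ≤ N) (hc : c + p ≤ N) (hj : j + p ≤ N) :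
    Included g N σ σ'' p o c j := fun r hr ht u hu v hv w hw =>
  (h r hr ht u hu v hv w hw).trans (add_le_add
    (hd _ (hg.fst_lt r hr ht) _ (by omega) _ (by omega)).2
    (hd _ (hg.snd_lt r hr ht) _ (by omega) _ (by omega)).2)

/-- If the value of `e` is nonzero, multiply blocks with the value of `f` as the middle offset. -/
def multiplyIf (D : RamProg) (e f : RamExpr) : RamProg :=
  .ite e (.seq (set 16 f) (multiplyAll D)) .skip

theorem writes_multiplyIf {D : RamProg} {e f : RamExpr} {a : ℕ} (h : (multiplyIf D e f).Writes a) :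
    a = 5 ∨ a = 10 ∨ a = 14 ∨ a = 16 ∨ a = 17 ∨ 100 ≤ a := by
  rcases h with (h | h) | h
  · change a = 16 at h; omega
  · have := writes_multiplyAll h; omega
  · exact h.elim

theorem runs_multiplyIf {D : RamProg} {c₀ : ℕ} {Dt : ℕ → ℕ} (hD : MultipliesWithin D c₀ Dt)
    (S : Setting g B N) (hB : (2 * g.len + 3) ^ c₀ ≤ B) (hσ : σ.IsWord B) (hL : Loaded g N σ)
    (hT : Table g N σ) {e f : RamExpr} {p o c j : ℕ} (he : e.Fits B σ) (hf : f.Fits B σ)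
    (hfc : f.eval σ = c)
    (hb : e.eval σ ≠ 0 → ∀ ρ : RamState, (∀ a, a ≠ 16 → ρ a = σ a) → ρ 16 0 = c →
      Blocks g N ρ p o c j) :
    (multiplyIf D e f).Runs B σ (multiplyCost g Dt p + e.cost + f.cost + 4) fun σ' =>
      Descends g N σ σ' ∧ (e.eval σ ≠ 0 → Included g N σ σ' p o c j) := by
  have hB' : 0 < B := by have := S.cap_lt; omega
  refine (Runs.ite (τ := (f.cost + 2) + multiplyCost g Dt p) (τ' := 1) he (fun h => ?_)
    (fun h => ?_)).mono (by omega) fun _ h => h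
  · have hset : (set 16 f).Runs B σ (f.cost + 2) fun σ' => σ' = σ.store 16 0 c := by
      refine (runs_of_wp (c := set 16 f) (Q := fun σ' => σ' = σ.store 16 0 c) hσ ?_).mono
        (by simp only [maxCost, cost]; omega) fun _ h => h
      exact ⟨fits_const.2 hB', hf, by rw [hfc]; rfl⟩
    refine hset.seq hσ fun σ₁ h₁ hs => ?_
    have f₁ : ∀ a, a ≠ 16 → σ₁ a = σ a := fun a ha => by rw [h₁, RamState.store_ne _ _ _ ha]
    have f5 := f₁ 5 (by norm_num)
    refine (runs_multiplyAll hD S hB hs.isWord (hL.congr fun a ha => f₁ a (by omega))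
      (hT.congr f5) (hb h σ₁ f₁ (by rw [h₁]; simp))).mono le_rfl ?_
    rintro σ₂ ⟨hd, hi⟩
    refine ⟨hd.congr f5.symm rfl, fun _ => ?_⟩
    unfold Included at hi ⊢
    rwa [tab_congr f5] at hi
  · refine (runs_of_wp hσ ?_).mono le_rfl fun _ h => h
    exact ⟨hT.refl, fun h' => absurd h h'⟩

/-- Multiply blocks of the current side for the square with the corner in row `i` and column `j`,
and double the side. -/
def level (D : RamProg) : RamProg :=
  .seq (set 18 (.op .sub (.op .add (.reg 12) (.const 1)) (.reg 9)))
    (.seq (.ite (.op .lt (.op .add (.reg 12) (.const 1)) (.reg 13))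
        (.seq
          (multiplyIf D (.op .mod (.op .div (.op .add (.reg 12) (.const 1)) (.reg 9)) (.const 2))
            (.op .add (.reg 12) (.const 1)))
          (multiplyIf D (.op .mod (.op .div (.reg 13) (.reg 9)) (.const 2))
            (.op .sub (.reg 13) (.reg 9))))
        .skip)
      (set 9 (.op .add (.reg 9) (.reg 9))))

theorem writes_level {D : RamProg} {a : ℕ} (h : (level D).Writes a) :
    a = 5 ∨ a = 9 ∨ a = 10 ∨ a = 14 ∨ a = 16 ∨ a = 17 ∨ a = 18 ∨ 100 ≤ a := by
  rcases h with h | ((h | h) | h) | h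
  · change a = 18 at h; omega
  · have := writes_multiplyIf h; omega
  · have := writes_multiplyIf h; omega
  · exact h.elim
  · change a = 9 at h; omega

/-- The block products for the square of side `p` with the corner in row `i` and column `j` have
been taken into account. -/
def LevelDone (g : CodedInstance) (N : ℕ) (σ σ' : RamState) (p i j : ℕ) : Prop :=
  i + 1 < j → ((i + 1) / p % 2 = 1 → Included g N σ σ' p (i + 1 - p) (i + 1) j) ∧
    (j / p % 2 = 1 → Included g N σ σ' p (i + 1 - p) (j - p) j)

/-- The square occupies the row block ending at `i` and the column block starting at `j`. The first
product uses the block following the rows, the second the block preceding the columns; both are made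
if both parities allow it. -/
theorem runs_level {D : RamProg} {c₀ : ℕ} {Dt : ℕ → ℕ} (hD : MultipliesWithin D c₀ Dt)
    (S : Setting g B N) (hB : (2 * g.len + 3) ^ c₀ ≤ B) (hσ : σ.IsWord B) (hL : Loaded g N σ)
    (hT : Table g N σ) {p i j : ℕ} (hp : σ 9 0 = p) (hi : σ 12 0 = i) (hj : σ 13 0 = j)
    (hp₀ : 1 ≤ p) (hp₁ : p ≤ g.len) (hpi : p ∣ i + 1) (hpj : p ∣ j) (hpi' : p ≤ i + 1)
    (hiN : i < N) (hjN : j + p ≤ N) :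
    (level D).Runs B σ (2 * multiplyCost g Dt p + 100) fun σ' =>
      Descends g N σ σ' ∧ σ' 9 0 = p + p ∧ LevelDone g N σ σ' p i j := by
  have hsq := S.square_lt
  have hcap := S.cap_lt
  have hlen := S.len_lt
  have hset : (set 18 (.op .sub (.op .add (.reg 12) (.const 1)) (.reg 9))).Runs B σ 10
      fun σ' => σ' = σ.store 18 0 (i + 1 - p) := by
    refine (runs_of_wp (Q := fun σ' => σ' = σ.store 18 0 (i + 1 - p)) hσ ?_).mono
      (by decide) fun _ h => h
    refine ⟨fits_const.2 (by omega), fits_sub.2 ⟨fits_add.2 ⟨fits_reg hσ 12, fits_const.2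
      (by omega), ?_⟩, fits_reg hσ 9⟩, ?_⟩ <;> simp only [eval, RamOp.apply, hi, hp]
    omega
  refine Runs.mono (Runs.seq (τ := 10) (τ' := 2 * multiplyCost g Dt p + 90) hσ hset
    fun σ₁ h₁ hs₁ => ?_) (by omega) fun _ h => h
  have f₁ : ∀ a, a ≠ 18 → σ₁ a = σ a := fun a ha => by rw [h₁, RamState.store_ne _ _ _ ha]
  have hT₁ : Table g N σ₁ := hT.congr (f₁ 5 (by norm_num))
  have hL₁ : Loaded g N σ₁ := hL.congr fun a ha => f₁ a (by omega)
  have h18 : σ₁ 18 0 = i + 1 - p := by rw [h₁]; simp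
  have h9 : σ₁ 9 0 = p := by rw [f₁ 9 (by norm_num), hp]
  have h12 : σ₁ 12 0 = i := by rw [f₁ 12 (by norm_num), hi]
  have h13 : σ₁ 13 0 = j := by rw [f₁ 13 (by norm_num), hj]
  have hadd : ∀ {ρ : RamState}, ρ.IsWord B → ρ 12 0 = i →
      (RamExpr.op .add (.reg 12) (.const 1)).Fits B ρ := fun {ρ} hρ h =>
    fits_add.2 ⟨fits_reg hρ 12, fits_const.2 (by omega), by simp only [eval, h]; omega⟩
  have haddv : ∀ {ρ : RamState}, ρ 12 0 = i →
      (RamExpr.op .add (.reg 12) (.const 1)).eval ρ = i + 1 := fun {ρ} h => by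
    simp only [eval, RamOp.apply, h]
  have mod2 : ∀ x, x % 2 ≠ 0 ↔ x % 2 = 1 := fun x => by omega
  have hmid : (RamProg.ite (.op .lt (.op .add (.reg 12) (.const 1)) (.reg 13))
        (.seq
          (multiplyIf D (.op .mod (.op .div (.op .add (.reg 12) (.const 1)) (.reg 9)) (.const 2))
            (.op .add (.reg 12) (.const 1)))
          (multiplyIf D (.op .mod (.op .div (.reg 13) (.reg 9)) (.const 2))
            (.op .sub (.reg 13) (.reg 9)))) .skip).Runs B σ₁
      (2 * multiplyCost g Dt p + 80) fun σ' => Descends g N σ₁ σ' ∧ LevelDone g N σ₁ σ' p i j := by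
    refine (Runs.ite (τ := (multiplyCost g Dt p + 20) + (multiplyCost g Dt p + 20)) (τ' := 1)
      ((fits_lt (by omega)).2 ⟨hadd hs₁.isWord h12, fits_reg hs₁.isWord 13⟩) (fun h => ?_)
      (fun h => ?_)).mono (by simp only [cost]; omega) fun _ h => h
    swap
    · refine (runs_of_wp hs₁.isWord ?_).mono le_rfl fun _ h => h
      refine ⟨hT₁.refl, fun h' => absurd h (eval_lt_ne_zero.2 ?_)⟩
      rwa [haddv h12, eval, eval, h13]
    rw [eval_lt_ne_zero, haddv h12, eval, eval, h13] at h
    -- Both `i + 1` and `j` are multiples of `p`, so a whole block fits between the rows and the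
    -- columns and the middle block stays inside the table.
    have hgap : i + 1 + p ≤ j := by
      have := Nat.le_of_dvd (by omega) (Nat.dvd_sub hpj hpi)
      omega
    have g₁ : (RamExpr.op .mod (.op .div (.op .add (.reg 12) (.const 1)) (.reg 9))
        (.const 2)).eval σ₁ = (i + 1) / p % 2 := by
      simp only [eval, RamOp.apply, h12, h9]
    have r₁ := runs_multiplyIf hD S hB hs₁.isWord hL₁ hT₁ (p := p) (o := i + 1 - p)
      (c := i + 1) (j := j) (e := .op .mod (.op .div (.op .add (.reg 12) (.const 1)) (.reg 9))
        (.const 2)) (f := .op .add (.reg 12) (.const 1))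
      (fits_mod.2 ⟨fits_div.2 ⟨hadd hs₁.isWord h12, fits_reg hs₁.isWord 9⟩,
        fits_const.2 (by omega)⟩) (hadd hs₁.isWord h12) (haddv h12)
      (fun _ ρ hρ hρ' => ⟨by rw [hρ 9 (by norm_num), h9], by rw [hρ 18 (by norm_num), h18], hρ',
        by rw [hρ 13 (by norm_num), h13], hp₀, hp₁, by omega, by omega, by omega⟩)
    rw [g₁] at r₁
    refine (r₁.mono (by simp only [cost]; omega) fun _ h => h).seq hs₁.isWord ?_
    rintro σ₂ ⟨hd₁, hi₁⟩ hs₂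
    have f₂ : ∀ a < 100, a ≠ 5 → a ≠ 10 → a ≠ 14 → a ≠ 16 → a ≠ 17 → σ₂ a = σ₁ a :=
      fun a _ _ _ _ _ _ => hs₂.frame a fun h => by have := writes_multiplyIf h; omega
    have k9 : σ₂ 9 0 = p := by
      rw [f₂ 9 (by norm_num) (by norm_num) (by norm_num) (by norm_num) (by norm_num)
        (by norm_num), h9]
    have k13 : σ₂ 13 0 = j := by
      rw [f₂ 13 (by norm_num) (by norm_num) (by norm_num) (by norm_num) (by norm_num)
        (by norm_num), h13]
    have k18 : σ₂ 18 0 = i + 1 - p := by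
      rw [f₂ 18 (by norm_num) (by norm_num) (by norm_num) (by norm_num) (by norm_num)
        (by norm_num), h18]
    have hT₂ := hT₁.descends hd₁
    have g₂ : (RamExpr.op .mod (.op .div (.reg 13) (.reg 9)) (.const 2)).eval σ₂ = j / p % 2 := by
      simp only [eval, RamOp.apply, k13, k9]
    have r₂ := runs_multiplyIf hD S hB hs₂.isWord (hL₁.congr fun a _ => f₂ a (by omega) (by omega)
      (by omega) (by omega) (by omega) (by omega)) hT₂ (p := p) (o := i + 1 - p)
      (c := j - p) (j := j) (e := .op .mod (.op .div (.reg 13) (.reg 9)) (.const 2))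
      (f := .op .sub (.reg 13) (.reg 9))
      (fits_mod.2 ⟨fits_div.2 ⟨fits_reg hs₂.isWord 13, fits_reg hs₂.isWord 9⟩,
        fits_const.2 (by omega)⟩) (fits_sub.2 ⟨fits_reg hs₂.isWord 13, fits_reg hs₂.isWord 9⟩)
      (by simp only [eval, RamOp.apply, k13, k9])
      (fun _ ρ hρ hρ' => ⟨by rw [hρ 9 (by norm_num), k9], by rw [hρ 18 (by norm_num), k18], hρ',
        by rw [hρ 13 (by norm_num), k13], hp₀, hp₁, by omega, by omega, by omega⟩)
    rw [g₂] at r₂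
    refine r₂.mono (by simp only [cost]; omega) ?_
    rintro σ₃ ⟨hd₂, hi₂⟩
    exact ⟨hd₁.trans hd₂, fun _ =>
      ⟨fun h₃ => (hi₁ ((mod2 _).2 h₃)).descends S.valid hd₂ (by omega) (by omega),
       fun h₃ => hd₁.included S.valid (hi₂ ((mod2 _).2 h₃)) (by omega) (by omega) (by omega)⟩⟩
  refine (Runs.seq (τ := 2 * multiplyCost g Dt p + 80) (τ' := 10) hs₁.isWord hmid ?_).mono
    (by omega) fun _ h => h
  rintro σ₂ ⟨hd, hl⟩ hs₂
  have k9 : σ₂ 9 0 = p := by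
    rw [hs₂.frame 9 fun h => ?_, h9]
    rcases h with (h | h) | h
    · have := writes_multiplyIf h; omega
    · have := writes_multiplyIf h; omega
    · exact h.elim
  refine (runs_of_wp (Q := fun σ' => σ' = σ₂.store 9 0 (p + p)) hs₂.isWord ?_).mono
    (by decide) ?_
  · refine ⟨fits_const.2 (by omega), fits_add.2 ⟨fits_reg hs₂.isWord 9, fits_reg hs₂.isWord 9, ?_⟩,
      ?_⟩ <;> simp only [eval, RamOp.apply, k9]
    omega
  · rintro σ₃ rfl
    have f5 : σ₂.store 9 0 (p + p) 5 = σ₂ 5 := RamState.store_ne _ _ _ (by norm_num)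
    refine ⟨hd.congr (f₁ 5 (by norm_num)).symm f5, by simp, ?_⟩
    unfold LevelDone Included at hl ⊢
    rwa [tab_congr f5, ← tab_congr (N := N) (f₁ 5 (by norm_num))]

/-- Perform the block products due at the current time. -/
def levels (D : RamProg) : RamProg :=
  .seq (set 9 (.const 1))
    (.loop (.op .eq (.op .add (.op .lt (.read 0 (.const 3)) (.reg 9))
      (.op .mod (.reg 8) (.op .mul (.reg 9) (.reg 9)))) (.const 0)) (level D))

theorem writes_levels {D : RamProg} {a : ℕ} (h : (levels D).Writes a) :
    a = 5 ∨ a = 9 ∨ a = 10 ∨ a = 14 ∨ a = 16 ∨ a = 17 ∨ a = 18 ∨ 100 ≤ a := by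
  rcases h with h | h
  · change a = 9 at h; omega
  · exact writes_level h

/-- The block products for squares of side `2 ^ l` are due at time `t`. -/
def Due (g : CodedInstance) (t l : ℕ) : Prop := 2 ^ l ≤ g.len ∧ 2 ^ l * 2 ^ l ∣ t

instance (g : CodedInstance) (t : ℕ) : DecidablePred (Due g t) := fun l => by
  unfold Due; infer_instance

/-- The time for the block products due at time `t`. -/
def levelsCost (g : CodedInstance) (Dt : ℕ → ℕ) (t : ℕ) : ℕ :=
  ∑ l ∈ Finset.range (Nat.log 2 g.len + 1),
    if Due g t l then 2 * multiplyCost g Dt (2 ^ l) + 200 else 0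

/-- The due levels form an initial segment, which is why a loop doubling the side may stop at the
first level that is not due. -/
theorem Due.of_le {t l l' : ℕ} (h : Due g t l) (hl : l' ≤ l) : Due g t l' :=
  ⟨(Nat.pow_le_pow_right (by norm_num) hl).trans h.1,
    (mul_dvd_mul (pow_dvd_pow 2 hl) (pow_dvd_pow 2 hl)).trans h.2⟩

/-- A split due at time `t` belongs to a cell of the square entered at `t`, by `mem_block_at`.
Writing `i`, `h`, `j` as block offset plus remainder shows which entry of which block product covers
it. -/
theorem runs_levels {D : RamProg} {c₀ : ℕ} {Dt : ℕ → ℕ} (hD : MultipliesWithin D c₀ Dt)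
    (S : Setting g B N) (hB : (2 * g.len + 3) ^ c₀ ≤ B) (hσ : σ.IsWord B) (hL : Loaded g N σ)
    (hT : Table g N σ) {L t : ℕ} (hN : N = 2 ^ L) (ht : t < N * N) (ht' : σ 8 0 = t)
    (hi : σ 12 0 = N - 1 - evenBits t) (hj : σ 13 0 = oddBits t) :
    (levels D).Runs B σ (levelsCost g Dt t + 50) fun σ' =>
      Descends g N σ σ' ∧ g.MidAt N (tab N σ) (tab N σ') t := by
  have hsq := S.square_lt
  have hcap := S.cap_lt
  have hlen := S.len_lt
  have hN0 : 0 < N := by omega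
  have hset : (set 9 (.const 1)).Runs B σ 3 fun σ' => σ' = σ.store 9 0 1 := by
    refine (runs_of_wp (Q := fun σ' => σ' = σ.store 9 0 1) hσ ?_).mono (by decide) fun _ h => h
    exact ⟨fits_const.2 (by omega), fits_const.2 (by omega), rfl⟩
  refine (Runs.seq (τ := 3) (τ' := levelsCost g Dt t + 40) hσ hset fun σ₁ h₁ hs₁ => ?_).mono
    (by omega) fun _ h => h
  have f₁ : ∀ a, a ≠ 9 → σ₁ a = σ a := fun a ha => by rw [h₁, RamState.store_ne _ _ _ ha]
  have tab₁ : tab N σ₁ = tab N σ := tab_congr (f₁ 5 (by norm_num))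
  have hT₁ : Table g N σ₁ := hT.congr (f₁ 5 (by norm_num))
  have hL₁ : Loaded g N σ₁ := hL.congr fun a ha => f₁ a (by omega)
  have hfr : ∀ {ρ}, Stable B (level D) σ₁ ρ → ∀ a < 9, a ≠ 5 → ρ a = σ₁ a := fun hs a h₁ h₂ =>
    hs.frame a fun h => by have := writes_level h; omega
  have hloop := runs_loop (c := level D) (e := .op .eq (.op .add (.op .lt (.read 0 (.const 3))
      (.reg 9)) (.op .mod (.reg 8) (.op .mul (.reg 9) (.reg 9)))) (.const 0)) hs₁.isWord
    (fun l ρ => ρ 9 0 = 2 ^ l ∧ 2 ^ l ≤ 2 * g.len + 1 ∧ Descends g N σ₁ ρ ∧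
      ∀ l' < l, LevelDone g N σ₁ ρ (2 ^ l') (N - 1 - evenBits t) (oddBits t))
    (Due g t) (Nat.log 2 g.len + 1)
    (fun h => absurd h.1 (not_le.2 (Nat.lt_pow_succ_log_self (by norm_num) _)))
    (fun l => 2 * multiplyCost g Dt (2 ^ l) + 100) ?_ ?_ ?_
  · refine hloop.mono ?_ ?_
    · unfold levelsCost
      simp only [cost]
      refine add_le_add (Finset.sum_le_sum fun l _ => ?_) (by norm_num)
      split_ifs <;> omega
    · rintro σ₂ ⟨m, hm, -, -, -, hd, hdone⟩
      refine ⟨hd.congr (f₁ 5 (by norm_num)).symm rfl, ?_⟩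
      intro r hr htag l i h j hl hih hhj hjl hs heq
      have hdue : Due g t l := ⟨hl, heq ▸ dvd_mul_right _ _⟩
      have hlm : l < m := by
        by_contra hlm
        exact hm (hdue.of_le (by omega))
      have hp0 : 0 < 2 ^ l := by positivity
      obtain ⟨b₁, b₂, b₃, b₄⟩ := block_at hN (by omega) ht hdue.2
      obtain ⟨c₁, c₂⟩ := mem_block_at hN (by omega) (show i < N by omega) heq.symm ht
      have hld := hdone l hlm
      unfold LevelDone Included at hld
      rw [tab₁] at hld
      generalize N - 1 - evenBits t + 1 = I at *
      generalize oddBits t = J at *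
      generalize 2 ^ l = p at *
      -- Now `I` and `J` are block numbers: the rows form block `I - 1`, the columns block `J`, and
      -- the middle blocks are `I` and `J - 1`. An even row block in `SplitAt` therefore corresponds
      -- to odd `I`.
      obtain ⟨I, rfl⟩ := b₁
      obtain ⟨J, rfl⟩ := b₂
      rw [Nat.mul_div_cancel_left _ hp0] at c₁ c₂ hld
      rw [Nat.mul_div_cancel_left _ hp0] at hld
      have e₁ := Nat.div_add_mod i p
      have e₂ := Nat.div_add_mod h p
      have e₃ := Nat.div_add_mod j p
      have m₁ := Nat.mod_lt i hp0
      have m₂ := Nat.mod_lt h hp0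
      have m₃ := Nat.mod_lt j hp0
      have hI : p * I - p + i % p = i := by
        rw [← c₁, mul_add]; omega
      have hJ : p * J + j % p = j := by rw [← c₂]; exact e₃
      unfold SplitAt at hs
      rcases hs with ⟨h₁, h₂, h₃⟩ | ⟨h₁, h₂, h₃⟩
      · have hlt : p * I < p * J := Nat.mul_lt_mul_of_pos_left (by omega) hp0
        have hH : p * I + h % p = h := by
          rw [← c₁, ← h₂]; exact e₂
        have := (hld hlt).1 (by omega) r hr htag _ m₁ _ m₃ _ m₂
        rwa [hI, hJ, hH] at this
      · have hlt : p * I < p * J := Nat.mul_lt_mul_of_pos_left (by omega) hp0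
        have hH : p * J - p + h % p = h := by
          rw [← c₂, ← h₂, mul_add]; omega
        have := (hld hlt).2 (by omega) r hr htag _ m₁ _ m₃ _ m₂
        rwa [hI, hJ, hH] at this
  · rintro l ρ hs ⟨h9, hle, -, -⟩
    have h8 : ρ 8 0 = t := by
      rw [hfr hs 8 (by norm_num) (by norm_num), f₁ 8 (by norm_num), ht']
    have h0 : ρ 0 3 = g.len := by rw [hfr hs 0 (by norm_num) (by norm_num), hL₁.len]
    -- The last test of the guard is made with a side that may already exceed the length, up to a
    -- factor of two, and its square must still be a machine word.
    have hpp : 2 ^ l * 2 ^ l ≤ 4 * (N * N) := by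
      calc 2 ^ l * 2 ^ l ≤ (2 * N) * (2 * N) := Nat.mul_le_mul (by omega) (by omega)
        _ = 4 * (N * N) := by ring
    have hmod : t % (2 ^ l * 2 ^ l) ≤ t := Nat.mod_le _ _
    constructor
    · refine (fits_eq (by omega)).2 ⟨fits_add.2 ⟨(fits_lt (by omega)).2 ⟨(fits_read hs.isWord 0).2
        (fits_const.2 (by omega)), fits_reg hs.isWord 9⟩, fits_mod.2 ⟨fits_reg hs.isWord 8,
        fits_mul.2 ⟨fits_reg hs.isWord 9, fits_reg hs.isWord 9, ?_⟩⟩, ?_⟩, fits_const.2 (by omega)⟩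
      · simp only [eval, h9]; omega
      · have := eval_lt_le_one (σ := ρ) (e := .read 0 (.const 3)) (f := .reg 9)
        refine lt_of_le_of_lt (Nat.add_le_add_right this _) ?_
        simp only [eval, RamOp.apply, h9, h8]
        omega
    -- The guard adds the truth value of `g.len < p` to the remainder of `t` modulo `p²`; the sum
    -- vanishes exactly if the level is due.
    · rw [eval_eq_ne_zero]
      simp only [eval, RamOp.apply, h9, h8, h0, Due, Nat.dvd_iff_mod_eq_zero]
      split_ifs with hlt <;> omega
  · rintro l ρ hs ⟨h9, hle, hd, hdone⟩ hdue
    have hf := hfr hs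
    obtain ⟨b₁, b₂, b₃, b₄⟩ := block_at hN (by have := hdue.1; omega) ht hdue.2
    have h12 : ρ 12 0 = N - 1 - evenBits t := by
      rw [hs.frame 12 fun h => by have := writes_level h; omega, f₁ 12 (by norm_num), hi]
    have h13 : ρ 13 0 = oddBits t := by
      rw [hs.frame 13 fun h => by have := writes_level h; omega, f₁ 13 (by norm_num), hj]
    refine (runs_level hD S hB hs.isWord (hL₁.congr fun a ha => hf a (by omega) (by omega))
      (hT₁.descends hd) h9 h12 h13 Nat.one_le_two_pow hdue.1 b₁ b₂ b₃ (by omega) b₄).mono le_rfl ?_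
    rintro ρ' ⟨hd', h9', hld⟩
    refine ⟨by rw [h9', pow_succ, mul_two], by rw [pow_succ]; have := hdue.1; omega,
      hd.trans hd', fun l' hl' hlt => ?_⟩
    have bb : 2 ^ l' ≤ 2 ^ l := Nat.pow_le_pow_right (by norm_num) (by omega)
    rcases Nat.lt_succ_iff_lt_or_eq.1 hl' with hlt' | rfl
    · obtain ⟨d₁, d₂⟩ := hdone l' hlt' hlt
      exact ⟨fun h => (d₁ h).descends S.valid hd' (by omega) (by omega),
        fun h => (d₂ h).descends S.valid hd' (by omega) (by omega)⟩
    · have hgap := Nat.le_of_dvd (by omega) (Nat.dvd_sub b₂ b₁)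
      obtain ⟨d₁, d₂⟩ := hld hlt
      exact ⟨fun h => hd.included S.valid (d₁ h) (by omega) (by omega) (by omega),
        fun h => hd.included S.valid (d₂ h) (by omega) (by omega) (by omega)⟩
  · exact ⟨by rw [h₁]; simp, by simp, hT₁.refl, fun l' h => absurd h (Nat.not_lt_zero _)⟩

end EditDP

/-! ### The main loop, the initialisation and the whole program -/

namespace EditDP

open RamExpr RamProg

variable {g : CodedInstance} {B N : ℕ} {σ σ' : RamState}

/-- Process the cell belonging to the current time. -/
def step (D : RamProg) : RamProg :=
  .seq (set 12 (.op .sub (.op .sub (.reg 4) (.const 1)) (.read 6 (.reg 8))))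
    (.seq (set 13 (.read 7 (.reg 8))) (.seq (levels D) closeCell))

theorem writes_step {D : RamProg} {a : ℕ} (h : (step D).Writes a) :
    a = 5 ∨ (9 ≤ a ∧ a ≤ 18) ∨ 100 ≤ a := by
  rcases h with h | h | h | h
  · change a = 12 at h; omega
  · change a = 13 at h; omega
  · have := writes_levels h; omega
  · have := writes_closeCell h; omega

/-- The coordinates of the cells in the order of evaluation are in memory. -/
def Ordered (N : ℕ) (σ : RamState) : Prop :=
  ∀ w < N * N, σ 6 w = evenBits w ∧ σ 7 w = oddBits w

/-- Block products come first, for they supply the proper splits that `closeCell` presupposes; the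
invariant then advances by `Progress.succ`. -/
theorem runs_step {D : RamProg} {c₀ : ℕ} {Dt : ℕ → ℕ} (hD : MultipliesWithin D c₀ Dt)
    (S : Setting g B N) (hB : (2 * g.len + 3) ^ c₀ ≤ B) (hσ : σ.IsWord B) (hL : Loaded g N σ)
    (hT : Table g N σ) (hO : Ordered N σ) {L t : ℕ} (hN : N = 2 ^ L) (ht : t < N * N)
    (ht' : σ 8 0 = t) (hP : g.Progress N (tab N σ) t) :
    (step D).Runs B σ (levelsCost g Dt t + 700 * ((g.nts + 1) * (g.rules + 1)) + 100) fun σ' =>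
      Descends g N σ σ' ∧ g.Progress N (tab N σ') (t + 1) := by
  have hsq := S.square_lt
  have hlen := S.len_lt
  obtain ⟨hi, hj, htime⟩ := cellTime_bits hN ht
  have hset₁ : (set 12 (.op .sub (.op .sub (.reg 4) (.const 1)) (.read 6 (.reg 8)))).Runs B σ 15
      fun σ' => σ' = σ.store 12 0 (N - 1 - evenBits t) := by
    refine (runs_of_wp (Q := fun σ' => σ' = σ.store 12 0 (N - 1 - evenBits t)) hσ ?_).mono
      (by decide) fun _ h => h
    refine ⟨fits_const.2 (by omega), fits_sub.2 ⟨fits_sub.2 ⟨fits_reg hσ 4, fits_const.2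
      (by omega)⟩, (fits_read hσ 6).2 (fits_reg hσ 8)⟩, ?_⟩
    simp only [eval, RamOp.apply, ht', hL.stride, (hO t ht).1]
  refine (hset₁.seq (τ' := levelsCost g Dt t + 700 * ((g.nts + 1) * (g.rules + 1)) + 80) hσ
    fun σ₁ h₁ hs₁ => ?_).mono (by omega) fun _ h => h
  have f₁ : ∀ a, a ≠ 12 → σ₁ a = σ a := fun a ha => by rw [h₁, RamState.store_ne _ _ _ ha]
  have hset₂ : (set 13 (.read 7 (.reg 8))).Runs B σ₁ 15
      fun σ' => σ' = σ₁.store 13 0 (oddBits t) := by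
    refine (runs_of_wp (Q := fun σ' => σ' = σ₁.store 13 0 (oddBits t)) hs₁.isWord ?_).mono
      (by decide) fun _ h => h
    refine ⟨fits_const.2 (by omega), (fits_read hs₁.isWord 7).2 (fits_reg hs₁.isWord 8), ?_⟩
    simp only [eval, f₁ 8 (by norm_num), f₁ 7 (by norm_num), ht', (hO t ht).2]
  refine (hset₂.seq (τ' := levelsCost g Dt t + 700 * ((g.nts + 1) * (g.rules + 1)) + 60)
    hs₁.isWord fun σ₂ h₂ hs₂ => ?_).mono (by omega) fun _ h => h
  have f₂ : ∀ a, a ≠ 12 → a ≠ 13 → σ₂ a = σ a := fun a ha ha' => by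
    rw [h₂, RamState.store_ne _ _ _ ha', f₁ a ha]
  have h12 : σ₂ 12 0 = N - 1 - evenBits t := by
    rw [h₂, RamState.store_ne _ _ _ (by norm_num), h₁]; simp
  have h13 : σ₂ 13 0 = oddBits t := by rw [h₂]; simp
  have hL₂ : Loaded g N σ₂ := hL.congr fun a ha => f₂ a (by omega) (by omega)
  have f5 : σ₂ 5 = σ 5 := f₂ 5 (by norm_num) (by norm_num)
  have hT₂ : Table g N σ₂ := hT.congr f5
  refine ((runs_levels hD S hB hs₂.isWord hL₂ hT₂ hN ht (by
    rw [f₂ 8 (by norm_num) (by norm_num), ht']) h12 h13).seq (τ' := 700 * ((g.nts + 1) *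
      (g.rules + 1))) hs₂.isWord fun σ₃ h₃ hs₃ => ?_).mono (by omega) fun _ h => h
  obtain ⟨hd, hmid⟩ := h₃
  have f₃ : ∀ a < 100, a ≠ 5 → a ≠ 9 → a ≠ 10 → a ≠ 14 → a ≠ 16 → a ≠ 17 → a ≠ 18 →
      σ₃ a = σ₂ a := fun a _ _ _ _ _ _ _ _ => hs₃.frame a fun h => by
    have := writes_levels h; omega
  have hT₃ := hT₂.descends hd
  refine (runs_closeCell S hs₃.isWord (hL₂.congr fun a ha => f₃ a (by omega) (by omega) (by omega)
    (by omega) (by omega) (by omega) (by omega) (by omega)) hT₃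
    (i := N - 1 - evenBits t) (j := oddBits t)
    (by rw [f₃ 12 (by norm_num) (by norm_num) (by norm_num) (by norm_num) (by norm_num)
      (by norm_num) (by norm_num) (by norm_num), h12]) hi
    (by rw [f₃ 13 (by norm_num) (by norm_num) (by norm_num) (by norm_num) (by norm_num)
      (by norm_num) (by norm_num) (by norm_num), h13]) hj).mono le_rfl ?_
  rintro σ₄ ⟨hd', hclose⟩
  refine ⟨(hd.trans hd').congr f5.symm rfl, ?_⟩
  rw [← tab_congr (N := N) f5] at hP
  exact hP.succ S.valid hN hlen (fun A hA i hi j hj => hd A hA i hi j hj) hmid hi htime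
    (fun A hA => hT₃.le_cap A hA _ hi _ hj) (fun A hA i hi j hj => hd' A hA i hi j hj) hclose

/-- Process all cells. -/
def steps (D : RamProg) : RamProg := forLoop 8 (.op .mul (.reg 4) (.reg 4)) (step D)

theorem writes_steps {D : RamProg} {a : ℕ} (h : (steps D).Writes a) :
    a = 5 ∨ (8 ≤ a ∧ a ≤ 18) ∨ 100 ≤ a := by
  rcases writes_forLoop.1 h with h | h
  · omega
  · have := writes_step h; omega

open Finset in
theorem runs_steps {D : RamProg} {c₀ : ℕ} {Dt : ℕ → ℕ} (hD : MultipliesWithin D c₀ Dt)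
    (S : Setting g B N) (hB : (2 * g.len + 3) ^ c₀ ≤ B) (hσ : σ.IsWord B) (hL : Loaded g N σ)
    (hT : Table g N σ) (hO : Ordered N σ) {L : ℕ} (hN : N = 2 ^ L) :
    (steps D).Runs B σ ((∑ t ∈ range (N * N), levelsCost g Dt t) +
      N * N * (700 * ((g.nts + 1) * (g.rules + 1)) + 200) + 50) fun σ' =>
      ∀ A < g.nts, tab N σ' A 0 g.len = g.value A 0 g.len := by
  have hsq := S.square_lt
  have hlen := S.len_lt
  have hframe : ∀ {σ'}, Stable B (steps D) σ σ' → ∀ a < 8, a ≠ 5 → σ' a = σ a :=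
    fun hs a _ _ => hs.frame a fun h => by have := writes_steps h; omega
  refine (runs_forLoop hσ (n := N * N) (by omega) (fun h => by have := writes_step h; omega)
    (fun t σ' => Descends g N σ σ' ∧ g.Progress N (tab N σ') t)
    (fun t => levelsCost g Dt t + 700 * ((g.nts + 1) * (g.rules + 1)) + 100)
    ?_ ?_ ?_ ?_).mono ?_ ?_
  · intro σ' hs
    have h4 : σ' 4 0 = N := by rw [hframe hs 4 (by norm_num) (by norm_num), hL.stride]
    refine ⟨fits_mul.2 ⟨fits_reg hs.isWord 4, fits_reg hs.isWord 4, ?_⟩, ?_⟩ <;>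
      simp only [eval, RamOp.apply, h4]
    omega
  · rintro t σ' v ⟨h₁, h₂⟩
    have h5 : σ'.store 8 0 v 5 = σ' 5 := RamState.store_ne _ _ _ (by norm_num)
    exact ⟨h₁.congr rfl h5, by rwa [tab_congr h5]⟩
  · exact ⟨hT.refl, CodedInstance.progress_zero _ _ _⟩
  · rintro t σ' hs ht ht' ⟨h₁, h₂⟩
    have hf := hframe hs
    refine (runs_step hD S hB hs.isWord (hL.congr fun a ha => hf a (by omega) (by omega))
      (hT.descends h₁) (fun w hw => by
        rw [hf 6 (by norm_num) (by norm_num), hf 7 (by norm_num) (by norm_num)]; exact hO w hw)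
      hN ht ht' h₂).mono le_rfl ?_
    rintro σ'' ⟨hd, hp⟩
    exact ⟨h₁.trans hd, hp⟩
  · have hc : (RamExpr.op .mul (.reg 4) (.reg 4)).cost = 5 := rfl
    generalize hw : 700 * ((g.nts + 1) * (g.rules + 1)) = w
    rw [hc, Finset.sum_congr rfl fun t _ => show levelsCost g Dt t + w + 100 + (5 + 20) =
      levelsCost g Dt t + (w + 125) by ring, Finset.sum_add_distrib, Finset.sum_const,
      Finset.card_range, smul_eq_mul, mul_add, mul_add]
    omega
  · rintro σ' ⟨-, hp⟩ A hA
    -- The requested cell has been visited, since every cell of the table has a time below `N * N`.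
    refine hp.done A hA 0 (by omega) _ le_rfl ?_
    rw [hN]
    exact interleave_lt L _ _ (by omega) (by omega)

/-- Compute the stride of the table, a power of two above the length of the string. -/
def makeStride : RamProg :=
  .seq (set 4 (.const 1))
    (.loop (.op .eq (.op .lt (.read 0 (.const 3)) (.reg 4)) (.const 0))
      (set 4 (.op .add (.reg 4) (.reg 4))))

theorem writes_makeStride {a : ℕ} (h : makeStride.Writes a) : a = 4 := by
  rcases h with h | h <;> exact h

/-- Doubling stops at a power of two that is at most twice the length, or `1` for the empty string.
The linear time bound is crude but sufficient; it uses `n < 2 ^ n`. -/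
theorem runs_makeStride (hσ : σ.IsWord B) {n : ℕ} (hn : σ 0 3 = n) (hB : 2 * n + 10 < B) :
    makeStride.Runs B σ (30 * (n + 1)) fun σ' => ∃ L, σ' 4 0 = 2 ^ L ∧ n < 2 ^ L ∧
      2 ^ L ≤ 2 * max n 1 := by
  have hset : (set 4 (.const 1)).Runs B σ 3 fun σ' => σ' = σ.store 4 0 1 := by
    refine (runs_of_wp (Q := fun σ' => σ' = σ.store 4 0 1) hσ ?_).mono (by decide) fun _ h => h
    exact ⟨fits_const.2 (by omega), fits_const.2 (by omega), rfl⟩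
  refine (hset.seq (τ' := 30 * n + 20) hσ fun σ₁ h₁ hs₁ => ?_).mono (by omega) fun _ h => h
  have hloop := runs_loop (c := set 4 (.op .add (.reg 4) (.reg 4)))
    (e := .op .eq (.op .lt (.read 0 (.const 3)) (.reg 4)) (.const 0)) hs₁.isWord
    (fun l ρ => ρ 4 0 = 2 ^ l ∧ 2 ^ l ≤ 2 * max n 1) (fun l => 2 ^ l ≤ n) n
    (not_le.2 Nat.lt_two_pow_self) (fun _ => 10) ?_ ?_ ?_
  · refine hloop.mono ?_ ?_
    · simp only [cost]
      refine (Nat.add_le_add_right (Finset.sum_le_sum (g := fun _ => 30) fun l _ => ?_) _).trans ?_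
      · split_ifs <;> norm_num
      · simp; omega
    · rintro σ₂ ⟨m, hm, -, h₂, h₃⟩
      exact ⟨m, h₂, not_le.1 hm, h₃⟩
  · rintro l ρ hs ⟨h₂, -⟩
    have h0 : ρ 0 3 = n := by
      rw [hs.frame 0 (by simp), h₁, RamState.store_ne _ _ _ (by norm_num), hn]
    refine ⟨(fits_eq (by omega)).2 ⟨(fits_lt (by omega)).2 ⟨(fits_read hs.isWord 0).2
      (fits_const.2 (by omega)), fits_reg hs.isWord 4⟩, fits_const.2 (by omega)⟩, ?_⟩
    rw [eval_eq_ne_zero]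
    simp only [eval, RamOp.apply, h0, h₂]
    rw [ite_eq_right_iff]
    simp
  · rintro l ρ hs ⟨h₂, h₃⟩ hl
    refine (runs_of_wp (Q := fun σ' => σ' = ρ.store 4 0 (2 ^ (l + 1))) hs.isWord ?_).mono
      (by decide) ?_
    · refine ⟨fits_const.2 (by omega), fits_add.2 ⟨fits_reg hs.isWord 4, fits_reg hs.isWord 4, ?_⟩,
        ?_⟩ <;> simp only [eval, RamOp.apply, h₂]
      · omega
      · rw [pow_succ, mul_two]
    · rintro ρ' rfl
      exact ⟨by simp, by rw [pow_succ]; omega⟩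
  · exact ⟨by rw [h₁]; simp, by simp; omega⟩

/-- Fill the table with the cap. -/
def fillTable : RamProg :=
  forLoop 17 (.op .mul (.op .mul (.read 0 (.const 0)) (.reg 4)) (.reg 4))
    (.assign 5 (.reg 17) (.op .add (.read 0 (.const 3)) (.const 1)))

theorem writes_fillTable {a : ℕ} (h : fillTable.Writes a) : a = 5 ∨ a = 17 := by
  rcases writes_forLoop.1 h with h | h
  · omega
  · change a = 5 at h; omega

theorem runs_fillTable (S : Setting g B N) (hσ : σ.IsWord B) (hL : Loaded g N σ) :
    fillTable.Runs B σ (g.nts * N * N * 60 + 50) fun σ' => Table g N σ' := by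
  have hcap := S.cap_lt
  have htab := S.table_lt
  have hN : 0 < N := by have := S.len_lt; omega
  refine (runs_forLoop_const hσ (n := g.nts * N * N) (by omega) (by simp)
    (fun m σ' => ∀ w < m, σ' 5 w = g.len + 1) 20 ?_ ?_ ?_ ?_).mono ?_ ?_
  · intro σ' hs
    have h0 : σ' 0 = σ 0 := hs.frame 0 fun h => by have := writes_fillTable h; omega
    have h4 : σ' 4 = σ 4 := hs.frame 4 fun h => by have := writes_fillTable h; omega
    refine ⟨fits_mul.2 ⟨fits_mul.2 ⟨(fits_read hs.isWord 0).2 (fits_const.2 (by omega)),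
      fits_reg hs.isWord 4, ?_⟩, fits_reg hs.isWord 4, ?_⟩, ?_⟩ <;>
      simp only [eval, RamOp.apply, h0, h4, hL.nts, hL.stride]
    · exact lt_of_le_of_lt (Nat.le_mul_of_pos_right _ hN) htab
    · exact htab
  · intro m σ' v h w hw
    rw [RamState.store_ne _ _ _ (by norm_num)]
    exact h w hw
  · exact fun w hw => absurd hw (Nat.not_lt_zero w)
  · intro m σ' hs hm hm' hI
    have h0 : σ' 0 = σ 0 := hs.frame 0 fun h => by have := writes_fillTable h; omega
    refine (runs_of_wp (Q := fun ρ => ρ = σ'.store 5 m (g.len + 1)) hs.isWord ?_).mono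
      (by decide) ?_
    · refine ⟨fits_reg hs.isWord 17, fits_add.2 ⟨(fits_read hs.isWord 0).2 (fits_const.2
        (by omega)), fits_const.2 (by omega), ?_⟩, ?_⟩ <;>
        simp only [eval, RamOp.apply, h0, hL.len, hm']
      omega
    · rintro ρ rfl w hw
      rw [RamState.store_apply]
      split_ifs with h
      · rfl
      · exact hI w (by omega)
  · simp only [cost]
    omega
  · intro σ' h
    have key : ∀ A < g.nts, ∀ i < N, ∀ j < N, tab N σ' A i j = g.len + 1 := by
      intro A hA i hi j hj
      refine h _ ?_
      have h₁ : (A + 1) * N ≤ g.nts * N := Nat.mul_le_mul_right _ hA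
      have h₂ : (A * N + i + 1) * N ≤ g.nts * N * N :=
        Nat.mul_le_mul_right _ (by rw [add_mul] at h₁; omega)
      rw [add_mul (A * N + i)] at h₂
      omega
    exact ⟨fun A hA i hi j hj => (CodedInstance.value_le_cap _ _ _).trans (key A hA i hi j hj).ge,
      fun A hA i hi j hj => (key A hA i hi j hj).le⟩

/-- Tabulate the coordinates of the cells in the order of evaluation. -/
def makeOrder : RamProg :=
  .seq (set 6 (.const 0)) (.seq (set 7 (.const 0))
    (forLoop 17 (.op .mul (.reg 4) (.reg 4))
      (.seq
        (.assign 6 (.reg 17) (.op .add (.op .mul (.const 2) (.read 6 (.op .div (.reg 17) (.const 4))))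
          (.op .mod (.reg 17) (.const 2))))
        (.assign 7 (.reg 17) (.op .add (.op .mul (.const 2) (.read 7 (.op .div (.reg 17) (.const 4))))
          (.op .div (.op .mod (.reg 17) (.const 4)) (.const 2)))))))

theorem writes_makeOrder {a : ℕ} (h : makeOrder.Writes a) : a = 6 ∨ a = 7 ∨ a = 17 := by
  rcases h with h | h | h
  · change a = 6 at h; omega
  · change a = 7 at h; omega
  · rcases writes_forLoop.1 h with h | h | h
    · omega
    · change a = 6 at h; omega
    · change a = 7 at h; omega

/-- The digits of `m` are obtained from the stored digits of `m / 4` in constant time, so the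
machine needs no bit operations. -/
theorem runs_makeOrder (hσ : σ.IsWord B) (h4 : σ 4 0 = N) (hB : N * N + 10 < B) :
    makeOrder.Runs B σ (N * N * 100 + 100) fun σ' => Ordered N σ' := by
  have hset₁ : (set 6 (.const 0)).Runs B σ 3 fun σ' => σ' = σ.store 6 0 0 := by
    refine (runs_of_wp (Q := fun σ' => σ' = σ.store 6 0 0) hσ ?_).mono (by decide) fun _ h => h
    exact ⟨fits_const.2 (by omega), fits_const.2 (by omega), rfl⟩
  refine (hset₁.seq (τ' := N * N * 100 + 80) hσ fun σ₁ h₁ hs₁ => ?_).mono (by omega) fun _ h => h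
  have hset₂ : (set 7 (.const 0)).Runs B σ₁ 3 fun σ' => σ' = σ₁.store 7 0 0 := by
    refine (runs_of_wp (Q := fun σ' => σ' = σ₁.store 7 0 0) hs₁.isWord ?_).mono (by decide)
      fun _ h => h
    exact ⟨fits_const.2 (by omega), fits_const.2 (by omega), rfl⟩
  refine (hset₂.seq (τ' := N * N * 100 + 50) hs₁.isWord fun σ₂ h₂ hs₂ => ?_).mono (by omega)
    fun _ h => h
  have k4 : σ₂ 4 0 = N := by
    rw [h₂, RamState.store_ne _ _ _ (by norm_num), h₁, RamState.store_ne _ _ _ (by norm_num), h4]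
  refine (runs_forLoop_const hs₂.isWord (n := N * N) (by omega) (by simp)
    (fun m σ' => (σ' 6 0 = 0 ∧ σ' 7 0 = 0) ∧
      ∀ w < m, σ' 6 w = evenBits w ∧ σ' 7 w = oddBits w) 50 ?_ ?_ ?_ ?_).mono ?_
    fun _ h => h.2
  · intro σ' hs
    have h4' : σ' 4 = σ₂ 4 := hs.frame 4 (by simp)
    refine ⟨fits_mul.2 ⟨fits_reg hs.isWord 4, fits_reg hs.isWord 4, ?_⟩, ?_⟩ <;>
      simp only [eval, RamOp.apply, h4', k4]
    omega
  · intro m σ' v h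
    rw [RamState.store_ne _ _ _ (by norm_num), RamState.store_ne _ _ _ (by norm_num)]
    exact h
  · refine ⟨⟨?_, ?_⟩, fun w hw => absurd hw (Nat.not_lt_zero w)⟩
    · rw [h₂, RamState.store_ne _ _ _ (by norm_num), h₁]; simp
    · rw [h₂]; simp
  · rintro m σ' hs hm hm' ⟨⟨h₃, h₄⟩, hI⟩
    -- For `m = 0` the recursion reads the very cell it is about to write, and memory is arbitrary;
    -- this is why cell `0` of both arrays is cleared in advance.
    have hprev : σ' 6 (m / 4) = evenBits (m / 4) ∧ σ' 7 (m / 4) = oddBits (m / 4) := by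
      rcases Nat.eq_zero_or_pos m with rfl | hpos
      · simp [h₃, h₄, evenBits, oddBits]
      · exact hI _ (by omega)
    have he := evenBits_eq m
    have ho := oddBits_eq m
    have he' := evenBits_le m
    have ho' := oddBits_le m
    refine (runs_of_wp (Q := fun ρ => ρ = (σ'.store 6 m (evenBits m)).store 7 m (oddBits m))
      hs.isWord ?_).mono (by decide) ?_
    · have e₀ : (RamExpr.op .add (.op .mul (.const 2) (.read 6 (.op .div (.reg 17) (.const 4))))
          (.op .mod (.reg 17) (.const 2))).eval σ' = evenBits m := by
        simp only [eval, RamOp.apply, hm', hprev.1, he]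
      refine ⟨fits_reg hs.isWord 17, fits_add.2 ⟨fits_mul.2 ⟨fits_const.2 (by omega),
        (fits_read hs.isWord 6).2 (fits_div.2 ⟨fits_reg hs.isWord 17, fits_const.2 (by omega)⟩),
        ?_⟩, fits_mod.2 ⟨fits_reg hs.isWord 17, fits_const.2 (by omega)⟩, ?_⟩, ?_⟩
      · simp only [eval, RamOp.apply, hm', hprev.1]; omega
      · simp only [eval, RamOp.apply, hm', hprev.1]; omega
      · rw [e₀]
        simp only [eval, hm']
        intro hw
        have f7 : σ'.store 6 m (evenBits m) 7 = σ' 7 := RamState.store_ne _ _ _ (by norm_num)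
        have f17 : σ'.store 6 m (evenBits m) 17 = σ' 17 := RamState.store_ne _ _ _ (by norm_num)
        refine ⟨fits_reg hw 17, fits_add.2 ⟨fits_mul.2 ⟨fits_const.2 (by omega),
          (fits_read hw 7).2 (fits_div.2 ⟨fits_reg hw 17, fits_const.2 (by omega)⟩),
          ?_⟩, fits_div.2 ⟨fits_mod.2 ⟨fits_reg hw 17, fits_const.2 (by omega)⟩,
          fits_const.2 (by omega)⟩, ?_⟩, ?_⟩ <;>
          simp only [eval, RamOp.apply, f7, f17, hm', hprev.2]
        · omega
        · omega
        · rw [← ho]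
    · rintro ρ rfl
      constructor
      · simp only [RamState.store_apply]
        constructor
        · rw [if_neg (by omega)]
          split_ifs with h
          · rw [← h.2, evenBits, if_pos rfl]
          · exact h₃
        · rw [if_neg (by omega) (c := (7 = 6 ∧ 0 = m))]
          split_ifs with h
          · rw [← h.2, oddBits, if_pos rfl]
          · exact h₄
      · intro w hw
        rcases Nat.lt_succ_iff_lt_or_eq.1 hw with hlt | rfl
        · have := hI w hlt
          simp only [RamState.store_apply]
          rw [if_neg (by omega), if_neg (by omega), if_neg (by omega), if_neg (by omega)]
          exact this
        · simp
  · simp only [cost]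
    omega

/-- Compute the language edit distance, `D` being a program for distance products. -/
def program (D : RamProg) : RamProg :=
  .seq makeStride (.seq fillTable (.seq makeOrder (.seq (steps D)
    (.assign 3 (.const 0) (tabE (.read 0 (.const 1)) (.const 0) (.read 0 (.const 3)))))))

/-- The running time of the program for the stride `N`. -/
def programCost (g : CodedInstance) (Dt : ℕ → ℕ) (N : ℕ) : ℕ :=
  30 * (g.len + 1) + (g.nts * N * N * 60 + 50) + (N * N * 100 + 100) +
    ((∑ t ∈ Finset.range (N * N), levelsCost g Dt t) +
      N * N * (700 * ((g.nts + 1) * (g.rules + 1)) + 200) + 50) + 20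

/-- The stride is known only at run time; monotonicity replaces it by its upper bound. -/
theorem programCost_mono (g : CodedInstance) (Dt : ℕ → ℕ) {N N' : ℕ} (h : N ≤ N') :
    programCost g Dt N ≤ programCost g Dt N' := by
  unfold programCost
  gcongr

theorem runs_program {D : RamProg} {c₀ : ℕ} {Dt : ℕ → ℕ} (hD : MultipliesWithin D c₀ Dt)
    (S : ∀ N, g.len < N → N ≤ 2 * max g.len 1 → Setting g B N)
    (hB : (2 * g.len + 3) ^ c₀ ≤ B) (hB' : 2 * g.len + 10 < B) (hσ : σ.IsWord B)
    (hL : ∀ ρ : RamState, (∀ a < 4, ρ a = σ a) → Loaded g (ρ 4 0) ρ)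
    {A : ℕ} (hA : σ 0 1 = A) (hA' : A < g.nts) :
    (program D).Runs B σ (programCost g Dt (2 * max g.len 1)) fun σ' =>
      σ' 3 0 = g.value A 0 g.len := by
  refine (Runs.seq (τ := 30 * (g.len + 1)) (τ' := programCost g Dt (2 * max g.len 1) -
    30 * (g.len + 1)) hσ (runs_makeStride hσ (hL σ fun _ _ => rfl).len hB')
    fun σ₁ h₁ hs₁ => ?_).mono (by unfold programCost; omega) fun _ h => h
  obtain ⟨L, h4, hlt, hle⟩ := h₁
  have hmono := programCost_mono g Dt hle
  generalize hN : 2 ^ L = N at h4 hlt hle hmono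
  have hS := S N hlt hle
  have f₁ : ∀ a < 4, σ₁ a = σ a := fun a ha => hs₁.frame a fun h => by
    have := writes_makeStride h; omega
  have hL₁ : Loaded g N σ₁ := by
    have := hL σ₁ f₁
    rwa [h4] at this
  have hsq := hS.square_lt
  refine Runs.mono (τ := (g.nts * N * N * 60 + 50) + ((N * N * 100 + 100) +
    (((∑ t ∈ Finset.range (N * N), levelsCost g Dt t) +
      N * N * (700 * ((g.nts + 1) * (g.rules + 1)) + 200) + 50) + 20))) ?_
    (by unfold programCost at hmono ⊢; omega) fun _ h => h
  refine (runs_fillTable hS hs₁.isWord hL₁).seq hs₁.isWord fun σ₂ hT₂ hs₂ => ?_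
  have f₂ : ∀ a < 5, σ₂ a = σ₁ a := fun a ha => hs₂.frame a fun h => by
    have := writes_fillTable h; omega
  have hL₂ : Loaded g N σ₂ := hL₁.congr fun a ha => f₂ a (by omega)
  refine (runs_makeOrder hs₂.isWord hL₂.stride (by omega)).seq hs₂.isWord fun σ₃ hO₃ hs₃ => ?_
  have f₃ : ∀ a < 6, σ₃ a = σ₂ a := fun a ha => hs₃.frame a fun h => by
    have := writes_makeOrder h; omega
  have hL₃ : Loaded g N σ₃ := hL₂.congr fun a ha => f₃ a (by omega)
  refine (runs_steps hD hS hB hs₃.isWord hL₃ (hT₂.congr (f₃ 5 (by norm_num))) hO₃ hN.symm).seq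
    hs₃.isWord fun σ₄ hv hs₄ => ?_
  have f₄ : ∀ a < 5, σ₄ a = σ₃ a := fun a ha => hs₄.frame a fun h => by
    have := writes_steps h; omega
  have hL₄ : Loaded g N σ₄ := hL₃.congr fun a ha => f₄ a (by omega)
  have h01 : σ₄ 0 1 = A := by
    rw [f₄ 0 (by norm_num), f₃ 0 (by norm_num), f₂ 0 (by norm_num), f₁ 0 (by norm_num), hA]
  have fr : ∀ d < B, (RamExpr.read 0 (.const d)).Fits B σ₄ := fun d hd =>
    (fits_read hs₄.isWord 0).2 (fits_const.2 hd)
  obtain ⟨t₁, t₂⟩ := tabE_spec hS hs₄.isWord hL₄ (a := .read 0 (.const 1)) (i := .const 0)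
    (j := .read 0 (.const 3)) (fr 1 (by omega)) (fits_const.2 (by omega)) (fr 3 (by omega))
    (by simpa only [eval, h01] using hA') (by simp only [eval]; omega)
    (by simpa only [eval, hL₄.len] using hlt)
  refine (runs_of_wp (Q := fun σ' => σ' 3 0 = g.value A 0 g.len) hs₄.isWord ?_).mono (by decide)
    fun _ h => h
  refine ⟨fits_const.2 (by omega), t₁, ?_⟩
  rw [t₂]
  simp only [eval, h01, hL₄.len, RamState.store_same, Function.update_self]
  exact hv A hA'

end EditDP

/-! ### The running time -/

section Growth

open Finset

/-- The total cost, per production, of the distance products of all sides `2 ^ l ≤ n`. -/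
noncomputable def productWeight (T : ℕ → ℝ) (n : ℕ) : ℝ :=
  ∑ l ∈ range (Nat.log 2 n + 1), (n : ℝ) ^ 2 / 4 ^ l * T (2 ^ l)

variable {T : ℕ → ℝ} {γ : ℝ}

theorem productWeight_nonneg (hT : ∀ n, 1 ≤ n → 0 < T n) (n : ℕ) :
    0 ≤ productWeight T n :=
  sum_nonneg fun _ _ => mul_nonneg (by positivity) (hT _ Nat.one_le_two_pow).le

/-- Growth compared with `m = 1` gives `n ^ γ = O(T n)`, and `γ ≥ 2`. -/
theorem GrowsAtLeastLike.exists_sq_le (h : GrowsAtLeastLike γ T) (hγ : 2 ≤ γ)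
    (hpos : ∀ n, 1 ≤ n → 0 < T n) : ∃ a : ℝ, 0 ≤ a ∧ ∀ n : ℕ, 1 ≤ n → (n : ℝ) ^ 2 ≤ a * T n := by
  obtain ⟨C, hC⟩ := h
  have h1 := hpos 1 le_rfl
  have key : ∀ n : ℕ, 1 ≤ n → (n : ℝ) ^ 2 ≤ C / T 1 * T n := by
    intro n hn
    have h₁ := hC 1 n le_rfl hn
    simp only [Nat.cast_one, Real.one_rpow, mul_one] at h₁
    have h₂ : (n : ℝ) ^ 2 ≤ (n : ℝ) ^ γ := by
      rw [← Real.rpow_two]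
      exact Real.rpow_le_rpow_of_exponent_le (by exact_mod_cast hn) hγ
    rw [div_mul_eq_mul_div, le_div_iff₀ h1]
    nlinarith
  refine ⟨C / T 1, ?_, key⟩
  have := key 1 le_rfl
  rw [div_mul_cancel₀ _ h1.ne'] at this
  exact div_nonneg (by norm_num at this; linarith) h1.le

/-- Growth with `m = 2 ^ l` bounds `T (2 ^ l)` by `C * T n * (2 ^ l / n) ^ γ`, and the number of
squares contributes the exponent `-2`. -/
theorem GrowsAtLeastLike.exists_productWeight_le_sum (h : GrowsAtLeastLike γ T)
    (hpos : ∀ n, 1 ≤ n → 0 < T n) :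
    ∃ C : ℝ, 0 ≤ C ∧ ∀ n : ℕ, 1 ≤ n → productWeight T n ≤
      C * T n * ∑ l ∈ range (Nat.log 2 n + 1), ((2 : ℝ) ^ l / n) ^ (γ - 2) := by
  obtain ⟨C, hC⟩ := h
  refine ⟨C, ?_, fun n hn => ?_⟩
  · have := hC 1 1 le_rfl le_rfl
    have h1 := hpos 1 le_rfl
    simp only [Nat.cast_one, Real.one_rpow, mul_one] at this
    nlinarith
  · rw [mul_sum]
    refine sum_le_sum fun l hl => ?_
    have hl' : 2 ^ l ≤ n :=
      Nat.pow_le_of_le_log (by omega) (by have := mem_range.1 hl; omega)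
    have hn0 : (0 : ℝ) < n := by exact_mod_cast hn
    have hp0 : (0 : ℝ) < 2 ^ l := by positivity
    have key := hC (2 ^ l) n Nat.one_le_two_pow hl'
    push_cast at key
    rw [Real.div_rpow hp0.le hn0.le, Real.rpow_sub hp0, Real.rpow_sub hn0, Real.rpow_two,
      Real.rpow_two]
    have h4 : (4 : ℝ) ^ l = (2 ^ l) ^ 2 := by rw [← pow_mul, mul_comm, pow_mul]; norm_num
    rw [h4]
    have hnγ : (0 : ℝ) < (n : ℝ) ^ γ := Real.rpow_pos_of_pos hn0 _
    calc (n : ℝ) ^ 2 / (2 ^ l) ^ 2 * T (2 ^ l)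
        = (n : ℝ) ^ 2 / ((2 ^ l) ^ 2 * (n : ℝ) ^ γ) * (T (2 ^ l) * (n : ℝ) ^ γ) := by
          field_simp
      _ ≤ (n : ℝ) ^ 2 / ((2 ^ l) ^ 2 * (n : ℝ) ^ γ) * (C * (T n * ((2 : ℝ) ^ l) ^ γ)) := by
          gcongr
      _ = _ := by field_simp

/-- The sum is geometric with ratio `2 ^ (γ - 2) > 1`, and its last term is at most one because `2 ^
Nat.log 2 n ≤ n`. -/
theorem GrowsAtLeastLike.exists_productWeight_le (h : GrowsAtLeastLike γ T) (hγ : 2 < γ)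
    (hpos : ∀ n, 1 ≤ n → 0 < T n) :
    ∃ E : ℝ, ∀ n : ℕ, 1 ≤ n → productWeight T n ≤ E * T n := by
  obtain ⟨C, hC0, hC⟩ := h.exists_productWeight_le_sum hpos
  set r : ℝ := 2 ^ (γ - 2) with hr
  have hr1 : 1 < r := Real.one_lt_rpow (by norm_num) (by linarith)
  refine ⟨C * (r / (r - 1)), fun n hn => (hC n hn).trans ?_⟩
  have hn0 : (0 : ℝ) < n := by exact_mod_cast hn
  have hT := (hpos n hn).le
  have hnγ : (0 : ℝ) < (n : ℝ) ^ (γ - 2) := Real.rpow_pos_of_pos hn0 _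
  have hpow : ∀ l : ℕ, ((2 : ℝ) ^ l) ^ (γ - 2) = r ^ l := by
    intro l
    rw [hr, ← Real.rpow_natCast, ← Real.rpow_mul (by norm_num), mul_comm,
      Real.rpow_mul (by norm_num), Real.rpow_natCast]
  have key : ∑ l ∈ range (Nat.log 2 n + 1), ((2 : ℝ) ^ l / n) ^ (γ - 2) ≤ r / (r - 1) := by
    have : ∀ l ∈ range (Nat.log 2 n + 1), ((2 : ℝ) ^ l / n) ^ (γ - 2) =
        r ^ l / (n : ℝ) ^ (γ - 2) := fun l _ => by
      rw [Real.div_rpow (by positivity) hn0.le, hpow]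
    rw [sum_congr rfl this, ← sum_div, geom_sum_eq hr1.ne', div_right_comm]
    refine div_le_div_of_nonneg_right ?_ (by linarith)
    rw [div_le_iff₀ hnγ, pow_succ]
    have hle : r ^ Nat.log 2 n ≤ (n : ℝ) ^ (γ - 2) := by
      rw [← hpow]
      refine Real.rpow_le_rpow (by positivity) ?_ (by linarith)
      exact_mod_cast Nat.pow_log_le_self 2 (by omega)
    nlinarith
  calc C * T n * _ ≤ C * T n * (r / (r - 1)) := by gcongr
    _ = _ := by ring

theorem one_le_two_mul_log {n : ℕ} (hn : 1 ≤ n) : 1 ≤ 2 * Real.log (n + 1) := by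
  have h₁ : Real.log 2 ≤ Real.log (n + 1) :=
    Real.log_le_log (by norm_num) (by have : (1 : ℝ) ≤ n := by exact_mod_cast hn
                                      linarith)
  have := Real.log_two_gt_d9
  linarith

/-- For `γ = 2` every term is one, so the sum is the number of levels. The constant `4` comes from
`log 2 ≥ 1 / 2`, used for the binary logarithm and for the additional level. -/
theorem GrowsAtLeastLike.exists_productWeight_le_log (h : GrowsAtLeastLike 2 T)
    (hpos : ∀ n, 1 ≤ n → 0 < T n) :
    ∃ E : ℝ, ∀ n : ℕ, 1 ≤ n → productWeight T n ≤ E * (T n * Real.log (n + 1)) := by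
  obtain ⟨C, hC0, hC⟩ := h.exists_productWeight_le_sum hpos
  refine ⟨C * 4, fun n hn => (hC n hn).trans ?_⟩
  have hT := (hpos n hn).le
  have h₀ := one_le_two_mul_log hn
  have h₁ : (Nat.log 2 n : ℝ) ≤ 2 * Real.log (n + 1) := by
    have h₂ : (2 : ℝ) ^ Nat.log 2 n ≤ n + 1 := by
      exact_mod_cast (Nat.pow_log_le_self 2 (by omega)).trans (Nat.le_succ n)
    have h₃ := Real.log_le_log (by positivity) h₂
    rw [Real.log_pow] at h₃
    have h₄ := Real.log_two_gt_d9
    have h₅ : (0 : ℝ) ≤ Nat.log 2 n := Nat.cast_nonneg _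
    nlinarith
  simp only [sub_self, Real.rpow_zero, sum_const, card_range, nsmul_eq_mul, mul_one]
  push_cast
  calc C * T n * ((Nat.log 2 n : ℝ) + 1) ≤ C * T n * (4 * Real.log (n + 1)) := by
        gcongr; linarith
    _ = _ := by ring

end Growth

/-! ### The total cost and the assembly -/

namespace EditDP

section Cost

open Finset

theorem card_filter_dvd_mul_le (M q : ℕ) :
    #{t ∈ range M | q ∣ t} * q ≤ M + q := by
  have h : #{t ∈ range M | q ∣ t} ≤ M / q + 1 := by
    rw [← card_range (M / q + 1)]
    refine card_le_card_of_injOn (· / q) (fun t ht => ?_) ?_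
    · simp only [coe_filter, mem_range, Set.mem_ofPred_eq] at ht
      simpa using Nat.lt_succ_of_le (Nat.div_le_div_right ht.1.le)
    · intro t ht u hu h
      simp only [coe_filter, mem_range, Set.mem_ofPred_eq] at ht hu
      exact (Nat.div_left_inj ht.2 hu.2).1 h
  calc _ ≤ (M / q + 1) * q := Nat.mul_le_mul_right _ h
    _ ≤ M + q := by rw [add_mul, one_mul]; have := Nat.div_mul_le_self M q; omega

/-- Exchanging the sums over times and levels reduces the cost to counting multiples of `4 ^ l`
below `4 n²`. As `2 ^ l ≤ n`, there are at most `5 n² / 4 ^ l` of them, the fifth part covering the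
rounding. -/
theorem sum_levelsCost_le {g : CodedInstance} {Dt : ℕ → ℕ} {T : ℕ → ℝ} {K a : ℝ} {n G : ℕ}
    (hn : 1 ≤ n) (hn' : n = max g.len 1) (hG : g.rules + 1 ≤ G)
    (hDt : ∀ p : ℕ, 1 ≤ p → (Dt p : ℝ) ≤ K * T p)
    (hT : ∀ p : ℕ, 1 ≤ p → (p : ℝ) ^ 2 ≤ a * T p) :
    ((∑ t ∈ range (2 * n * (2 * n)), levelsCost g Dt t : ℕ) : ℝ) ≤
      5 * (G * (2 * K + 2600 * a)) * productWeight T n := by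
  have hlog : Nat.log 2 g.len = Nat.log 2 n := by
    rcases Nat.eq_zero_or_pos g.len with h | h
    · simp [hn', h]
    · rw [hn', max_eq_left h]
  have hG1 : (1 : ℝ) ≤ G := by exact_mod_cast (by omega : 1 ≤ G)
  unfold levelsCost productWeight
  rw [sum_comm, hlog, mul_sum, Nat.cast_sum]
  refine sum_le_sum fun l hl => ?_
  have hl' : 2 ^ l ≤ n := Nat.pow_le_of_le_log (by omega) (by have := mem_range.1 hl; omega)
  set X := 2 * multiplyCost g Dt (2 ^ l) + 200 with hX
  have hX' : (X : ℝ) ≤ G * (2 * K + 2600 * a) * T (2 ^ l) := by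
    have h₁ := hDt (2 ^ l) Nat.one_le_two_pow
    have h₂ := hT (2 ^ l) Nat.one_le_two_pow
    have h₃ : X ≤ 2 * (G * (Dt (2 ^ l) + 600 * (2 ^ l * 2 ^ l + 1))) + 200 := by
      rw [hX, multiplyCost]; gcongr
    have h₄ : (X : ℝ) ≤ 2 * (G * (Dt (2 ^ l) + 600 * (2 ^ l * 2 ^ l + 1))) + 200 := by
      exact_mod_cast h₃
    have h₅ : (1 : ℝ) ≤ 2 ^ l := one_le_pow₀ (by norm_num)
    push_cast at h₂
    generalize (2 : ℝ) ^ l = p at *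
    calc (X : ℝ) ≤ 2 * (G * (Dt (2 ^ l) + 600 * (p * p + 1))) + 200 := h₄
      -- `2600 = 1200 + 1200 + 200`, since `p` and `G` are at least one.
      _ ≤ G * (2 * Dt (2 ^ l) + 2600 * p ^ 2) := by
        have h₆ : (G : ℝ) * 1 ≤ G * p ^ 2 := by gcongr; exact one_le_pow₀ h₅
        generalize (Dt (2 ^ l) : ℝ) = d
        linear_combination 1200 * h₆ + 200 * (hG1.trans ((mul_one _).ge.trans h₆))
      _ ≤ G * (2 * (K * T (2 ^ l)) + 2600 * (a * T (2 ^ l))) := by gcongr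
      _ = _ := by ring
  have hsum : ∑ t ∈ range (2 * n * (2 * n)), (if Due g t l then X else 0) ≤
      #{t ∈ range (2 * n * (2 * n)) | 2 ^ l * 2 ^ l ∣ t} * X := by
    rw [← sum_filter, sum_const, smul_eq_mul]
    refine Nat.mul_le_mul_right _ (card_le_card ?_)
    exact monotone_filter_right _ fun t _ h => h.2
  have hc := card_filter_dvd_mul_le (2 * n * (2 * n)) (2 ^ l * 2 ^ l)
  set c := #{t ∈ range (2 * n * (2 * n)) | 2 ^ l * 2 ^ l ∣ t}
  have hc' : c * (2 ^ l * 2 ^ l) ≤ 5 * (n * n) := by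
    have h₁ := Nat.mul_le_mul hl' hl'
    have h₂ : 2 * n * (2 * n) = 4 * (n * n) := by ring
    omega
  have h4 : (4 : ℝ) ^ l = 2 ^ l * 2 ^ l := by rw [← mul_pow]; norm_num
  have hc'' : (c : ℝ) ≤ 5 * (n ^ 2 / 4 ^ l) := by
    rw [h4, mul_div_assoc', le_div_iff₀ (by positivity), sq]
    exact_mod_cast hc'
  calc ((∑ t ∈ range (2 * n * (2 * n)), if Due g t l then X else 0 : ℕ) : ℝ)
      ≤ ((c * X : ℕ) : ℝ) := by exact_mod_cast hsum
    _ = c * X := by push_cast; rfl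
    _ ≤ 5 * (n ^ 2 / 4 ^ l) * (G * (2 * K + 2600 * a) * T (2 ^ l)) := by gcongr
    _ = _ := by ring

theorem programCost_le {g : CodedInstance} {Dt : ℕ → ℕ} {T : ℕ → ℝ} {K a : ℝ} {G : ℕ}
    (hG : g.rules + 1 ≤ G) (hG' : g.nts ≤ G)
    (hDt : ∀ p : ℕ, 1 ≤ p → (Dt p : ℝ) ≤ K * T p)
    (hT : ∀ p : ℕ, 1 ≤ p → (p : ℝ) ^ 2 ≤ a * T p) :
    (programCost g Dt (2 * max g.len 1) : ℝ) ≤ (G : ℝ) ^ 2 * (8000 * (max g.len 1 : ℕ) ^ 2) +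
      5 * (G * (2 * K + 2600 * a)) * productWeight T (max g.len 1) := by
  have hs := sum_levelsCost_le (le_max_right g.len 1) rfl hG hDt hT
  have hlen := le_max_left g.len 1
  have hn := le_max_right g.len 1
  generalize max g.len 1 = n at *
  unfold programCost
  generalize ∑ t ∈ range (2 * n * (2 * n)), levelsCost g Dt t = Z at *
  have h₁ : g.nts * (2 * n) * (2 * n) ≤ 4 * (G * G * (n * n)) := by
    calc g.nts * (2 * n) * (2 * n) = 4 * (g.nts * 1 * (n * n)) := by ring
      _ ≤ 4 * (G * G * (n * n)) := by gcongr; omega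
  have h₂ : 2 * n * (2 * n) * (700 * ((g.nts + 1) * (g.rules + 1)) + 200) ≤
      6400 * (G * G * (n * n)) := by
    calc _ ≤ 2 * n * (2 * n) * (700 * ((G + G) * G) + 200 * (G * G)) := by
          have : 1 ≤ G * G := Nat.mul_pos (by omega) (by omega)
          gcongr
          all_goals omega
      _ = 6400 * (G * G * (n * n)) := by ring
  have h₃ : n * n ≤ G * G * (n * n) := Nat.le_mul_of_pos_left _ (Nat.mul_pos (by omega) (by omega))
  have h₄ : n ≤ n * n := Nat.le_mul_of_pos_left _ hn
  have h₅ : 2 * n * (2 * n) = 4 * (n * n) := by ring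
  have key : 30 * (g.len + 1) + (g.nts * (2 * n) * (2 * n) * 60 + 50) +
      (2 * n * (2 * n) * 100 + 100) + (Z + 2 * n * (2 * n) *
        (700 * ((g.nts + 1) * (g.rules + 1)) + 200) + 50) + 20 ≤
      G * G * (n * n) * 8000 + Z := by
    linarith
  have key' := (Nat.cast_le (α := ℝ)).2 key
  push_cast at key' ⊢
  calc _ ≤ _ := key'
    _ ≤ (G : ℝ) * G * (n * n) * 8000 + _ := add_le_add_right hs _
    _ = _ := by ring

end Cost

theorem multipliesWithin {D : RamProg} {K c : ℕ} {T : ℕ → ℝ}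
    (hD : ∀ n : ℕ, 1 ≤ n → ∀ (X Y : Matrix (Fin n) (Fin n) ℕ) (M : ℕ),
      (∀ i j, X i j ≤ M) → (∀ i j, Y i j ≤ M) →
      ∀ B : ℕ, (n + M + 2) ^ c ≤ B → ∀ σ : RamState, σ.IsWord B →
        σ 0 0 = n → σ.HoldsMatrix 1 X → σ.HoldsMatrix 2 Y →
        D.HaltsWithin B σ (K * T n) fun σ' => σ'.HoldsMatrix 3 (distanceProduct X Y)) :
    MultipliesWithin D c fun n => ⌊K * T n⌋₊ := by
  intro n hn X Y M hX hY B hB σ hσ h0 h1 h2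
  obtain ⟨t, σ', h₁, h₂, h₃⟩ := hD n hn X Y M hX hY B hB σ hσ h0 h1 h2
  exact ⟨t, σ', h₁, Nat.le_floor h₂, h₃⟩

/-- Every run takes at least one step, so the time bound `K * T n` is at least one. It is enough to
multiply zero matrices. -/
theorem pos_of_distanceProduct {D : RamProg} {K c : ℕ} {T : ℕ → ℝ}
    (hD : ∀ n : ℕ, 1 ≤ n → ∀ (X Y : Matrix (Fin n) (Fin n) ℕ) (M : ℕ),
      (∀ i j, X i j ≤ M) → (∀ i j, Y i j ≤ M) →
      ∀ B : ℕ, (n + M + 2) ^ c ≤ B → ∀ σ : RamState, σ.IsWord B →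
        σ 0 0 = n → σ.HoldsMatrix 1 X → σ.HoldsMatrix 2 Y →
        D.HaltsWithin B σ (K * T n) fun σ' => σ'.HoldsMatrix 3 (distanceProduct X Y))
    (n : ℕ) (hn : 1 ≤ n) : 0 < T n := by
  obtain ⟨t, σ', h₁, h₂, -⟩ := hD n hn 0 0 0 (fun _ _ => le_rfl) (fun _ _ => le_rfl)
    ((n + 0 + 2) ^ c + n + 1) (by omega) (fun a _ => if a = 0 then n else 0)
    (fun a i => by dsimp only; split_ifs <;> omega) rfl (fun _ _ => rfl) (fun _ _ => rfl)
  have h₃ : (1 : ℝ) ≤ t := by exact_mod_cast h₁.one_le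
  exact pos_of_mul_pos_right (by linarith) (Nat.cast_nonneg K)

theorem exists_codes {m : ℕ} {G : ContextFreeGrammar (Fin m)} {s : List (Fin m)} {σ : RamState}
    (hG : G.IsCNF) (h : σ.HoldsInstance G s) :
    ∃ (g : CodedInstance) (ν : G.NT ≃ Fin g.nts), g.Codes G ν s ∧ g.code = σ 1 ∧ g.text = σ 2 ∧
      σ 0 0 = g.nts ∧ σ 0 1 = ν G.initial ∧ σ 0 2 = g.rules ∧ σ 0 3 = g.len ∧
      g.nts + g.rules ≤ G.size := by
  classical
  obtain ⟨k, ν, L, hL, hL', h0, h1, h2, h3, hr, ht⟩ := h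
  refine ⟨⟨σ 1, σ 2, k, L.length, s.length⟩, ν, ⟨hG, fun r hr' => ?_, fun i hi => ?_, rfl, ht⟩,
    rfl, rfl, h0, h1, h2, h3, ?_⟩
  · obtain ⟨i, hi, rfl⟩ := List.getElem_of_mem ((hL' r).2 hr')
    exact ⟨i, hi, hr i hi⟩
  · exact ⟨L[i], (hL' _).1 (List.getElem_mem hi), hr i hi⟩
  · have h₁ : Nat.card G.NT = k := by rw [Nat.card_congr ν, Nat.card_eq_fintype_card, Fintype.card_fin]
    have h₂ : L.length = G.rules.card := by
      rw [← List.toFinset_card_of_nodup hL]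
      congr 1
      ext r
      rw [List.mem_toFinset, hL']
    unfold ContextFreeGrammar.size
    rw [h₁, h₂, Finset.card_eq_sum_ones]
    exact Nat.add_le_add_left (Finset.sum_le_sum fun r _ => Nat.le_add_right _ _) _

/-- Three factors `W` bound the size of the table, and seven more, each at least `3`, dominate the
numerical constants: `2187 = 3 ^ 7`. -/
theorem setting_of_pow_le {g : CodedInstance} (hg : g.Valid) {B N W c : ℕ} (hN : g.len < N)
    (hN' : N ≤ 2 * max g.len 1) (hW : g.nts + g.rules + g.len + 2 ≤ W) (hW' : 3 ≤ W)
    (hB : W ^ (c + 10) ≤ B) : Setting g B N := by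
  have h₁ : 2187 * (W * W * W) ≤ B := by
    calc 2187 * (W * W * W) = 1 * 3 ^ 7 * W ^ 3 := by ring
      _ ≤ W ^ c * W ^ 7 * W ^ 3 := by gcongr; exact Nat.one_le_pow _ _ (by omega)
      _ = W ^ (c + 10) := by ring
      _ ≤ B := hB
  have h₂ : N ≤ 2 * W := hN'.trans (Nat.mul_le_mul_left _ (by omega))
  have h₃ : N * N ≤ 4 * (W * W) := (Nat.mul_le_mul h₂ h₂).trans (by ring_nf; rfl)
  have h₄ : g.nts * N * N ≤ 4 * (W * W * W) := by
    calc g.nts * N * N = g.nts * (N * N) := by ring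
      _ ≤ W * (4 * (W * W)) := Nat.mul_le_mul (by omega) h₃
      _ = _ := by ring
  have h₅ : W ≤ W * W := Nat.le_mul_of_pos_left _ (by omega)
  have h₆ : W * W ≤ W * W * W := Nat.le_mul_of_pos_right _ (by omega)
  exact ⟨hg, hN, by omega, by omega, by omega, by omega⟩

/-- The function `F` is `T n` or `T n * log (n + 1)`, so both parts of the theorem follow from one
estimate. Only the bound on `productWeight` distinguishes them. -/
theorem languageEditDistanceInTime {T F : ℕ → ℝ} (hT : DistanceProductInTime T) {E a : ℝ}
    (ha : 0 ≤ a) (hF : ∀ n, 1 ≤ n → 0 ≤ F n) (hTn : ∀ n, 1 ≤ n → 0 < T n)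
    (hsq : ∀ n : ℕ, 1 ≤ n → (n : ℝ) ^ 2 ≤ a * T n) (hTF : ∀ n, 1 ≤ n → T n ≤ 2 * F n)
    (hw : ∀ n, 1 ≤ n → productWeight T n ≤ E * F n) :
    LanguageEditDistanceInTime fun g n => (g : ℝ) ^ 2 * F n := by
  obtain ⟨D, K, c, hD⟩ := hT
  -- The first summand comes from `8000 n² ≤ 8000 a T n` and `T n ≤ 2 F n`, the second from the
  -- block products. In the word size, `2 * c` serves the subroutine, as `2 * g.len + 3 ≤ W ^ 2`,
  -- and `10` the table.
  refine ⟨program D, ⌈16000 * a + 5 * (2 * K + 2600 * a) * E⌉₊, 2 * c + 10, ?_⟩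
  intro m G s hG hε B hB σ hσ hI
  obtain ⟨g, ν, hg, hcode, htext, h0, h1, h2, h3, hsize⟩ := exists_codes hG hI
  have hA := (ν G.initial).2
  have hlen := hg.len_eq
  set W := G.size + s.length + m + 2 with hW
  have hW3 : 3 ≤ W := by omega
  have hc : (2 * g.len + 3) ^ c ≤ B := by
    calc (2 * g.len + 3) ^ c ≤ (W ^ 2) ^ c := by
          refine Nat.pow_le_pow_left ?_ c
          nlinarith
      _ = W ^ (2 * c) := (pow_mul _ _ _).symm
      _ ≤ W ^ (2 * c + 10) := Nat.pow_le_pow_right (by omega) (by omega)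
      _ ≤ B := hB
  have S : ∀ N, g.len < N → N ≤ 2 * max g.len 1 → Setting g B N := fun N h h' =>
    setting_of_pow_le hg.valid h h' (by omega) hW3 hB
  have hB10 : 2 * g.len + 10 < B := by
    have h₁ := Nat.pow_le_pow_right (show 0 < W by omega) (show 3 ≤ 2 * c + 10 by omega)
    have h₂ : 9 * W ≤ W ^ 3 := by nlinarith [Nat.mul_le_mul hW3 hW3]
    omega
  obtain ⟨t, σ', h₁, h₂, h₃⟩ := runs_program (multipliesWithin hD) S hc hB10 hσ
    (fun ρ hρ => ⟨by rw [hρ 0 (by norm_num), h0], by rw [hρ 0 (by norm_num), h2],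
      by rw [hρ 0 (by norm_num), h3], by rw [hρ 1 (by norm_num), hcode],
      by rw [hρ 2 (by norm_num), htext], rfl⟩) h1 hA
  refine ⟨t, σ', h₁, ?_, ?_⟩
  · have hcost := programCost_le (g := g) (G := G.size) (T := T) (K := K) (by omega) (by omega)
      (fun p hp => Nat.floor_le (mul_nonneg (Nat.cast_nonneg K) (hTn p hp).le)) hsq
    rw [hlen] at hcost h₂
    have hn := le_max_right s.length 1
    generalize max s.length 1 = n at *
    have e₁ := hsq n hn
    have e₂ := hTF n hn
    have e₃ := hF n hn
    have e₄ := hw n hn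
    have hG1 : (1 : ℝ) ≤ G.size := by exact_mod_cast (by omega : 1 ≤ G.size)
    have hG2 : (G.size : ℝ) ≤ (G.size : ℝ) ^ 2 := by nlinarith
    calc (t : ℝ) ≤ _ := by exact_mod_cast h₂
      _ ≤ _ := hcost
      _ ≤ (G.size : ℝ) ^ 2 * (8000 * (a * (2 * F n))) +
          5 * ((G.size : ℝ) ^ 2 * (2 * K + 2600 * a)) * (E * F n) := by
        have := productWeight_nonneg hTn n
        gcongr
        exact e₁.trans (by gcongr)
      _ = (16000 * a + 5 * (2 * K + 2600 * a) * E) * ((G.size : ℝ) ^ 2 * F n) := by ring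
      _ ≤ _ := by gcongr; exact Nat.le_ceil _
  · exact h₃.trans (by rw [hg.languageEditDistance_eq hε, hlen])

end EditDP

theorem mainTheorem6 (T : ℕ → ℝ) (hT : DistanceProductInTime T) :
    (∀ γ : ℝ, 2 < γ → GrowsAtLeastLike γ T →
      LanguageEditDistanceInTime fun g n => (g : ℝ) ^ 2 * T n) ∧
    (GrowsAtLeastLike 2 T →
      LanguageEditDistanceInTime fun g n => (g : ℝ) ^ 2 * (T n * Real.log (n + 1))) := by
  have hpos : ∀ n, 1 ≤ n → 0 < T n := by
    obtain ⟨D, K, c, hD⟩ := hT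
    exact EditDP.pos_of_distanceProduct hD
  constructor
  · intro γ hγ h
    obtain ⟨a, ha, hsq⟩ := h.exists_sq_le hγ.le hpos
    obtain ⟨E, hw⟩ := h.exists_productWeight_le hγ hpos
    exact EditDP.languageEditDistanceInTime hT ha (fun n hn => (hpos n hn).le) hpos hsq
      (fun n hn => by linarith [hpos n hn]) hw
  · intro h
    obtain ⟨a, ha, hsq⟩ := h.exists_sq_le le_rfl hpos
    obtain ⟨E, hw⟩ := h.exists_productWeight_le_log hpos
    refine EditDP.languageEditDistanceInTime (F := fun n => T n * Real.log (n + 1)) hT ha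
      (fun n hn => ?_) hpos hsq (fun n hn => ?_) hw
    · have := one_le_two_mul_log hn
      exact mul_nonneg (hpos n hn).le (by linarith)
    -- `2 * log (n + 1) ≥ 1` already for `n = 1`, which is why `T n ≤ 2 * F n` is required instead
    -- of `T n ≤ F n`.
    · have := one_le_two_mul_log hn
      have := hpos n hn
      nlinarith
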